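/- Let $G=\mathbb R\ltimes\mathbb R$ be the affine group with law $(a,b)(a',b')=(a+a',\,b+e^{-a}b')$ and left Haar measure $d\mu(a,b)=e^a\,da\,db$, and let $\mathcal A=\mathcal D(G)_*$ be the $*$-algebra of smooth compactly supported functions $f:G\to\mathbb C$ with the convolution product $(f*g)(p)=\int_G f(q)\,g(q^{-1}p)\,d\mu(q)$ and the involution $f^*(a,b)=e^{-a}\,\overline{f((a,b)^{-1})}$. Define $\delta_1,\delta_2:\mathcal A\to\mathcal A$ by $$(\delta_1f)(a,b)=i\,a\,f(a,b),\qquad (\delta_2f)(a,b)=-f(a,b)-b\,\partial_bf(a,b).$$ For $\nu\in\{-,0,+\}$ (read as $-1,0,1$) let $\pi_\nu$ be the representation on $L^2(\mathbb R,ds)$ $$(\pi_\nu(a,b)\phi)(s)=e^{i\nu b e^{-s}}\phi(s+a),\qquad \pi_\nu(f)=\int_{\mathbb R^2}f(a,b)\,\pi_\nu(a,b)\,e^a\,da\,db .$$ Let $\mathcal H=\bigoplus_{\nu=+,0,-}L^2(\mathbb R)\otimes\mathbb C^2$ and $\pi=\bigoplus_{\nu}\mathrm{Diag}(\pi_\nu,\pi_\nu)$.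 With $\partial_1=s$, $\partial_2=-i\,d/ds$, $\gamma^1=\begin{pmatrix}0&1\\1&0\end{pmatrix}$ and $\gamma^2=\begin{pmatrix}0&-i\\i&0\end{pmatrix}$, let $\mathcal D$ be the closure of the operator $\gamma^k\partial_k$ (acting in each of the three summands) defined on vectors whose components are all Schwartz functions, and let $\chi=-i\gamma^1\gamma^2$. Then: 1. $(\mathcal A,\mathcal H,\mathcal D)$ is an even spectral triple with grading $\chi$: $\pi$ is a faithful $*$-representation of $\mathcal A$ by bounded operators; $\mathcal D$ is self-adjoint; for every $f\in\mathcal A$, $\pi(f)$ preserves $\mathrm{dom}\,\mathcal D$, $[\mathcal D,\pi(f)]$ is bounded, and $\pi(f)(\mathcal D-z)^{-1}$ is compact for $z\in\mathbb C\setminus\mathbb R$; moreover $\chi=\chi^*$, $\chi^2=1$, $[\chi,\pi(f)]=0$, $\chi$ preserves $\mathrm{dom}\,\mathcal D$, and $\mathcal D\chi=-\chi\mathcal D$. 2. The triple is regular: for every $f\in\mathcal A$, both $\pi(f)$ and $[\mathcal D,\pi(f)]$ lie in $\bigcap_{n\ge0}\mathrm{dom}\,\delta^n$, where $\delta=[|\mathcal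 D|,\cdot\,]$. 3. In each of the three summands $$\mathcal D^2=\begin{pmatrix}H-1&0\\0&H+1\end{pmatrix},\qquad H=-\frac{d^2}{ds^2}+s^2,$$ where the right-hand side is the closure of the operator defined on Schwartz functions; and $\mathcal D$ has compact resolvent. 4. For every $f\in\mathcal A$, $[\mathcal D,\pi(f)]=\gamma^k\,\pi(i\,\delta_kf)$ (sum over $k=1,2$). -/

import Mathlib

open MeasureTheory Distributions
open scoped SchwartzMap InnerProductSpace ContDiff

noncomputable section

namespace AffineTriple

/-! ### The affine group and its convolution algebra of test functions -/

/-- The product `(a, b) (a', b') = (a + a', b + exp (-a) b')` of the affine group, whose underlying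
manifold is the plane. -/
def grpMul (p q : ℝ × ℝ) : ℝ × ℝ := (p.1 + q.1, p.2 + Real.exp (-p.1) * q.2)

/-- The inverse `(a, b)⁻¹ = (-a, -exp a b)`. -/
def grpInv (p : ℝ × ℝ) : ℝ × ℝ := (-p.1, -(Real.exp p.1 * p.2))

/-- The algebra of smooth compactly supported complex functions on the affine group; the product
and the involution are defined below. -/
def TestAlg : Type := 𝓓((⊤ : TopologicalSpace.Opens (ℝ × ℝ)), ℂ)

namespace TestAlg

instance : AddCommGroup TestAlg :=
  inferInstanceAs (AddCommGroup 𝓓((⊤ : TopologicalSpace.Opens (ℝ × ℝ)), ℂ))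

instance : Module ℂ TestAlg :=
  inferInstanceAs (Module ℂ 𝓓((⊤ : TopologicalSpace.Opens (ℝ × ℝ)), ℂ))

instance : FunLike TestAlg (ℝ × ℝ) ℂ :=
  inferInstanceAs (FunLike 𝓓((⊤ : TopologicalSpace.Opens (ℝ × ℝ)), ℂ) (ℝ × ℝ) ℂ)

theorem contDiff (f : TestAlg) : ContDiff ℝ ∞ f := TestFunction.contDiff f

theorem continuous (f : TestAlg) : Continuous f := f.contDiff.continuous

theorem hasCompactSupport (f : TestAlg) : HasCompactSupport f := TestFunction.hasCompactSupport f

/-- Build an element of the algebra from a smooth compactly supported function. -/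
def mk (f : ℝ × ℝ → ℂ) (h : ContDiff ℝ ∞ f) (h' : HasCompactSupport f) : TestAlg :=
  (⟨f, h, h', Set.subset_univ _⟩ : 𝓓((⊤ : TopologicalSpace.Opens (ℝ × ℝ)), ℂ))

@[simp] theorem mk_apply (f : ℝ × ℝ → ℂ) (h : ContDiff ℝ ∞ f) (h' : HasCompactSupport f)
    (p : ℝ × ℝ) : mk f h h' p = f p := rfl

@[ext] theorem ext {f g : TestAlg} (h : ∀ p, f p = g p) : f = g := DFunLike.ext _ _ h

@[simp] theorem add_apply (f g : TestAlg) (p : ℝ × ℝ) : (f + g) p = f p + g p := rfl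
@[simp] theorem zero_apply (p : ℝ × ℝ) : (0 : TestAlg) p = 0 := rfl
@[simp] theorem smul_apply (c : ℂ) (f : TestAlg) (p : ℝ × ℝ) : (c • f) p = c * f p := rfl

end TestAlg

theorem continuous_grpMul : Continuous fun x : (ℝ × ℝ) × (ℝ × ℝ) => grpMul x.1 x.2 := by
  unfold grpMul; fun_prop

theorem continuous_grpInv : Continuous grpInv := by
  unfold grpInv; fun_prop

theorem contDiff_grpMul : ContDiff ℝ ∞ fun x : (ℝ × ℝ) × (ℝ × ℝ) => grpMul x.1 x.2 := by
  unfold grpMul; fun_prop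

theorem contDiff_grpInv : ContDiff ℝ ∞ grpInv := by
  unfold grpInv; fun_prop

theorem grpMul_assoc (p q r : ℝ × ℝ) : grpMul (grpMul p q) r = grpMul p (grpMul q r) := by
  ext <;> simp [grpMul, Real.exp_add] <;> ring

theorem grpInv_grpInv (p : ℝ × ℝ) : grpInv (grpInv p) = p := by
  ext
  · simp [grpInv]
  · simp [grpInv, ← mul_assoc, ← Real.exp_add]

theorem grpInv_mul (p q : ℝ × ℝ) : grpInv (grpMul p q) = grpMul (grpInv q) (grpInv p) := by
  ext
  · simp [grpInv, grpMul]
  · simp [grpInv, grpMul, Real.exp_add, Real.exp_neg]; field_simp; try ring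

theorem grpInv_mul_cancel_left (p q : ℝ × ℝ) : grpMul (grpInv p) (grpMul p q) = q := by
  ext
  · simp [grpInv, grpMul]
  · simp [grpInv, grpMul, Real.exp_neg]; field_simp; try ring

theorem grpMul_inv_cancel_left (p q : ℝ × ℝ) : grpMul p (grpMul (grpInv p) q) = q := by
  have := grpInv_mul_cancel_left (grpInv p) q
  rwa [grpInv_grpInv] at this

/-- Left invariance of the Haar measure `exp a da db`. -/
theorem integral_grpMul (r : ℝ × ℝ) {F : ℝ × ℝ → ℂ} (hF : Continuous F)
    (hF' : HasCompactSupport F) :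
    ∫ q : ℝ × ℝ, (Real.exp q.1 : ℂ) * F (grpMul r q) = ∫ q : ℝ × ℝ, (Real.exp q.1 : ℂ) * F q := by
  have i1 : Integrable (fun q : ℝ × ℝ => (Real.exp q.1 : ℂ) * F q) (volume.prod volume) :=
    Continuous.integrable_of_hasCompactSupport (by fun_prop) hF'.mul_left
  have hs : HasCompactSupport fun q => F (grpMul r q) := by
    refine HasCompactSupport.intro
      (hF'.isCompact.image (f := grpMul (grpInv r)) (continuous_grpMul.comp (by fun_prop : Continuous fun q => (grpInv r, q)))) ?_
    intro q hq
    by_contra h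
    exact hq ⟨grpMul r q, subset_tsupport _ h, grpInv_mul_cancel_left _ _⟩
  have hc : Continuous fun q => F (grpMul r q) :=
    hF.comp (continuous_grpMul.comp (by fun_prop : Continuous fun q => (r, q)))
  have i2 : Integrable (fun q : ℝ × ℝ => (Real.exp q.1 : ℂ) * F (grpMul r q))
      (volume.prod volume) :=
    Continuous.integrable_of_hasCompactSupport
      ((by fun_prop : Continuous fun q : ℝ × ℝ => (Real.exp q.1 : ℂ)).mul hc) hs.mul_left
  rw [Measure.volume_eq_prod, integral_prod _ i1, integral_prod _ i2]
  simp only [integral_const_mul]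
  have key : ∀ x : ℝ, ∫ y : ℝ, F (grpMul r (x, y)) = (Real.exp r.1 : ℂ) * ∫ y : ℝ, F (r.1 + x, y) := by
    intro x
    have h1 := Measure.integral_comp_mul_left (fun y => F (r.1 + x, r.2 + y)) (Real.exp (-r.1))
    have h2 := integral_add_left_eq_self (μ := volume) (fun y => F (r.1 + x, y)) r.2
    simp only [grpMul]
    rw [h1, h2, abs_inv, abs_of_pos (Real.exp_pos _), ← Real.exp_neg, neg_neg]
    simp
  simp only [key]
  rw [← integral_add_left_eq_self (μ := volume)
    (fun x : ℝ => (Real.exp x : ℂ) * ∫ y : ℝ, F (x, y)) r.1]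
  refine integral_congr_ae (Filter.Eventually.of_forall fun x => ?_)
  simp only [Real.exp_add]
  push_cast
  ring

theorem contDiff_integral_param {Φ : ℝ × ℝ → ℝ × ℝ → ℂ} {k : Set (ℝ × ℝ)} (hk : IsCompact k)
    (h : ∀ p q, q ∉ k → Φ p q = 0) (hΦ : ContDiff ℝ ∞ fun x : (ℝ × ℝ) × (ℝ × ℝ) => Φ x.1 x.2) :
    ContDiff ℝ ∞ fun p => ∫ q, Φ p q := by
  have := contDiffOn_convolution_right_with_param (μ := (volume : Measure (ℝ × ℝ))) (n := ⊤)
    (ContinuousLinearMap.lsmul ℝ ℝ) (f := fun _ : ℝ × ℝ => (1 : ℝ))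
    (g := fun p q => Φ p (-q)) (s := Set.univ) (k := -k) isOpen_univ hk.neg
    (fun p q _ hq => h p (-q) (by simpa using hq)) (locallyIntegrable_const _)
    (ContDiff.contDiffOn (hΦ.comp (contDiff_fst.prodMk contDiff_snd.neg)))
  rw [Set.univ_prod_univ, contDiffOn_univ] at this
  have h2 := this.comp ((contDiff_id (𝕜 := ℝ) (E := ℝ × ℝ)).prodMk (contDiff_const (c := (0 : ℝ × ℝ))))
  have e : (fun p => ∫ q, Φ p q) = (fun q : (ℝ × ℝ) × (ℝ × ℝ) => convolution
      (fun _ : ℝ × ℝ => (1 : ℝ)) (fun r => Φ q.1 (-r)) (ContinuousLinearMap.lsmul ℝ ℝ)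
      volume q.2) ∘ fun x => (id x, (0 : ℝ × ℝ)) := by
    ext p
    simp [convolution]
  rw [e]
  exact h2

namespace TestAlg

/-- The convolution `(f * g) p = ∫ f q * g (q⁻¹ p) dμ q` for the left Haar measure
`dμ (a, b) = exp a da db`. -/
def conv (f g : ℝ × ℝ → ℂ) (p : ℝ × ℝ) : ℂ :=
  ∫ q : ℝ × ℝ, (Real.exp q.1 : ℂ) * (f q * g (grpMul (grpInv q) p))

theorem contDiff_conv (f g : TestAlg) : ContDiff ℝ ∞ (conv f g) := by
  refine contDiff_integral_param f.hasCompactSupport.isCompact (fun p q hq => ?_) ?_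
  · rw [image_eq_zero_of_notMem_tsupport hq]; simp
  · have h1 : ContDiff ℝ ∞ fun x : (ℝ × ℝ) × (ℝ × ℝ) => f x.2 := f.contDiff.comp contDiff_snd
    have h2 : ContDiff ℝ ∞ fun x : (ℝ × ℝ) × (ℝ × ℝ) => g (grpMul (grpInv x.2) x.1) :=
      g.contDiff.comp (contDiff_grpMul.comp ((contDiff_grpInv.comp contDiff_snd).prodMk contDiff_fst))
    have h3 : ContDiff ℝ ∞ fun x : (ℝ × ℝ) × (ℝ × ℝ) => (Real.exp x.2.1 : ℂ) :=
      Complex.ofRealCLM.contDiff.comp (Real.contDiff_exp.comp (contDiff_fst.comp contDiff_snd))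
    exact h3.mul (h1.mul h2)

theorem hasCompactSupport_conv (f g : TestAlg) : HasCompactSupport (conv f g) := by
  refine HasCompactSupport.intro
    ((f.hasCompactSupport.isCompact.prod g.hasCompactSupport.isCompact).image continuous_grpMul) ?_
  intro p hp
  unfold conv
  rw [integral_eq_zero_of_ae (Filter.Eventually.of_forall fun q => ?_)]
  by_cases h : q ∈ tsupport f
  · by_cases h' : grpMul (grpInv q) p ∈ tsupport g
    · exact absurd ⟨(q, grpMul (grpInv q) p), ⟨h, h'⟩, grpMul_inv_cancel_left _ _⟩ hp
    · simp [image_eq_zero_of_notMem_tsupport h']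
  · simp [image_eq_zero_of_notMem_tsupport h]

instance : Mul TestAlg := ⟨fun f g => mk (conv f g) (contDiff_conv f g) (hasCompactSupport_conv f g)⟩

theorem mul_apply (f g : TestAlg) (p : ℝ × ℝ) :
    (f * g) p = ∫ q : ℝ × ℝ, (Real.exp q.1 : ℂ) * (f q * g (grpMul (grpInv q) p)) := rfl

theorem hasCompactSupport_star (f : TestAlg) :
    HasCompactSupport fun p : ℝ × ℝ => (Real.exp (-p.1) : ℂ) * (starRingEnd ℂ) (f (grpInv p)) := by
  refine HasCompactSupport.intro (f.hasCompactSupport.isCompact.image continuous_grpInv) ?_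
  intro p hp
  by_cases h : grpInv p ∈ tsupport f
  · exact absurd ⟨grpInv p, h, grpInv_grpInv p⟩ hp
  · simp [image_eq_zero_of_notMem_tsupport h]

theorem contDiff_star (f : TestAlg) :
    ContDiff ℝ ∞ fun p : ℝ × ℝ => (Real.exp (-p.1) : ℂ) * (starRingEnd ℂ) (f (grpInv p)) :=
  (Complex.ofRealCLM.contDiff.comp (Real.contDiff_exp.comp contDiff_fst.neg)).mul
    (Complex.conjCLE.contDiff.comp (f.contDiff.comp contDiff_grpInv))

/-- The involution `f* (a, b) = exp (-a) * conj (f ((a, b)⁻¹))`. -/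
instance : Star TestAlg := ⟨fun f => mk _ (contDiff_star f) (hasCompactSupport_star f)⟩

theorem star_apply (f : TestAlg) (p : ℝ × ℝ) :
    (star f) p = (Real.exp (-p.1) : ℂ) * (starRingEnd ℂ) (f (grpInv p)) := rfl

theorem integrable_conv (f g : TestAlg) (p : ℝ × ℝ) :
    Integrable fun q : ℝ × ℝ => (Real.exp q.1 : ℂ) * (f q * g (grpMul (grpInv q) p)) := by
  have h1 := f.continuous
  have h2 : Continuous fun q => g (grpMul (grpInv q) p) :=
    g.continuous.comp (continuous_grpMul.comp (continuous_grpInv.prodMk continuous_const))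
  exact Continuous.integrable_of_hasCompactSupport
    ((by fun_prop : Continuous fun q : ℝ × ℝ => (Real.exp q.1 : ℂ)).mul (h1.mul h2))
    f.hasCompactSupport.mul_right.mul_left

protected theorem left_distrib (f g h : TestAlg) : f * (g + h) = f * g + f * h := by
  ext p
  simp only [mul_apply, add_apply, mul_add]
  exact integral_add (integrable_conv f g p) (integrable_conv f h p)

protected theorem right_distrib (f g h : TestAlg) : (f + g) * h = f * h + g * h := by
  ext p
  simp only [mul_apply, add_apply, mul_add, add_mul]
  exact integral_add (integrable_conv f h p) (integrable_conv g h p)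

protected theorem smul_mul (c : ℂ) (f g : TestAlg) : (c • f) * g = c • (f * g) := by
  ext p
  simp only [mul_apply, smul_apply, ← integral_const_mul]
  congr 1; ext q; ring

protected theorem mul_smul (c : ℂ) (f g : TestAlg) : f * (c • g) = c • (f * g) := by
  ext p
  simp only [mul_apply, smul_apply, ← integral_const_mul]
  congr 1; ext q; ring

protected theorem mul_assoc (f g h : TestAlg) : f * g * h = f * (g * h) := by
  ext p
  have hcont : Continuous fun x : (ℝ × ℝ) × (ℝ × ℝ) => (Real.exp x.1.1 : ℂ) *
      (((Real.exp x.2.1 : ℂ) * (f x.2 * g (grpMul (grpInv x.2) x.1))) *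
        h (grpMul (grpInv x.1) p)) := by
    have h1 := f.continuous
    have h2 : Continuous fun x : (ℝ × ℝ) × (ℝ × ℝ) => g (grpMul (grpInv x.2) x.1) :=
      g.continuous.comp (continuous_grpMul.comp
        ((continuous_grpInv.comp continuous_snd).prodMk continuous_fst))
    have h3 : Continuous fun x : (ℝ × ℝ) × (ℝ × ℝ) => h (grpMul (grpInv x.1) p) :=
      h.continuous.comp (continuous_grpMul.comp
        ((continuous_grpInv.comp continuous_fst).prodMk continuous_const))
    have h4 : Continuous fun x : (ℝ × ℝ) × (ℝ × ℝ) => (Real.exp x.1.1 : ℂ) := by fun_prop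
    have h5 : Continuous fun x : (ℝ × ℝ) × (ℝ × ℝ) => (Real.exp x.2.1 : ℂ) := by fun_prop
    exact h4.mul ((h5.mul ((h1.comp continuous_snd).mul h2)).mul h3)
  have hsupp : HasCompactSupport fun x : (ℝ × ℝ) × (ℝ × ℝ) => (Real.exp x.1.1 : ℂ) *
      (((Real.exp x.2.1 : ℂ) * (f x.2 * g (grpMul (grpInv x.2) x.1))) *
        h (grpMul (grpInv x.1) p)) := by
    refine HasCompactSupport.intro
      (((f.hasCompactSupport.isCompact.prod g.hasCompactSupport.isCompact).image
        continuous_grpMul).prod f.hasCompactSupport.isCompact) ?_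
    rintro ⟨q, r⟩ hx
    by_cases hr : r ∈ tsupport f
    · by_cases h' : grpMul (grpInv r) q ∈ tsupport g
      · exact absurd ⟨⟨(r, grpMul (grpInv r) q), ⟨hr, h'⟩, grpMul_inv_cancel_left _ _⟩, hr⟩ hx
      · simp [image_eq_zero_of_notMem_tsupport h']
    · simp [image_eq_zero_of_notMem_tsupport hr]
  have hint : Integrable (Function.uncurry fun q r : ℝ × ℝ => (Real.exp q.1 : ℂ) *
      (((Real.exp r.1 : ℂ) * (f r * g (grpMul (grpInv r) q))) *
        h (grpMul (grpInv q) p))) (volume.prod volume) :=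
    hcont.integrable_of_hasCompactSupport hsupp
  have key : ∀ r : ℝ × ℝ, ∫ q : ℝ × ℝ, (Real.exp q.1 : ℂ) *
      (g (grpMul (grpInv r) q) * h (grpMul (grpInv q) p)) = (g * h) (grpMul (grpInv r) p) := by
    intro r
    have hc : Continuous fun q => g (grpMul (grpInv r) q) * h (grpMul (grpInv q) p) :=
      (g.continuous.comp (continuous_grpMul.comp (continuous_const.prodMk continuous_id))).mul
        (h.continuous.comp (continuous_grpMul.comp (continuous_grpInv.prodMk continuous_const)))
    have hs : HasCompactSupport fun q => g (grpMul (grpInv r) q) * h (grpMul (grpInv q) p) := by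
      refine HasCompactSupport.intro (g.hasCompactSupport.isCompact.image (f := grpMul r)
        (continuous_grpMul.comp (continuous_const.prodMk continuous_id))) ?_
      intro q hq
      by_cases h' : grpMul (grpInv r) q ∈ tsupport g
      · exact absurd ⟨_, h', grpMul_inv_cancel_left _ _⟩ hq
      · simp [image_eq_zero_of_notMem_tsupport h']
    rw [← integral_grpMul r hc hs, mul_apply]
    simp only [grpInv_mul_cancel_left, grpInv_mul, grpMul_assoc]
  rw [mul_apply, mul_apply]
  simp only [mul_apply f g]
  calc _ = ∫ q : ℝ × ℝ, ∫ r : ℝ × ℝ, (Real.exp q.1 : ℂ) *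
        (((Real.exp r.1 : ℂ) * (f r * g (grpMul (grpInv r) q))) * h (grpMul (grpInv q) p)) := by
        simp only [integral_const_mul, integral_mul_const]
    _ = ∫ r : ℝ × ℝ, ∫ q : ℝ × ℝ, (Real.exp q.1 : ℂ) *
        (((Real.exp r.1 : ℂ) * (f r * g (grpMul (grpInv r) q))) * h (grpMul (grpInv q) p)) :=
        integral_integral_swap hint
    _ = _ := by
        congr 1; ext r
        rw [← key r, ← integral_const_mul, ← integral_const_mul]
        congr 1; ext q; ring

instance : NonUnitalRing TestAlg where
  left_distrib := TestAlg.left_distrib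
  right_distrib := TestAlg.right_distrib
  zero_mul f := by ext p; simp [mul_apply]
  mul_zero f := by ext p; simp [mul_apply]
  mul_assoc := TestAlg.mul_assoc

instance : IsScalarTower ℂ TestAlg TestAlg := ⟨TestAlg.smul_mul⟩

instance : SMulCommClass ℂ TestAlg TestAlg := ⟨fun c f g => (TestAlg.mul_smul c f g).symm⟩

protected theorem star_mul (f g : TestAlg) : star (f * g) = star g * star f := by
  ext p
  have hc : Continuous fun q => (starRingEnd ℂ) (g (grpInv q) * f (grpMul (grpInv p) q)) :=
    Complex.continuous_conj.comp ((g.continuous.comp continuous_grpInv).mul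
      (f.continuous.comp (continuous_grpMul.comp (continuous_const.prodMk continuous_id))))
  have hs : HasCompactSupport
      fun q => (starRingEnd ℂ) (g (grpInv q) * f (grpMul (grpInv p) q)) := by
    refine HasCompactSupport.intro (g.hasCompactSupport.isCompact.image continuous_grpInv) ?_
    intro q hq
    by_cases h' : grpInv q ∈ tsupport g
    · exact absurd ⟨_, h', grpInv_grpInv q⟩ hq
    · simp [image_eq_zero_of_notMem_tsupport h']
  have := integral_grpMul p hc hs
  simp only [grpInv_mul, grpInv_mul_cancel_left] at this
  rw [star_apply, mul_apply, mul_apply, ← integral_conj, ← integral_const_mul]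
  simp only [star_apply, grpInv_mul, grpInv_grpInv]
  calc _ = (Real.exp (-p.1) : ℂ) * ∫ q : ℝ × ℝ, (Real.exp q.1 : ℂ) *
        (starRingEnd ℂ) (g (grpMul (grpInv q) (grpInv p)) * f q) := by
        rw [← integral_const_mul]
        congr 1; ext q
        simp only [map_mul, Complex.conj_ofReal]; ring
    _ = _ := by
        rw [this, ← integral_const_mul]
        congr 1; ext q
        have e : (Real.exp (-(grpMul (grpInv q) p).1) : ℂ) = Real.exp q.1 * Real.exp (-p.1) := by
          simp [grpMul, grpInv, Complex.exp_add, mul_comm]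
        have e' : (Real.exp q.1 : ℂ) * Real.exp (-q.1) = 1 := by
          rw [← Complex.ofReal_mul, ← Real.exp_add]; simp
        rw [e, map_mul]
        linear_combination (-(Real.exp q.1 : ℂ) * (Real.exp (-p.1) : ℂ) * (starRingEnd ℂ) (g (grpInv q)) * (starRingEnd ℂ) (f (grpMul (grpInv p) q))) * e'

instance : StarRing TestAlg where
  star_involutive f := by
    ext p
    rw [star_apply, star_apply, grpInv_grpInv]
    have e' : (Real.exp (-p.1) : ℂ) * Real.exp (-(grpInv p).1) = 1 := by
      rw [← Complex.ofReal_mul, ← Real.exp_add]; simp [grpInv]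
    simp only [map_mul, Complex.conj_ofReal, Complex.conj_conj]
    linear_combination (f p) * e'
  star_mul := TestAlg.star_mul
  star_add f g := by
    ext p
    simp only [star_apply, add_apply, map_add]; ring

instance : StarModule ℂ TestAlg where
  star_smul c f := by
    ext p
    simp only [star_apply, smul_apply, map_mul]
    rw [Complex.star_def]; ring

end TestAlg

/-! ### Derivations -/

namespace TestAlg

theorem contDiff_del₁ (f : TestAlg) :
    ContDiff ℝ ∞ fun p : ℝ × ℝ => Complex.I * (p.1 : ℂ) * f p :=
  (contDiff_const.mul (Complex.ofRealCLM.contDiff.comp contDiff_fst)).mul f.contDiff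

/-- The directional derivative in the second variable. -/
def dirDeriv (f : TestAlg) (p : ℝ × ℝ) : ℂ := fderiv ℝ f p (0, 1)

theorem contDiff_dirDeriv (f : TestAlg) : ContDiff ℝ ∞ f.dirDeriv :=
  (f.contDiff.fderiv_right (m := ∞) (by simp)).clm_apply contDiff_const

theorem hasCompactSupport_dirDeriv (f : TestAlg) : HasCompactSupport f.dirDeriv :=
  f.hasCompactSupport.fderiv_apply ℝ (0, 1)

/-- The derivation `δ₁`, the generator of the automorphism group
`f ↦ ((a, b) ↦ exp (i t a) f (a, b))`: `δ₁ f (a, b) = i a f (a, b)`. -/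
def del₁ (f : TestAlg) : TestAlg :=
  mk (fun p => Complex.I * (p.1 : ℂ) * f p) f.contDiff_del₁ f.hasCompactSupport.mul_left

/-- The derivation `δ₂`, the generator of the automorphism group
`f ↦ ((a, b) ↦ exp (-u) f (a, exp (-u) b))`: `δ₂ f (a, b) = - f (a, b) - b ∂_b f (a, b)`. -/
def del₂ (f : TestAlg) : TestAlg :=
  mk (fun p => -f p - (p.2 : ℂ) * f.dirDeriv p)
    (f.contDiff.neg.sub ((Complex.ofRealCLM.contDiff.comp contDiff_snd).mul f.contDiff_dirDeriv))
    (by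
      have h := f.hasCompactSupport.neg.add
        ((f.hasCompactSupport_dirDeriv.mul_left (f := fun p : ℝ × ℝ => (p.2 : ℂ))).neg)
      simpa [sub_eq_add_neg, Pi.add_def, Pi.neg_def, Pi.mul_def] using h)

/-- The two derivations. -/
def del : Fin 2 → TestAlg → TestAlg := ![del₁, del₂]

end TestAlg

/-! ### The representations on the line -/

/-- `L²(ℝ)`. -/
abbrev L2 : Type := Lp ℂ 2 (volume : Measure ℝ)

/-- The function `s ↦ exp (i ν b exp (-s))`. -/
def phase (ν : SignType) (b s : ℝ) : ℂ :=
  Complex.exp (Complex.I * (((ν : ℝ) * b * Real.exp (-s) : ℝ) : ℂ))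

theorem continuous_phase (ν : SignType) : Continuous fun x : ℝ × ℝ => phase ν x.1 x.2 := by
  unfold phase; fun_prop

theorem norm_phase (ν : SignType) (b s : ℝ) : ‖phase ν b s‖ = 1 := by
  unfold phase; rw [mul_comm]; exact Complex.norm_exp_ofReal_mul_I _

/-- Translation on `L²(ℝ)`: `φ ↦ (s ↦ φ (s + a))`. -/
def trans (a : ℝ) (φ : L2) : L2 :=
  Lp.compMeasurePreserving (fun s => s + a) (measurePreserving_add_right volume a) φ

theorem memLp_phase_mul (ν : SignType) (b : ℝ) (φ : L2) :
    MemLp (fun s => phase ν b s * φ s) 2 volume := by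
  refine (Lp.memLp φ).congr_norm ?_ ?_
  · exact (Continuous.aestronglyMeasurable ((continuous_phase ν).comp
      (by fun_prop : Continuous fun s : ℝ => (b, s)))).mul (Lp.aestronglyMeasurable φ)
  · exact Filter.Eventually.of_forall fun s => by simp [norm_phase]

/-- The unitary `φ ↦ (s ↦ exp (i ν b exp (-s)) φ (s + a))` representing the group element
`(a, b)`. -/
def unitaryRep (ν : SignType) (p : ℝ × ℝ) (φ : L2) : L2 :=
  (memLp_phase_mul ν p.2 (trans p.1 φ)).toLp

theorem unitaryRep_ae (ν : SignType) (p : ℝ × ℝ) (φ : L2) :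
    unitaryRep ν p φ =ᵐ[volume] fun s => phase ν p.2 s * φ (s + p.1) := by
  refine (MemLp.coeFn_toLp _).trans ?_
  filter_upwards [Lp.coeFn_compMeasurePreserving φ (measurePreserving_add_right volume p.1)]
    with s hs
  simp only [trans, hs, Function.comp]

theorem norm_unitaryRep (ν : SignType) (p : ℝ × ℝ) (φ : L2) : ‖unitaryRep ν p φ‖ = ‖φ‖ := by
  rw [unitaryRep, Lp.norm_toLp, ← Lp.norm_compMeasurePreserving φ
    (measurePreserving_add_right volume p.1), Lp.norm_def]
  congr 1
  exact eLpNorm_congr_norm_ae (Filter.Eventually.of_forall fun s => by simp [norm_phase, trans])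

theorem quasi_shift {P : ℝ → Prop} (a : ℝ) (h : ∀ᵐ s, P s) : ∀ᵐ s : ℝ, P (s + a) :=
  (measurePreserving_add_right volume a).quasiMeasurePreserving.ae h

theorem unitaryRep_add (ν : SignType) (p : ℝ × ℝ) (φ ψ : L2) :
    unitaryRep ν p (φ + ψ) = unitaryRep ν p φ + unitaryRep ν p ψ := by
  apply Lp.ext
  filter_upwards [unitaryRep_ae ν p (φ + ψ), unitaryRep_ae ν p φ, unitaryRep_ae ν p ψ,
    Lp.coeFn_add (unitaryRep ν p φ) (unitaryRep ν p ψ), quasi_shift p.1 (Lp.coeFn_add φ ψ)]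
    with s h1 h2 h3 h4 h5
  simp only [h1, h4, Pi.add_apply, h2, h3, h5]; ring

theorem unitaryRep_smul (ν : SignType) (p : ℝ × ℝ) (c : ℂ) (φ : L2) :
    unitaryRep ν p (c • φ) = c • unitaryRep ν p φ := by
  apply Lp.ext
  filter_upwards [unitaryRep_ae ν p (c • φ), unitaryRep_ae ν p φ,
    Lp.coeFn_smul c (unitaryRep ν p φ), quasi_shift p.1 (Lp.coeFn_smul c φ)]
    with s h1 h2 h4 h5
  simp only [h1, h4, Pi.smul_apply, h2, h5, smul_eq_mul]; ring

theorem continuous_trans (φ : L2) : Continuous fun a : ℝ => trans a φ := by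
  let g : C(ℝ, C(ℝ, ℝ)) :=
    (ContinuousMap.mk (fun x : ℝ × ℝ => x.2 + x.1) (by fun_prop)).curry
  exact Continuous.compMeasurePreservingLp (f := fun _ : ℝ => φ) (g := g) continuous_const
    g.continuous (fun a => measurePreserving_add_right volume a) (by simp)

/-- Multiplication by the phase. -/
def phaseMul (ν : SignType) (b : ℝ) (φ : L2) : L2 := (memLp_phase_mul ν b φ).toLp

theorem continuous_phaseMul (ν : SignType) (φ : L2) : Continuous fun b : ℝ => phaseMul ν b φ := by
  rw [continuous_iff_continuousAt]
  intro b₀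
  rw [ContinuousAt, tendsto_iff_norm_sub_tendsto_zero]
  have hm : ∀ b, MemLp (fun s => phase ν b s * φ s - phase ν b₀ s * φ s) 2 volume := fun b =>
    (memLp_phase_mul ν b φ).sub (memLp_phase_mul ν b₀ φ)
  have hn : ∀ b, ‖phaseMul ν b φ - phaseMul ν b₀ φ‖ =
      (∫ s, ‖phase ν b s * φ s - phase ν b₀ s * φ s‖ ^ (2 : ℝ)) ^ (2 : ℝ)⁻¹ := by
    intro b
    have h := (hm b).eLpNorm_eq_integral_rpow_norm (by norm_num) (by norm_num)
    have e : phaseMul ν b φ - phaseMul ν b₀ φ = (hm b).toLp := rfl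
    rw [e, Lp.norm_toLp, h, ENNReal.toReal_ofReal]
    · simp
    · positivity
  simp only [hn]
  have hφ : Integrable (fun s => ‖φ s‖ ^ (2 : ℝ)) volume := by
    simpa using (Lp.memLp φ).integrable_norm_rpow (by norm_num) (by norm_num)
  have h0 : (0 : ℝ) = (∫ s, ‖phase ν b₀ s * φ s - phase ν b₀ s * φ s‖ ^ (2 : ℝ)) ^ (2 : ℝ)⁻¹ := by
    simp
  rw [h0]
  refine Filter.Tendsto.rpow_const ?_ (Or.inr (by norm_num))
  refine tendsto_integral_filter_of_dominated_convergence (fun s => 4 * ‖φ s‖ ^ (2 : ℝ)) ?_ ?_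
    (hφ.const_mul 4) ?_
  · exact Filter.Eventually.of_forall fun b =>
      ((hm b).aestronglyMeasurable.norm.aemeasurable.pow_const (2 : ℝ)).aestronglyMeasurable
  · refine Filter.Eventually.of_forall fun b => Filter.Eventually.of_forall fun s => ?_
    rw [Real.norm_of_nonneg (by positivity)]
    have h1 : ‖phase ν b s * φ s - phase ν b₀ s * φ s‖ ≤ 2 * ‖φ s‖ := by
      refine (norm_sub_le _ _).trans ?_
      simp only [norm_mul, norm_phase]; linarith
    simp only [Real.rpow_two]
    nlinarith [norm_nonneg (phase ν b s * φ s - phase ν b₀ s * φ s), norm_nonneg (φ s)]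
  · refine Filter.Eventually.of_forall fun s => ?_
    have hc : Continuous fun b : ℝ => phase ν b s :=
      (continuous_phase ν).comp (by fun_prop : Continuous fun b : ℝ => (b, s))
    have hc' : Continuous fun b : ℝ => ‖phase ν b s * φ s - phase ν b₀ s * φ s‖ ^ (2 : ℝ) := by
      simp only [Real.rpow_two]; fun_prop
    exact hc'.tendsto b₀

theorem norm_phaseMul_sub (ν : SignType) (b : ℝ) (φ ψ : L2) :
    ‖phaseMul ν b φ - phaseMul ν b ψ‖ = ‖φ - ψ‖ := by
  have e : phaseMul ν b φ - phaseMul ν b ψ =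
      ((memLp_phase_mul ν b φ).sub (memLp_phase_mul ν b ψ)).toLp := rfl
  rw [e, Lp.norm_toLp, Lp.norm_def]
  congr 1
  refine eLpNorm_congr_norm_ae ?_
  filter_upwards [Lp.coeFn_sub φ ψ] with s hs
  simp only [Pi.sub_apply, hs, ← mul_sub, norm_mul, norm_phase, one_mul]

theorem continuous_unitaryRep (ν : SignType) (φ : L2) :
    Continuous fun p : ℝ × ℝ => unitaryRep ν p φ := by
  rw [continuous_iff_continuousAt]
  rintro ⟨a₀, b₀⟩
  rw [ContinuousAt, tendsto_iff_norm_sub_tendsto_zero]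
  have h1 : Continuous fun p : ℝ × ℝ =>
      ‖trans p.1 φ - trans a₀ φ‖ + ‖phaseMul ν p.2 (trans a₀ φ) - phaseMul ν b₀ (trans a₀ φ)‖ :=
    ((((continuous_trans φ).comp continuous_fst).sub continuous_const).norm).add
      ((((continuous_phaseMul ν (trans a₀ φ)).comp continuous_snd).sub continuous_const).norm)
  have h2 := h1.tendsto (a₀, b₀)
  simp only [sub_self, norm_zero, add_zero] at h2
  refine squeeze_zero (fun _ => norm_nonneg _) (fun p => ?_) h2
  have e : ∀ p : ℝ × ℝ, unitaryRep ν p φ = phaseMul ν p.2 (trans p.1 φ) := fun _ => rfl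
  rw [e, e, ← norm_phaseMul_sub ν p.2 (trans p.1 φ) (trans a₀ φ)]
  exact norm_sub_le_norm_sub_add_norm_sub _ _ _

theorem integrable_rep (ν : SignType) (f : TestAlg) (φ : L2) :
    Integrable fun p : ℝ × ℝ => ((Real.exp p.1 : ℂ) * f p) • unitaryRep ν p φ := by
  have h : Continuous fun p : ℝ × ℝ => (Real.exp p.1 : ℂ) * f p :=
    (by fun_prop : Continuous fun p : ℝ × ℝ => (Real.exp p.1 : ℂ)).mul f.continuous
  exact (h.smul (continuous_unitaryRep ν φ)).integrable_of_hasCompactSupport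
    (f.hasCompactSupport.mul_left.smul_right)

/-- The integrated representation `π_ν(f) = ∫ f(a, b) π_ν(a, b) exp a da db` on `L²(ℝ)`, as a
bounded operator (the integral converges strongly). -/
def repOn (ν : SignType) (f : TestAlg) : L2 →L[ℂ] L2 :=
  LinearMap.mkContinuous
    { toFun := fun φ => ∫ p : ℝ × ℝ, ((Real.exp p.1 : ℂ) * f p) • unitaryRep ν p φ
      map_add' := fun φ ψ => by
        simp only [unitaryRep_add, smul_add]
        exact integral_add (integrable_rep ν f φ) (integrable_rep ν f ψ)
      map_smul' := fun c φ => by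
        simp only [unitaryRep_smul, RingHom.id_apply, ← integral_smul]
        congr 1; ext p : 1; rw [smul_comm] }
    (∫ p : ℝ × ℝ, ‖(Real.exp p.1 : ℂ) * f p‖)
    (fun φ => by
      refine (norm_integral_le_integral_norm _).trans (le_of_eq ?_)
      simp only [norm_smul, norm_unitaryRep, integral_mul_const])

/-! ### The Hilbert space, the representation and the Dirac operator -/

/-- The Hilbert sum over `ν ∈ {-, 0, +}` of `L²(ℝ) ⊗ ℂ²`; the component `(ν, j)` of a vector is its
`j`-th spinor component in the summand `ν`. -/
abbrev HSpace : Type := PiLp 2 fun _ : SignType × Fin 2 => L2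

/-- The operator acting by `π_ν(f)` on both spinor components of the summand `ν`. -/
def rep (f : TestAlg) : HSpace →L[ℂ] HSpace :=
  (PiLp.continuousLinearEquiv 2 ℂ fun _ : SignType × Fin 2 => L2).symm.toContinuousLinearMap ∘L
    ContinuousLinearMap.pi fun i => repOn i.1 f ∘L PiLp.proj 2 (fun _ : SignType × Fin 2 => L2) i

/-- The operator by which a two-by-two matrix acts on the spinor components. -/
def spinMat (M : Matrix (Fin 2) (Fin 2) ℂ) : HSpace →L[ℂ] HSpace :=
  (PiLp.continuousLinearEquiv 2 ℂ fun _ : SignType × Fin 2 => L2).symm.toContinuousLinearMap ∘L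
    ContinuousLinearMap.pi fun i =>
      ∑ j, M i.2 j • PiLp.proj 2 (fun _ : SignType × Fin 2 => L2) (i.1, j)

/-- The Pauli matrices `γ¹` and `γ²`. -/
def gam : Fin 2 → Matrix (Fin 2) (Fin 2) ℂ :=
  ![!![0, 1; 1, 0], !![0, -Complex.I; Complex.I, 0]]

/-- The grading `χ = -i γ¹ γ²`. -/
def grading : HSpace →L[ℂ] HSpace := spinMat ((-Complex.I) • (gam 0 * gam 1))

/-- The operators `∂₁ φ (s) = s φ (s)` and `∂₂ φ (s) = -i φ' (s)` on Schwartz functions. -/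
def pder : Fin 2 → 𝓢(ℝ, ℂ) →ₗ[ℂ] 𝓢(ℝ, ℂ) :=
  ![(SchwartzMap.smulLeftCLM ℂ (fun s : ℝ => (s : ℂ))).toLinearMap,
    (-Complex.I) • (SchwartzMap.derivCLM ℂ ℂ).toLinearMap]

/-- The harmonic oscillator `H φ (s) = -φ'' (s) + s ^ 2 φ (s)` on Schwartz functions. -/
def oscillator : 𝓢(ℝ, ℂ) →ₗ[ℂ] 𝓢(ℝ, ℂ) :=
  (SchwartzMap.smulLeftCLM ℂ (fun s : ℝ => (s : ℂ) ^ 2)).toLinearMap -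
    (SchwartzMap.derivCLM ℂ ℂ).toLinearMap ∘ₗ (SchwartzMap.derivCLM ℂ ℂ).toLinearMap

/-- Families of Schwartz functions. -/
abbrev SCore : Type := SignType × Fin 2 → 𝓢(ℝ, ℂ)

/-- The inclusion of the families of Schwartz functions into the Hilbert space. -/
def coreIncl : SCore →ₗ[ℂ] HSpace :=
  (WithLp.linearEquiv 2 ℂ (SignType × Fin 2 → L2)).symm.toLinearMap ∘ₗ
    LinearMap.pi fun i =>
      (SchwartzMap.toLpCLM ℂ ℂ 2 (volume : Measure ℝ)).toLinearMap ∘ₗ LinearMap.proj i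

/-- The unbounded operator with domain the Schwartz families and action `T`, that is, the operator
with graph `{(φ, T φ) | φ Schwartz}`. -/
def ofCore (T : SCore →ₗ[ℂ] SCore) : HSpace →ₗ.[ℂ] HSpace :=
  (LinearMap.range (coreIncl.prod (coreIncl ∘ₗ T))).toLinearPMap

/-- `γ^k ∂_k` on families of Schwartz functions. -/
def diracCore : SCore →ₗ[ℂ] SCore :=
  LinearMap.pi fun i => ∑ k, ∑ j, gam k i.2 j • (pder k ∘ₗ LinearMap.proj (i.1, j))

/-- The Dirac operator `𝒟`: the closure of `γ^k ∂_k` on Schwartz functions. -/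
def dirac : HSpace →ₗ.[ℂ] HSpace := (ofCore diracCore).closure

/-- `diag (H - 1, H + 1)` in each summand, on families of Schwartz functions. -/
def oscillatorCore : SCore →ₗ[ℂ] SCore :=
  LinearMap.pi fun i =>
    oscillator ∘ₗ LinearMap.proj i + (![-1, 1] i.2 : ℂ) • LinearMap.proj i

/-- The self-adjoint operator `diag (H - 1, H + 1)` in each summand. -/
def oscillatorOp : HSpace →ₗ.[ℂ] HSpace := (ofCore oscillatorCore).closure

/-! ### Spectral triples -/

section SpectralTriple

variable {H : Type*} [NormedAddCommGroup H] [InnerProductSpace ℂ H]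

/-- The graph of the product `S T` of unbounded operators, on its natural domain
`{x ∈ dom T | T x ∈ dom S}`. -/
def graphMul (S T : H →ₗ.[ℂ] H) : Set (H × H) :=
  {x | ∃ z, (x.1, z) ∈ T.graph ∧ (z, x.2) ∈ S.graph}

/-- `C` is the bounded operator `[D, T]`: `T` preserves the domain of `D` and `D T - T D = C` on
that domain. -/
def IsCommutator (D : H →ₗ.[ℂ] H) (T C : H →L[ℂ] H) : Prop :=
  ∀ x : D.domain, ∃ h : T x ∈ D.domain, D ⟨T x, h⟩ - T (D x) = C x

/-- `R` is the bounded inverse of `D - z`. -/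
def IsResolvent (D : H →ₗ.[ℂ] H) (z : ℂ) (R : H →L[ℂ] H) : Prop :=
  (∀ y, ∃ h : R y ∈ D.domain, D ⟨R y, h⟩ - z • R y = y) ∧
    ∀ x : D.domain, R (D x - z • (x : H)) = x

/-- The resolvents `(D - z)⁻¹`, for `z` not real, exist and are compact. -/
def HasCompactResolvent (D : H →ₗ.[ℂ] H) : Prop :=
  ∀ z : ℂ, z.im ≠ 0 → ∃ R, IsResolvent D z R ∧ IsCompactOperator R

/-- `T` lies in the domain of the `n`-th power of the derivation `[P, ·]`. -/
def InDomDeltaPow (P : H →ₗ.[ℂ] H) : ℕ → (H →L[ℂ] H) → Prop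
  | 0, _ => True
  | n + 1, T => ∃ C, IsCommutator P T C ∧ InDomDeltaPow P n C

variable [CompleteSpace H]

/-- `P = |D|`, the positive self-adjoint square root of `D† D`. -/
structure IsAbs (D P : H →ₗ.[ℂ] H) : Prop where
  selfAdjoint : IsSelfAdjoint P
  nonneg : ∀ x : P.domain, 0 ≤ (⟪P x, (x : H)⟫_ℂ).re
  sq : graphMul P P = graphMul D.adjoint D

variable {A : Type*} [NonUnitalRing A] [StarRing A] [Module ℂ A]

/-- A spectral triple over a possibly non-unital algebra: a faithful `*`-representation `π` by
bounded operators and a self-adjoint operator `D` with bounded commutators `[D, π a]` and compact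
`π a (D - z)⁻¹`. -/
structure IsSpectralTriple (π : A → H →L[ℂ] H) (D : H →ₗ.[ℂ] H) : Prop where
  starHom : ∃ ρ : A →⋆ₙₐ[ℂ] (H →L[ℂ] H), ∀ a, ρ a = π a
  faithful : Function.Injective π
  selfAdjoint : IsSelfAdjoint D
  boundedCommutator : ∀ a, ∃ C, IsCommutator D (π a) C
  locallyCompact : ∀ a, ∀ z : ℂ, z.im ≠ 0 →
    ∃ R, IsResolvent D z R ∧ IsCompactOperator (π a ∘L R)

/-- An even spectral triple with grading `χ`: a self-adjoint unitary commuting with the algebra and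
anticommuting with `D`. -/
structure IsEvenSpectralTriple (π : A → H →L[ℂ] H) (D : H →ₗ.[ℂ] H) (χ : H →L[ℂ] H) : Prop
    extends IsSpectralTriple π D where
  grading_selfAdjoint : IsSelfAdjoint χ
  grading_sq : χ * χ = 1
  grading_comm : ∀ a, χ * π a = π a * χ
  grading_anticomm : ∀ x : D.domain, ∃ h : χ x ∈ D.domain, D ⟨χ x, h⟩ = -χ (D x)

/-- Regularity: `π a` and `[D, π a]` lie in the domain of every power of the derivation
`[|D|, ·]`. -/
def IsRegularTriple (π : A → H →L[ℂ] H) (D : H →ₗ.[ℂ] H) : Prop :=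
  ∃ P, IsAbs D P ∧ ∀ a n, InDomDeltaPow P n (π a) ∧
    ∀ C, IsCommutator D (π a) C → InDomDeltaPow P n C

end SpectralTriple

end AffineTriple

end

open AffineTriple

/-! The proof is a computation in the Hermite basis. There `s - d/ds` and `s + d/ds` raise and lower
the index with coefficients `√(2(n+1))` and `√(2n)`, and `γ^k ∂_k` is the off-diagonal matrix formed
by these two operators. So the Dirac operator sends each basis vector of `HSpace` to a weight
`√(2(n+j))` times another basis vector, and the pairing is an involution that preserves the weight.
For every such weighted involution (`WPerm`), the operator on its maximal domain is self-adjoint, it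
is the closure of any restriction defined on the basis vectors, its square and its absolute value
are diagonal, and its resolvent is an explicit sum of two monomial matrices, compact when the
weights tend to infinity. Through `dirac_eq` and `oscillatorOp_eq` this gives self-adjointness,
compact resolvent, the grading relation and the formula for the square.

The commutators rest on two facts. Multiplication by `s` and translation by `a` differ by the factor
`a`, which gives `δ₁`. Differentiating the phase in `s` amounts to applying `-b ∂_b` to it, and
integration by parts in `b` moves this onto `f`, which gives `δ₂`. The identity is needed only for
matrix elements between Schwartz functions (`inner_pder_repOn`). As the domain of the Dirac operator
is maximal, `WPerm.isCommutator_op` deduces from matrix elements both that the domain is preserved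
and what the commutator is.

For regularity, a commutator with `|𝒟|` multiplies a matrix entry by the difference `p i - p j` of
weights, so these powers times the matrix of `π(f)` must be bounded (`inDomDeltaPow_of_bddMat`). The
ladder relations write `2(m-n)` times the matrix of `π_ν(f)` through matrices of other algebra
elements with coefficients of size `√m` or `√n`. Hence `(m-n)^l` costs `l` factors `√(m+1)` or
`√(n+1)`, distributed at will (`bddOrder_repMat`). With `x = √(2(m+j)+1)` and `y = √(2(n+j')+1)` one
has `x - y = (xy/(x+y)²) (1/x + 1/y) (x² - y²)`. The last two factors are controlled by the previous
estimate, and the first is a bounded Schur multiplier (`BddMat.schur`). Passing from `x` to `p` is a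
bounded diagonal perturbation.

Faithfulness is injectivity of the Fourier transform in `b`: the values `ν e^{-s}` with `ν = ±1`
exhaust the non-zero frequencies. -/

noncomputable section

namespace AffineTriple

/-! ### Self-adjoint operators given by weighted involutions of a Hilbert basis -/

/-- Real weights on an index set together with an involution preserving them. -/
structure WPerm (ι : Type*) where
  p : ι → ℝ
  σ : ι → ι
  σσ : ∀ i, σ (σ i) = i
  pσ : ∀ i, p (σ i) = p i

/-! ### Coordinates in a Hilbert basis and monomial operators. -/

section HilbertBasis

variable {ι : Type*} {H : Type*} [NormedAddCommGroup H] [InnerProductSpace ℂ H]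

theorem basis_hasSum (b : HilbertBasis ι ℂ H) (x : H) : HasSum (fun i => ⟪b i, x⟫_ℂ • b i) x := by
  simpa [b.repr_apply_apply] using b.hasSum_repr x

theorem basis_ext (b : HilbertBasis ι ℂ H) {x y : H} (h : ∀ i, ⟪b i, x⟫_ℂ = ⟪b i, y⟫_ℂ) : x = y :=
  (basis_hasSum b x).unique (by simpa only [h] using basis_hasSum b y)

theorem basis_hasSum_norm_sq (b : HilbertBasis ι ℂ H) (x : H) :
    HasSum (fun i => ‖⟪b i, x⟫_ℂ‖ ^ 2) (‖x‖ ^ 2) := by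
  have h := Complex.hasSum_re (b.hasSum_inner_mul_inner x x)
  rw [inner_self_eq_norm_sq_to_K] at h
  have e : ∀ i, (⟪x, b i⟫_ℂ * ⟪b i, x⟫_ℂ).re = ‖⟪b i, x⟫_ℂ‖ ^ 2 := by
    intro i
    rw [← inner_conj_symm, mul_comm, Complex.mul_conj, Complex.ofReal_re, Complex.normSq_eq_norm_sq]
  simp only [e] at h
  convert! h using 1
  norm_cast

theorem basis_exists (b : HilbertBasis ι ℂ H) {c : ι → ℂ} (h : Summable fun i => ‖c i‖ ^ 2) :
    ∃ x : H, ∀ i, ⟪b i, x⟫_ℂ = c i := by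
  have hm : Memℓp c 2 := memℓp_gen (by simpa using h)
  refine ⟨b.repr.symm ⟨c, hm⟩, fun i => ?_⟩
  rw [← b.repr_apply_apply]
  simp

/-- Parseval on both sides; injectivity of `τ` ensures that no coordinate of `x` is counted twice.
-/
theorem basis_norm_le (b : HilbertBasis ι ℂ H) {x y : H} {τ : ι → ι} (hτ : Function.Injective τ)
    {K : ℝ} (hK : 0 ≤ K) (h : ∀ i, ‖⟪b i, y⟫_ℂ‖ ≤ K * ‖⟪b (τ i), x⟫_ℂ‖) : ‖y‖ ≤ K * ‖x‖ := by
  have h1 := basis_hasSum_norm_sq b x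
  have h2 := basis_hasSum_norm_sq b y
  have h3 : Summable fun i => ‖⟪b (τ i), x⟫_ℂ‖ ^ 2 := h1.summable.comp_injective hτ
  have h4 : ∑' i, ‖⟪b (τ i), x⟫_ℂ‖ ^ 2 ≤ ‖x‖ ^ 2 := by
    rw [← h1.tsum_eq]
    exact h3.tsum_le_tsum_of_inj τ hτ (fun _ _ => by positivity) (fun _ => le_rfl) h1.summable
  have h5 : ‖y‖ ^ 2 ≤ (K * ‖x‖) ^ 2 := by
    rw [← h2.tsum_eq]
    calc _ ≤ ∑' i, K ^ 2 * ‖⟪b (τ i), x⟫_ℂ‖ ^ 2 := by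
          refine h2.summable.tsum_le_tsum (fun i => ?_) (h3.mul_left _)
          rw [← mul_pow]
          exact pow_le_pow_left₀ (norm_nonneg _) (h i) 2
      _ = K ^ 2 * ∑' i, ‖⟪b (τ i), x⟫_ℂ‖ ^ 2 := tsum_mul_left
      _ ≤ _ := by rw [mul_pow]; gcongr
  exact (pow_le_pow_iff_left₀ (norm_nonneg _) (by positivity) two_ne_zero).1 h5

/-- The operator with a bounded monomial matrix. -/
theorem exists_monomial (b : HilbertBasis ι ℂ H) {τ : ι → ι} (hτ : Function.Injective τ)
    {c : ι → ℂ} {K : ℝ} (hc : ∀ i, ‖c i‖ ≤ K) :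
    ∃ T : H →L[ℂ] H, ∀ x i, ⟪b i, T x⟫_ℂ = c i * ⟪b (τ i), x⟫_ℂ := by
  have hs : ∀ x : H, Summable fun i => ‖c i * ⟪b (τ i), x⟫_ℂ‖ ^ 2 := by
    intro x
    refine Summable.of_nonneg_of_le (fun _ => by positivity) (fun i => ?_)
      (((basis_hasSum_norm_sq b x).summable.comp_injective hτ).mul_left (K ^ 2))
    rw [norm_mul, mul_pow]
    exact mul_le_mul_of_nonneg_right (pow_le_pow_left₀ (norm_nonneg _) (hc i) 2) (by positivity)
  choose T hT using fun x => basis_exists b (hs x)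
  refine ⟨LinearMap.mkContinuous
    { toFun := T
      map_add' := fun x y => basis_ext b fun i => by
        rw [inner_add_right, hT, hT, hT, inner_add_right, mul_add]
      map_smul' := fun a x => basis_ext b fun i => by
        rw [hT, inner_smul_right, inner_smul_right, RingHom.id_apply, hT]; ring } (max K 0) ?_, hT⟩
  intro x
  refine basis_norm_le b hτ (le_max_right _ _) fun i => ?_
  change ‖⟪b i, T x⟫_ℂ‖ ≤ _
  rw [hT, norm_mul]
  exact mul_le_mul_of_nonneg_right ((hc i).trans (le_max_left _ _)) (norm_nonneg _)

/-- A bounded operator with a monomial matrix whose entries tend to zero is compact. -/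
theorem isCompact_of_monomial [CompleteSpace H] (b : HilbertBasis ι ℂ H) {τ : ι → ι}
    (hτ : Function.Injective τ) {c : ι → ℂ} (hc : Filter.Tendsto c Filter.cofinite (nhds 0))
    {T : H →L[ℂ] H} (hT : ∀ x i, ⟪b i, T x⟫_ℂ = c i * ⟪b (τ i), x⟫_ℂ) : IsCompactOperator T := by
  classical
  have hcl : IsClosed {f : H →L[ℂ] H | IsCompactOperator f} := isClosed_setOfPred_isCompactOperator
  refine hcl.closure_subset (Metric.mem_closure_iff.2 fun ε hε => ?_)
  have hfin : {i | ¬ ‖c i‖ < ε / 2}.Finite := by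
    have := (tendsto_zero_iff_norm_tendsto_zero.1 hc).eventually_lt_const (half_pos hε)
    exact this
  -- Projecting onto the finitely many coordinates where `c` is at least `ε / 2` in norm leaves a
  -- finite rank operator; the remainder is again monomial, with entries below `ε / 2`.
  let F := hfin.toFinset
  let Q : H →L[ℂ] H := ∑ i ∈ F, (innerSL ℂ (b i)).smulRight (b i)
  have hQ : ∀ x k, ⟪b k, Q x⟫_ℂ = if k ∈ F then ⟪b k, x⟫_ℂ else 0 := by
    intro x k
    simp [Q, orthonormal_iff_ite.1 b.orthonormal]
  have hQc : IsCompactOperator Q := by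
    have : ∀ s : Finset ι, IsCompactOperator
        (∑ i ∈ s, (innerSL ℂ (b i)).smulRight (b i) : H →L[ℂ] H) := by
      intro s
      induction s using Finset.induction_on with
      | empty => simpa using isCompactOperator_zero
      | insert i s hi ih =>
        rw [Finset.sum_insert hi]
        refine IsCompactOperator.add ?_ ih
        have h1 : IsCompactOperator (innerSL ℂ (b i)) :=
          isCompactOperator_of_locallyCompactSpace_dom _
        exact h1.continuous_comp (g := fun a : ℂ => a • b i) (by fun_prop)
    exact this F
  refine ⟨Q ∘L T, hQc.comp_clm T, ?_⟩
  rw [dist_eq_norm]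
  refine lt_of_le_of_lt (ContinuousLinearMap.opNorm_le_bound _ (half_pos hε).le fun x => ?_)
    (half_lt_self hε)
  refine basis_norm_le b hτ (half_pos hε).le fun i => ?_
  rw [sub_apply, ContinuousLinearMap.comp_apply, inner_sub_right, hQ, hT]
  by_cases hi : i ∈ F
  · simp only [hi, if_true, sub_self, norm_zero]; positivity
  · simp only [hi, if_false, sub_zero, norm_mul]
    have : ‖c i‖ < ε / 2 := by simpa [F] using hi
    gcongr

end HilbertBasis

/-! ### Operators given by a weighted involution of a basis. -/

namespace WPerm

variable {ι : Type*} (w : WPerm ι)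

theorem σ_injective : Function.Injective w.σ := fun i j h => by
  rw [← w.σσ i, h, w.σσ]

/-- The involution as a permutation. -/
def perm : Equiv.Perm ι := ⟨w.σ, w.σ, w.σσ, w.σσ⟩

/-- The diagonal weights. -/
def diag (p : ι → ℝ) : WPerm ι := ⟨p, id, fun _ => rfl, fun _ => rfl⟩

variable {H : Type*} [NormedAddCommGroup H] [InnerProductSpace ℂ H] (b : HilbertBasis ι ℂ H)

/-- The graph of the operator `b i ↦ p i • b (σ i)` on its maximal domain. -/
def graph : Submodule ℂ (H × H) where
  carrier := {x | ∀ i, ⟪b i, x.2⟫_ℂ = w.p i * ⟪b (w.σ i), x.1⟫_ℂ}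
  add_mem' {x y} hx hy i := by
    simp only [Prod.fst_add, Prod.snd_add, inner_add_right, hx i, hy i]; ring
  zero_mem' i := by simp
  smul_mem' c x hx i := by
    simp only [Prod.smul_fst, Prod.smul_snd, inner_smul_right, hx i]; ring

theorem mem_graph {x : H × H} :
    x ∈ w.graph b ↔ ∀ i, ⟪b i, x.2⟫_ℂ = w.p i * ⟪b (w.σ i), x.1⟫_ℂ := Iff.rfl

theorem isClosed_graph : IsClosed (w.graph b : Set (H × H)) := by
  have : (w.graph b : Set (H × H)) =
      ⋂ i, {x : H × H | ⟪b i, x.2⟫_ℂ = w.p i * ⟪b (w.σ i), x.1⟫_ℂ} := by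
    ext x; simp [mem_graph]
  rw [this]
  exact isClosed_iInter fun i => isClosed_eq (by fun_prop) (by fun_prop)

theorem basis_mem_graph (i : ι) : (b i, (w.p i : ℂ) • b (w.σ i)) ∈ w.graph b := by
  classical
  intro k
  simp only [inner_smul_right, orthonormal_iff_ite.1 b.orthonormal]
  by_cases h : k = w.σ i
  · subst h; simp [w.σσ, w.pσ]
  · have : w.σ k ≠ i := fun h' => h (by rw [← h', w.σσ])
    simp [h, this]

/-- The basis is a core: reindexing the expansion of `x.2` by the involution makes its partial sums
the images of the partial sums of `x.1`. -/
theorem graph_le_closure {g : Submodule ℂ (H × H)}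
    (hg : ∀ i, (b i, (w.p i : ℂ) • b (w.σ i)) ∈ g) : w.graph b ≤ g.topologicalClosure := by
  intro x hx
  have h1 := basis_hasSum b x.1
  have h2 : HasSum (fun i => ⟪b i, x.1⟫_ℂ • ((w.p i : ℂ) • b (w.σ i))) x.2 := by
    have := (Equiv.hasSum_iff w.perm).2 (basis_hasSum b x.2)
    convert! this using 1
    funext i
    simp only [Function.comp, perm, Equiv.coe_fn_mk, mem_graph .. |>.1 hx, w.σσ, w.pσ]
    rw [smul_smul, mul_comm]
  have h3 := h1.prodMk h2
  refine mem_closure_of_tendsto h3 (Filter.Eventually.of_forall fun s => ?_)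
  exact g.sum_mem fun i _ => g.smul_mem _ (hg i)

theorem graph_fst_zero (x : H × H) (hx : x ∈ w.graph b) (h : x.1 = 0) : x.2 = 0 :=
  basis_ext b fun i => by rw [hx i, h]; simp

/-- The operator `b i ↦ p i • b (σ i)` on its maximal domain. -/
def op : H →ₗ.[ℂ] H := (w.graph b).toLinearPMap

theorem graph_op : (w.op b).graph = w.graph b :=
  Submodule.toLinearPMap_graph_eq _ (w.graph_fst_zero b)

theorem mem_op_graph {x : H × H} :
    x ∈ (w.op b).graph ↔ ∀ i, ⟪b i, x.2⟫_ℂ = w.p i * ⟪b (w.σ i), x.1⟫_ℂ := by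
  rw [graph_op]; rfl

theorem inner_op (x : (w.op b).domain) (i : ι) :
    ⟪b i, w.op b x⟫_ℂ = w.p i * ⟪b (w.σ i), (x : H)⟫_ℂ :=
  (w.mem_op_graph b).1 ((w.op b).mem_graph x) i

theorem exists_domain {x y : H} (h : ∀ i, ⟪b i, y⟫_ℂ = w.p i * ⟪b (w.σ i), x⟫_ℂ) :
    ∃ hx : x ∈ (w.op b).domain, w.op b ⟨x, hx⟩ = y := by
  have := (w.mem_op_graph b (x := (x, y))).2 h
  obtain ⟨z, hz1, hz2⟩ := (LinearPMap.mem_graph_iff _).1 this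
  simp only at hz1 hz2
  subst hz1
  exact ⟨z.2, hz2⟩

theorem dense_domain : Dense ((w.op b).domain : Set H) := by
  have h' : Submodule.span ℂ (Set.range b) ≤ (w.op b).domain := by
    rw [Submodule.span_le]
    rintro _ ⟨i, rfl⟩
    exact (w.exists_domain b (w.basis_mem_graph b i)).1
  have hd : Dense (Submodule.span ℂ (Set.range b) : Set H) :=
    Submodule.dense_iff_topologicalClosure_eq_top.2 b.dense_span
  exact hd.mono h'

/-- Testing the adjoint relation on basis vectors yields exactly the coordinate condition defining
the graph, since the weights are real and invariant under `σ`. Conversely, for fixed `x` the adjoint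
relation is closed and linear in the tested pair, so it spreads from the basis pairs to the whole
graph. -/
theorem isSelfAdjoint_op [CompleteSpace H] : IsSelfAdjoint (w.op b) := by
  rw [LinearPMap.isSelfAdjoint_def]
  refine LinearPMap.eq_of_eq_graph ?_
  rw [LinearPMap.adjoint_graph_eq_graph_adjoint (w.dense_domain b), graph_op]
  ext x
  rw [Submodule.mem_adjoint_iff]
  constructor
  · intro h i
    have := h _ _ (w.basis_mem_graph b i)
    rw [sub_eq_zero, inner_smul_left, Complex.conj_ofReal] at this
    exact this.symm
  · intro hx
    let g : Submodule ℂ (H × H) :=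
      { carrier := {z | ⟪z.2, x.1⟫_ℂ - ⟪z.1, x.2⟫_ℂ = 0}
        add_mem' := fun {y z} hy hz => by
          simp only [Set.mem_ofPred_eq, Prod.fst_add, Prod.snd_add, inner_add_left] at *
          linear_combination hy + hz
        zero_mem' := by simp
        smul_mem' := fun c z hz => by
          simp only [Set.mem_ofPred_eq, Prod.smul_fst, Prod.smul_snd, inner_smul_left] at *
          linear_combination (starRingEnd ℂ c) * hz }
    have hgc : IsClosed (g : Set (H × H)) := by
      have : Continuous fun z : H × H => ⟪z.2, x.1⟫_ℂ - ⟪z.1, x.2⟫_ℂ := by fun_prop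
      exact isClosed_eq this continuous_const
    have hle := w.graph_le_closure b (g := g) fun i => by
      have := hx i
      change ⟪(w.p i : ℂ) • b (w.σ i), x.1⟫_ℂ - ⟪b i, x.2⟫_ℂ = 0
      rw [this, inner_smul_left, Complex.conj_ofReal, sub_self]
    rw [hgc.submodule_topologicalClosure_eq] at hle
    exact fun a c hac => hle hac

/-- An operator contained in `w.op b` and containing the basis has closure `w.op b`. -/
theorem closure_toLinearPMap {g : Submodule ℂ (H × H)} (hg : g ≤ w.graph b)
    (hb : ∀ i, (b i, (w.p i : ℂ) • b (w.σ i)) ∈ g) : g.toLinearPMap.closure = w.op b := by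
  have hgr : g.toLinearPMap.graph = g :=
    Submodule.toLinearPMap_graph_eq _ fun x hx h => w.graph_fst_zero b x (hg hx) h
  have hcl : g.topologicalClosure = w.graph b :=
    le_antisymm (g.topologicalClosure_minimal hg (w.isClosed_graph b)) (w.graph_le_closure b hb)
  have hc : g.toLinearPMap.IsClosable := ⟨w.op b, by rw [hgr, hcl, graph_op]⟩
  refine LinearPMap.eq_of_eq_graph ?_
  rw [← hc.graph_closure_eq_closure_graph, hgr, hcl, graph_op]

theorem graphMul_op : graphMul (w.op b) (w.op b) =
    ((diag fun i => w.p i ^ 2).op b).graph := by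
  ext ⟨x, y⟩
  simp only [graphMul, Set.mem_ofPred_eq, SetLike.mem_coe, mem_op_graph]
  constructor
  · rintro ⟨z, h1, h2⟩ i
    rw [h2, h1, w.σσ, w.pσ]
    simp only [diag, id]; push_cast; ring
  · intro h
    -- The intermediate vector exists because `p² ≤ 1 + p⁴`: membership in the domain of the square
    -- already forces membership in the domain of the operator.
    have hs : Summable fun i => ‖(w.p i : ℂ) * ⟪b (w.σ i), x⟫_ℂ‖ ^ 2 := by
      have s1 := ((basis_hasSum_norm_sq b x).summable.comp_injective w.σ_injective)
      have s2 := ((basis_hasSum_norm_sq b y).summable.comp_injective w.σ_injective)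
      refine Summable.of_nonneg_of_le (fun _ => by positivity) (fun i => ?_) (s1.add s2)
      simp only [Function.comp, h (w.σ i), diag, id, w.pσ, norm_mul, mul_pow, Complex.norm_real,
        Complex.ofReal_pow, norm_pow]
      have : 0 ≤ ‖⟪b (w.σ i), x⟫_ℂ‖ ^ 2 := by positivity
      nlinarith [sq_nonneg (‖w.p i‖ ^ 2 - 1), sq_nonneg ‖w.p i‖]
    obtain ⟨z, hz⟩ := basis_exists b hs
    refine ⟨z, hz, fun i => ?_⟩
    rw [h i, hz, w.σσ, w.pσ]
    simp only [diag, id]; push_cast; ring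

/-- The weighted involution and the diagonal operator with the same weights have the same square,
`diag (p²)`. -/
theorem isAbs_op [CompleteSpace H] (hp : ∀ i, 0 ≤ w.p i) : IsAbs (w.op b) ((diag w.p).op b) where
  selfAdjoint := isSelfAdjoint_op _ b
  nonneg x := by
    have h := Complex.hasSum_re (b.hasSum_inner_mul_inner ((diag w.p).op b x) x)
    rw [← h.tsum_eq]
    refine tsum_nonneg fun i => ?_
    rw [← inner_conj_symm, inner_op]
    simp only [diag, id, map_mul, Complex.conj_ofReal]
    rw [mul_assoc, ← Complex.normSq_eq_conj_mul_self, ← Complex.ofReal_mul, Complex.ofReal_re]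
    exact mul_nonneg (hp i) (Complex.normSq_nonneg _)
  sq := by
    rw [LinearPMap.isSelfAdjoint_def.1 (w.isSelfAdjoint_op b), graphMul_op, graphMul_op]
    rfl

/-- As the square acts by `p²`, the inverse of `D - z` is `(D + z) / (p² - z²)`: a diagonal part `z
/ (p² - z²)` plus a part `p / (p² - z²)` along `σ`. Partial fractions show that both coefficients
tend to zero. -/
theorem hasCompactResolvent_op [CompleteSpace H] 
    (hp : Filter.Tendsto w.p Filter.cofinite Filter.atTop) : HasCompactResolvent (w.op b) := by
  intro z hz
  have hne : ∀ i, (w.p i : ℂ) ^ 2 - z ^ 2 ≠ 0 := by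
    intro i h
    have : ((w.p i : ℂ) - z) * (w.p i + z) = 0 := by linear_combination h
    rcases mul_eq_zero.1 this with h | h
    · apply hz; have := congrArg Complex.im h; simpa using this
    · apply hz; have := congrArg Complex.im h; simpa using this
  have hm : ∀ i, (w.p i : ℂ) - z ≠ 0 := fun i h => hne i (by linear_combination (w.p i + z) * h)
  have hq : ∀ i, (w.p i : ℂ) + z ≠ 0 := fun i h => hne i (by linear_combination (w.p i - z) * h)
  have hinv : ∀ z : ℂ, Filter.Tendsto (fun i => ((w.p i : ℂ) - z)⁻¹) Filter.cofinite (nhds 0) := by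
    intro z
    refine Filter.tendsto_inv₀_cobounded.comp (tendsto_norm_atTop_iff_cobounded.1 ?_)
    refine Filter.tendsto_atTop_mono (fun i => ?_)
      (Filter.tendsto_atTop_add_const_right _ (-‖z‖) hp)
    have := norm_sub_norm_le (w.p i : ℂ) z
    rw [Complex.norm_real, Real.norm_eq_abs] at this
    linarith [le_abs_self (w.p i)]
  have ht1 : Filter.Tendsto (fun i => z / ((w.p i : ℂ) ^ 2 - z ^ 2)) Filter.cofinite (nhds 0) := by
    have := (hinv z).sub (hinv (-z)) |>.const_mul (1 / 2)
    simp only [sub_zero, mul_zero] at this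
    refine this.congr fun i => ?_
    have h1 := hne i
    have h2 := hm i
    have h3 := hq i
    rw [sub_neg_eq_add]
    field_simp
    ring
  have ht2 : Filter.Tendsto (fun i => (w.p i : ℂ) / ((w.p i : ℂ) ^ 2 - z ^ 2))
      Filter.cofinite (nhds 0) := by
    have := (hinv z).add (hinv (-z)) |>.const_mul (1 / 2)
    simp only [add_zero, mul_zero] at this
    refine this.congr fun i => ?_
    have h1 := hne i
    have h2 := hm i
    have h3 := hq i
    rw [sub_neg_eq_add]
    field_simp
    ring
  have hb : ∀ c : ι → ℂ, Filter.Tendsto c Filter.cofinite (nhds 0) → ∃ K, ∀ i, ‖c i‖ ≤ K := by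
    intro c hc
    obtain ⟨K, hK⟩ := (Filter.Tendsto.bddAbove_range_of_cofinite
      (tendsto_zero_iff_norm_tendsto_zero.1 hc))
    exact ⟨K, fun i => hK ⟨i, rfl⟩⟩
  obtain ⟨K1, hK1⟩ := hb _ ht1
  obtain ⟨K2, hK2⟩ := hb _ ht2
  obtain ⟨R1, hR1⟩ := exists_monomial b Function.injective_id hK1
  obtain ⟨R2, hR2⟩ := exists_monomial b w.σ_injective hK2
  have hR : ∀ x i, ⟪b i, (R1 + R2) x⟫_ℂ =
      (z * ⟪b i, x⟫_ℂ + w.p i * ⟪b (w.σ i), x⟫_ℂ) / ((w.p i : ℂ) ^ 2 - z ^ 2) := by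
    intro x i
    rw [add_apply, inner_add_right, hR1, hR2, id]; ring
  refine ⟨R1 + R2, ⟨fun y => ?_, fun x => ?_⟩, ?_⟩
  · obtain ⟨h1, h2⟩ := w.exists_domain b (x := (R1 + R2) y) (y := y + z • (R1 + R2) y) fun i => by
      rw [inner_add_right, inner_smul_right, hR, hR, w.σσ, w.pσ]
      field_simp [hne i]
      ring
    exact ⟨h1, by rw [h2]; abel⟩
  · refine basis_ext b fun i => ?_
    rw [hR, inner_sub_right, inner_sub_right, inner_smul_right, inner_smul_right, inner_op, inner_op,
      w.σσ, w.pσ]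
    field_simp [hne i]
    ring
  · exact (isCompact_of_monomial b Function.injective_id ht1 hR1).add
      (isCompact_of_monomial b w.σ_injective ht2 hR2)

/-- The domain is maximal, so it suffices to compute the coordinates of `T x`: expanding `x` in the
basis and reindexing one series by `σ` turns the entrywise identity into membership of `T x` in the
domain together with the commutator formula. -/
theorem isCommutator_op {T C : H →L[ℂ] H}
    (h : ∀ i j, (w.p i : ℂ) * ⟪b (w.σ i), T (b j)⟫_ℂ - w.p j * ⟪b i, T (b (w.σ j))⟫_ℂ =
      ⟪b i, C (b j)⟫_ℂ) : IsCommutator (w.op b) T C := by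
  intro x
  obtain ⟨h1, h2⟩ := w.exists_domain b (x := T x) (y := T (w.op b x) + C x) fun i => by
    have hs : ∀ (S : H →L[ℂ] H) (y : H) k,
        HasSum (fun j => ⟪b j, y⟫_ℂ * ⟪b k, S (b j)⟫_ℂ) ⟪b k, S y⟫_ℂ := by
      intro S y k
      have := ((innerSL ℂ (b k)).comp S).hasSum (basis_hasSum b y)
      simpa [inner_smul_right, Function.comp_def] using this
    have s1 := (Equiv.hasSum_iff w.perm).2 (hs T (w.op b x) i)
    have s2 := hs C x i
    have s3 := (hs T x (w.σ i)).mul_left (w.p i : ℂ)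
    rw [inner_add_right]
    have e : (fun j => (w.p i : ℂ) * (⟪b j, (x : H)⟫_ℂ * ⟪b (w.σ i), T (b j)⟫_ℂ)) =
        fun j => ((fun j => ⟪b j, w.op b x⟫_ℂ * ⟪b i, T (b j)⟫_ℂ) ∘ w.perm) j +
          ⟪b j, (x : H)⟫_ℂ * ⟪b i, C (b j)⟫_ℂ := by
      funext j
      simp only [Function.comp, perm, Equiv.coe_fn_mk, inner_op, w.σσ, w.pσ]
      linear_combination ⟪b j, (x : H)⟫_ℂ * h i j
    rw [e] at s3
    exact (s1.add s2).unique s3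
  exact ⟨h1, by rw [h2]; abel⟩

end WPerm

theorem isCommutator_unique {H : Type*} [NormedAddCommGroup H] [InnerProductSpace ℂ H]
    {D : H →ₗ.[ℂ] H} (hD : Dense (D.domain : Set H)) {T C C' : H →L[ℂ] H}
    (h : IsCommutator D T C) (h' : IsCommutator D T C') : C = C' := by
  refine ContinuousLinearMap.ext fun x => ?_
  refine congrFun (C.continuous.ext_on hD C'.continuous fun y hy => ?_) x
  obtain ⟨h1, h2⟩ := h ⟨y, hy⟩
  obtain ⟨h3, h4⟩ := h' ⟨y, hy⟩
  rw [← h2, ← h4]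

/-! ### Bounded matrices -/

/-- The matrix `M` defines a bounded sesquilinear form on finitely supported families. -/
def BddMat {ι κ : Type*} (M : ι → κ → ℂ) : Prop :=
  ∃ C : ℝ, 0 < C ∧ ∀ (s : Finset ι) (t : Finset κ) (u : ι → ℂ) (v : κ → ℂ),
    ‖∑ i ∈ s, ∑ j ∈ t, u i * v j * M i j‖ ≤ C * (∑ i ∈ s, ‖u i‖ ^ 2 + ∑ j ∈ t, ‖v j‖ ^ 2)

namespace BddMat

variable {ι κ : Type*} {M N : ι → κ → ℂ}

theorem zero : BddMat fun (_ : ι) (_ : κ) => (0 : ℂ) :=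
  ⟨1, one_pos, fun s t u v => by simp; positivity⟩

theorem add (hM : BddMat M) (hN : BddMat N) : BddMat fun i j => M i j + N i j := by
  obtain ⟨C, hC, h⟩ := hM
  obtain ⟨C', hC', h'⟩ := hN
  refine ⟨C + C', by positivity, fun s t u v => ?_⟩
  simp only [mul_add, Finset.sum_add_distrib]
  refine (norm_add_le _ _).trans ((add_le_add (h s t u v) (h' s t u v)).trans (le_of_eq ?_))
  ring

theorem smul (a : ℂ) (hM : BddMat M) : BddMat fun i j => a * M i j := by
  obtain ⟨C, hC, h⟩ := hM
  refine ⟨(‖a‖ + 1) * C, by positivity, fun s t u v => ?_⟩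
  have e : ∑ i ∈ s, ∑ j ∈ t, u i * v j * (a * M i j) = a * ∑ i ∈ s, ∑ j ∈ t, u i * v j * M i j := by
    simp only [Finset.mul_sum]
    exact Finset.sum_congr rfl fun i _ => Finset.sum_congr rfl fun j _ => by ring
  rw [e, norm_mul, mul_assoc]
  exact mul_le_mul (by linarith) (h s t u v) (norm_nonneg _) (by positivity)

theorem sub (hM : BddMat M) (hN : BddMat N) : BddMat fun i j => M i j - N i j := by
  simpa [sub_eq_add_neg] using hM.add (hN.smul (-1))

theorem sum {α : Type*} (s : Finset α) {M : α → ι → κ → ℂ} (h : ∀ a ∈ s, BddMat (M a)) :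
    BddMat fun i j => ∑ a ∈ s, M a i j := by
  classical
  induction s using Finset.induction_on with
  | empty => simpa using zero
  | insert a s ha ih =>
    simp only [Finset.sum_insert ha]
    exact (h a (by simp)).add (ih fun c hc => h c (by simp [hc]))

theorem transpose (hM : BddMat M) : BddMat fun j i => M i j := by
  obtain ⟨C, hC, h⟩ := hM
  refine ⟨C, hC, fun s t u v => ?_⟩
  rw [Finset.sum_comm, add_comm]
  simpa only [mul_comm (u _)] using h t s v u

/-- Composition on the left with a bounded monomial matrix. -/
theorem comp_left {ι' : Type*} (hM : BddMat M) {τ : ι' → ι} {c : ι' → ℂ} {K : ℝ}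
    (hc : ∀ i, ‖c i‖ ≤ K) (hτ : Set.InjOn τ {i | c i ≠ 0}) : BddMat fun i j => c i * M (τ i) j := by
  classical
  obtain ⟨C, hC, h⟩ := hM
  refine ⟨C * (K ^ 2 + 1), by positivity, fun s t u v => ?_⟩
  -- Only where `c` does not vanish is `τ` injective; there it is inverted by `g`, and the remaining
  -- rows contribute zero.
  let s' := s.filter fun i => c i ≠ 0
  have hτ' : Set.InjOn τ s' := hτ.mono fun i hi => (Finset.mem_filter.1 hi).2
  rcases isEmpty_or_nonempty ι' with hE | hE
  · rw [Finset.eq_empty_of_isEmpty s]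
    simp only [Finset.sum_empty, norm_zero]
    positivity
  let g := Function.invFunOn τ s'
  have hg : ∀ i ∈ s', g (τ i) = i := fun i hi => hτ'.leftInvOn_invFunOn hi
  have e1 : ∑ i ∈ s, ∑ j ∈ t, u i * v j * (c i * M (τ i) j) =
      ∑ k ∈ s'.image τ, ∑ j ∈ t, (u (g k) * c (g k)) * v j * M k j := by
    rw [Finset.sum_image hτ', Finset.sum_filter]
    refine Finset.sum_congr rfl fun i hi => ?_
    split_ifs with h0
    · refine Finset.sum_congr rfl fun j _ => ?_
      rw [hg i (Finset.mem_filter.2 ⟨hi, h0⟩)]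
      ring
    · simp [not_not.1 h0]
  have e2 : ∑ k ∈ s'.image τ, ‖u (g k) * c (g k)‖ ^ 2 ≤ K ^ 2 * ∑ i ∈ s, ‖u i‖ ^ 2 := by
    rw [Finset.sum_image hτ', Finset.mul_sum]
    refine (Finset.sum_le_sum fun i hi => ?_).trans (Finset.sum_le_sum_of_subset_of_nonneg
      (Finset.filter_subset _ s) fun _ _ _ => by positivity)
    rw [hg i hi, norm_mul, mul_pow, mul_comm]
    exact mul_le_mul_of_nonneg_right (pow_le_pow_left₀ (norm_nonneg _) (hc i) 2) (by positivity)
  rw [e1]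
  refine (h _ t (fun k => u (g k) * c (g k)) v).trans ?_
  have h1 : 0 ≤ ∑ i ∈ s, ‖u i‖ ^ 2 := by positivity
  have h2 : 0 ≤ K ^ 2 * ∑ j ∈ t, ‖v j‖ ^ 2 := by positivity
  rw [mul_assoc]
  refine mul_le_mul_of_nonneg_left ?_ hC.le
  linarith

/-- Composition on the right with a bounded monomial matrix. -/
theorem comp_right {κ' : Type*} (hM : BddMat M) {τ : κ' → κ} {c : κ' → ℂ} {K : ℝ}
    (hc : ∀ i, ‖c i‖ ≤ K) (hτ : Set.InjOn τ {i | c i ≠ 0}) : BddMat fun i j => c j * M i (τ j) :=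
  (hM.transpose.comp_left hc hτ).transpose

theorem mul_left (hM : BddMat M) {c : ι → ℂ} {K : ℝ} (hc : ∀ i, ‖c i‖ ≤ K) :
    BddMat fun i j => c i * M i j :=
  hM.comp_left hc Function.injective_id.injOn

theorem mul_right (hM : BddMat M) {c : κ → ℂ} {K : ℝ} (hc : ∀ j, ‖c j‖ ≤ K) :
    BddMat fun i j => c j * M i j :=
  hM.comp_right hc Function.injective_id.injOn

theorem injOn_snd {γ δ : Type*} [DecidableEq γ] (z : γ) :
    Set.InjOn (Prod.snd : γ × δ → δ) {i | (if i.1 = z then (1 : ℂ) else 0) ≠ 0} := by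
  rintro ⟨x, m⟩ hx ⟨y, n⟩ hy hxy
  simp only [ne_eq, ite_eq_right_iff, one_ne_zero, imp_false, not_not, Set.mem_ofPred_eq] at *
  rw [hx, hy, hxy]

/-- A matrix with finitely many bounded blocks is bounded. -/
theorem of_blocks {α β : Type*} [Fintype α] [Fintype β] {M : α × ι → β × κ → ℂ}
    (h : ∀ x y, BddMat fun m n => M (x, m) (y, n)) : BddMat M := by
  classical
  have hbd : ∀ P : Prop, ‖(if P then (1 : ℂ) else 0)‖ ≤ 1 := fun P => by split_ifs <;> simp
  -- A block is put in place by composing on each side with the projection onto the second index,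
  -- weighted by the indicator of the block; the projection is injective on the support of that
  -- indicator.
  have h0 : ∀ x y, BddMat fun (i : α × ι) (j : β × κ) => (if j.1 = y then (1 : ℂ) else 0) *
      ((if i.1 = x then (1 : ℂ) else 0) * M (x, i.2) (y, j.2)) := fun x y =>
    have h2 : BddMat fun (i : α × ι) (n : κ) =>
        (if i.1 = x then (1 : ℂ) else 0) * M (x, i.2) (y, n) :=
      comp_left (h x y) (τ := Prod.snd) (fun _ => hbd _) (injOn_snd x)
    comp_right h2 (τ := Prod.snd) (fun _ => hbd _) (injOn_snd y)
  have h1 := sum (Finset.univ : Finset (α × β)) fun a _ => h0 a.1 a.2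
  have e : M = fun i j => ∑ a : α × β, (if j.1 = a.2 then (1 : ℂ) else 0) *
      ((if i.1 = a.1 then (1 : ℂ) else 0) * M (a.1, i.2) (a.2, j.2)) := by
    funext i j
    rw [Finset.sum_eq_single (i.1, j.1)]
    · simp
    · rintro ⟨x, y⟩ _ hne
      by_cases h2 : j.1 = y
      · by_cases h3 : i.1 = x
        · exact absurd (by rw [h2, h3]) hne
        · simp [h3]
      · simp [h2]
    · simp
  rw [e]
  exact h1

/-! ### The Schur multiplier `q r / (q + r) ^ 2`. -/

theorem integral_mul_exp_neg_mul {a : ℝ} (ha : 0 < a) :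
    IntegrableOn (fun t : ℝ => t * Real.exp (-(a * t))) (Set.Ioi 0) ∧
      ∫ t in Set.Ioi (0 : ℝ), t * Real.exp (-(a * t)) = 1 / a ^ 2 := by
  have h := Real.integral_rpow_mul_exp_neg_mul_Ioi (a := 2) (by norm_num) ha
  have e : ∀ t : ℝ, t ^ ((2 : ℝ) - 1) * Real.exp (-(a * t)) = t * Real.exp (-(a * t)) := by
    intro t; norm_num
  simp only [e] at h
  have h2 : ∫ t in Set.Ioi (0 : ℝ), t * Real.exp (-(a * t)) = 1 / a ^ 2 := by
    rw [h]; norm_num [Real.Gamma_two]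
  refine ⟨?_, h2⟩
  -- The integral of a non-integrable function is zero by convention, so the positive value already
  -- proves integrability.
  by_contra hc
  rw [integral_undef hc] at h2
  have : 0 < 1 / a ^ 2 := by positivity
  linarith

/-- The bound is uniform in the weights because `∫ z q² exp (-2 q z) dz = 1/4` for every `q > 0`. -/
theorem integral_mul_sum_norm_sq_le {α : Type*} (s : Finset α) (q : α → ℝ) (u : α → ℂ)
    (hq : ∀ i, 0 < q i) :
      Integrable (fun z : ℝ => z * ∑ i ∈ s, ‖u i * ((q i * Real.exp (-(q i * z)) : ℝ) : ℂ)‖ ^ 2)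
      (volume.restrict (Set.Ioi 0)) ∧
    ∫ z in Set.Ioi (0 : ℝ), z * ∑ i ∈ s, ‖u i * ((q i * Real.exp (-(q i * z)) : ℝ) : ℂ)‖ ^ 2 ≤
      ∑ i ∈ s, ‖u i‖ ^ 2 := by
  have e : ∀ z : ℝ, z * ∑ i ∈ s, ‖u i * ((q i * Real.exp (-(q i * z)) : ℝ) : ℂ)‖ ^ 2 =
      ∑ i ∈ s, (‖u i‖ ^ 2 * q i ^ 2) * (z * Real.exp (-((2 * q i) * z))) := by
    intro z
    rw [Finset.mul_sum]
    refine Finset.sum_congr rfl fun i _ => ?_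
    rw [norm_mul, Complex.norm_real, mul_pow, Real.norm_eq_abs, sq_abs, mul_pow, ← Real.exp_nat_mul]
    push_cast
    rw [show (2 : ℝ) * -(q i * z) = -(2 * q i * z) by ring]
    ring
  have hi : ∀ i, Integrable (fun z : ℝ => (‖u i‖ ^ 2 * q i ^ 2) *
      (z * Real.exp (-((2 * q i) * z)))) (volume.restrict (Set.Ioi 0)) := fun i =>
    (integral_mul_exp_neg_mul (a := 2 * q i) (by linarith [hq i])).1.const_mul _
  simp only [e]
  refine ⟨integrable_finsetSum _ fun i _ => hi i, ?_⟩
  rw [integral_finsetSum _ fun i _ => hi i]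
  refine Finset.sum_le_sum fun i _ => ?_
  rw [integral_const_mul, (integral_mul_exp_neg_mul (a := 2 * q i) (by linarith [hq i])).2]
  have h3 := hq i
  have : ‖u i‖ ^ 2 * q i ^ 2 * (1 / (2 * q i) ^ 2) = ‖u i‖ ^ 2 / 4 := by field_simp; norm_num
  rw [this]
  linarith [sq_nonneg ‖u i‖]

/-- The kernel `q r / (q + r) ^ 2` is a bounded Schur multiplier. -/
theorem schur (hM : BddMat M) {q : ι → ℝ} {r : κ → ℝ} (hq : ∀ i, 0 < q i) (hr : ∀ j, 0 < r j) :
    BddMat fun i j => ((q i * r j / (q i + r j) ^ 2 : ℝ) : ℂ) * M i j := by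
  obtain ⟨C, hC, h⟩ := hM
  refine ⟨C, hC, fun s t u v => ?_⟩
  -- Since `1 / (q + r)² = ∫ z exp (-(q + r) z) dz`, the kernel is a superposition, with density `z
  -- dz`, of the rank one multipliers `q exp (-q z) · r exp (-r z)`. Each of these is absorbed into
  -- the test vectors.
  let x : ℝ → ι → ℂ := fun z i => u i * ((q i * Real.exp (-(q i * z)) : ℝ) : ℂ)
  let y : ℝ → κ → ℂ := fun z j => v j * ((r j * Real.exp (-(r j * z)) : ℝ) : ℂ)
  have e1 : ∑ i ∈ s, ∑ j ∈ t, u i * v j * (((q i * r j / (q i + r j) ^ 2 : ℝ) : ℂ) * M i j) =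
      ∫ z in Set.Ioi (0 : ℝ), (z : ℂ) * ∑ i ∈ s, ∑ j ∈ t, x z i * y z j * M i j := by
    have e : ∀ z : ℝ, (z : ℂ) * ∑ i ∈ s, ∑ j ∈ t, x z i * y z j * M i j =
        ∑ i ∈ s, ∑ j ∈ t, (u i * v j * ((q i * r j : ℝ) : ℂ) * M i j) *
          ((z * Real.exp (-((q i + r j) * z)) : ℝ) : ℂ) := by
      intro z
      simp only [Finset.mul_sum]
      refine Finset.sum_congr rfl fun i _ => Finset.sum_congr rfl fun j _ => ?_
      simp only [x, y]
      rw [add_mul, neg_add, Real.exp_add]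
      push_cast
      ring
    have hi : ∀ i j, Integrable (fun z : ℝ => (u i * v j * ((q i * r j : ℝ) : ℂ) * M i j) *
          ((z * Real.exp (-((q i + r j) * z)) : ℝ) : ℂ)) (volume.restrict (Set.Ioi 0)) :=
      fun i j => ((integral_mul_exp_neg_mul (add_pos (hq i) (hr j))).1.ofReal).const_mul _
    simp only [e]
    rw [integral_finsetSum _ fun i _ => integrable_finsetSum _ fun j _ => hi i j]
    refine Finset.sum_congr rfl fun i _ => ?_
    rw [integral_finsetSum _ fun j _ => hi i j]
    refine Finset.sum_congr rfl fun j _ => ?_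
    rw [integral_const_mul, integral_complex_ofReal,
      (integral_mul_exp_neg_mul (add_pos (hq i) (hr j))).2]
    push_cast
    ring
  obtain ⟨i1, k1⟩ := integral_mul_sum_norm_sq_le s q u hq
  obtain ⟨i2, k2⟩ := integral_mul_sum_norm_sq_le t r v hr
  rw [e1]
  calc _ ≤ ∫ z in Set.Ioi (0 : ℝ), C * (z * ∑ i ∈ s, ‖x z i‖ ^ 2 + z * ∑ j ∈ t, ‖y z j‖ ^ 2) := by
        refine norm_integral_le_of_norm_le ((i1.add i2).const_mul C) ?_
        refine (ae_restrict_mem measurableSet_Ioi).mono fun z hz => ?_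
        have hz' : (0 : ℝ) < z := hz
        rw [norm_mul, Complex.norm_real, Real.norm_of_nonneg hz'.le]
        refine (mul_le_mul_of_nonneg_left (h s t (x z) (y z)) hz'.le).trans (le_of_eq ?_)
        ring
    _ = C * ((∫ z in Set.Ioi (0 : ℝ), z * ∑ i ∈ s, ‖x z i‖ ^ 2) +
          ∫ z in Set.Ioi (0 : ℝ), z * ∑ j ∈ t, ‖y z j‖ ^ 2) := by
        rw [integral_const_mul, integral_add i1 i2]
    _ ≤ _ := by gcongr

/-- The form bound is a sum of squares, not a product of norms, so it is tested with `u` the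
conjugate of the image `y` scaled by `1 / (2 C)`: half of the left side then absorbs the term in
`u`, and the resulting operator bound is `2 C`. -/
theorem sum_norm_sq_le (hM : BddMat M) : ∃ K : ℝ, 0 ≤ K ∧ ∀ (s : Finset ι) (t : Finset κ)
    (v : κ → ℂ), ∑ i ∈ s, ‖∑ j ∈ t, v j * M i j‖ ^ 2 ≤ K ^ 2 * ∑ j ∈ t, ‖v j‖ ^ 2 := by
  obtain ⟨C, hC, h⟩ := hM
  refine ⟨2 * C, by positivity, fun s t v => ?_⟩
  let y : ι → ℂ := fun i => ∑ j ∈ t, v j * M i j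
  have h1 := h s t (fun i => ((1 / (2 * C) : ℝ) : ℂ) * (starRingEnd ℂ) (y i)) v
  have e : ∑ i ∈ s, ∑ j ∈ t, ((1 / (2 * C) : ℝ) : ℂ) * (starRingEnd ℂ) (y i) * v j * M i j =
      ((1 / (2 * C) * ∑ i ∈ s, ‖y i‖ ^ 2 : ℝ) : ℂ) := by
    push_cast
    rw [Finset.mul_sum]
    refine Finset.sum_congr rfl fun i _ => ?_
    rw [← Complex.conj_mul']
    have : y i = ∑ j ∈ t, v j * M i j := rfl
    rw [mul_comm _ (y i), ← mul_assoc, mul_right_comm]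
    nth_rw 3 [this]
    rw [Finset.mul_sum]
    exact Finset.sum_congr rfl fun j _ => by ring
  have e2 : ∑ i ∈ s, ‖((1 / (2 * C) : ℝ) : ℂ) * (starRingEnd ℂ) (y i)‖ ^ 2 =
      (1 / (2 * C)) ^ 2 * ∑ i ∈ s, ‖y i‖ ^ 2 := by
    rw [Finset.mul_sum]
    refine Finset.sum_congr rfl fun i _ => ?_
    rw [norm_mul, RCLike.norm_conj, Complex.norm_real, Real.norm_of_nonneg (by positivity), mul_pow]
  rw [e, e2, Complex.norm_real, Real.norm_of_nonneg (by positivity)] at h1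
  change ∑ i ∈ s, ‖y i‖ ^ 2 ≤ _
  have h3 : 1 / (2 * C) * ∑ i ∈ s, ‖y i‖ ^ 2 ≤
      1 / (4 * C) * ∑ i ∈ s, ‖y i‖ ^ 2 + C * ∑ j ∈ t, ‖v j‖ ^ 2 := by
    refine h1.trans (le_of_eq ?_)
    field_simp
    ring
  have h4 : 1 / (4 * C) * ∑ i ∈ s, ‖y i‖ ^ 2 ≤ C * ∑ j ∈ t, ‖v j‖ ^ 2 := by
    have : 1 / (2 * C) * ∑ i ∈ s, ‖y i‖ ^ 2 = 2 * (1 / (4 * C) * ∑ i ∈ s, ‖y i‖ ^ 2) := by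
      field_simp
      ring
    linarith
  have h5 := mul_le_mul_of_nonneg_left h4 (by positivity : 0 ≤ 4 * C)
  calc _ = 4 * C * (1 / (4 * C) * ∑ i ∈ s, ‖y i‖ ^ 2) := by field_simp
    _ ≤ _ := h5
    _ = _ := by ring

variable {H : Type*} [NormedAddCommGroup H] [InnerProductSpace ℂ H]

theorem _root_.Orthonormal.norm_sq_sum_smul {e : ι → H} (he : Orthonormal ℂ e) (s : Finset ι)
    (u : ι → ℂ) : ‖∑ i ∈ s, u i • e i‖ ^ 2 = ∑ i ∈ s, ‖u i‖ ^ 2 := by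
  have h := he.inner_sum u u s
  rw [inner_self_eq_norm_sq_to_K] at h
  simp only [Complex.conj_mul'] at h
  have h' : ((‖∑ i ∈ s, u i • e i‖ ^ 2 : ℝ) : ℂ) = ((∑ i ∈ s, ‖u i‖ ^ 2 : ℝ) : ℂ) := by
    push_cast
    exact h
  exact Complex.ofReal_injective h'

theorem of_clm {E : Type*} [NormedAddCommGroup E] [InnerProductSpace ℂ E] {e : ι → H} {f : κ → E}
    (he : Orthonormal ℂ e) (hf : Orthonormal ℂ f) (T : E →L[ℂ] H) :
    BddMat fun i j => ⟪e i, T (f j)⟫_ℂ := by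
  refine ⟨‖T‖ + 1, by positivity, fun s t u v => ?_⟩
  let x : H := ∑ i ∈ s, (starRingEnd ℂ) (u i) • e i
  let y : E := ∑ j ∈ t, v j • f j
  have hx : ‖x‖ ^ 2 = ∑ i ∈ s, ‖u i‖ ^ 2 := by
    simpa using he.norm_sq_sum_smul s fun i => (starRingEnd ℂ) (u i)
  have hy : ‖y‖ ^ 2 = ∑ j ∈ t, ‖v j‖ ^ 2 := hf.norm_sq_sum_smul t v
  have e1 : ∑ i ∈ s, ∑ j ∈ t, u i * v j * ⟪e i, T (f j)⟫_ℂ = ⟪x, T y⟫_ℂ := by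
    simp only [x, y, map_sum, sum_inner, inner_sum, map_smul, inner_smul_left, inner_smul_right,
      Complex.conj_conj, mul_assoc, Finset.mul_sum]
    rw [Finset.sum_comm]
    exact Finset.sum_congr rfl fun j _ => Finset.sum_congr rfl fun i _ => by ring
  rw [e1, ← hx, ← hy]
  have h1 := (norm_inner_le_norm (𝕜 := ℂ) x (T y)).trans
    (mul_le_mul_of_nonneg_left (T.le_opNorm y) (norm_nonneg x))
  have h2 : ‖x‖ * (‖T‖ * ‖y‖) ≤ ‖T‖ * (‖x‖ ^ 2 + ‖y‖ ^ 2) := by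
    have : ‖x‖ * ‖y‖ ≤ ‖x‖ ^ 2 + ‖y‖ ^ 2 := by nlinarith [sq_nonneg (‖x‖ - ‖y‖), sq_nonneg (‖x‖ + ‖y‖)]
    calc _ = ‖T‖ * (‖x‖ * ‖y‖) := by ring
      _ ≤ _ := by gcongr
  have h3 : 0 ≤ ‖x‖ ^ 2 + ‖y‖ ^ 2 := by positivity
  calc _ ≤ ‖x‖ * (‖T‖ * ‖y‖) := h1
    _ ≤ _ := by linarith

/-- The bounded operator with a given bounded matrix. -/
theorem exists_clm [CompleteSpace H] (b : HilbertBasis ι ℂ H) {M : ι → ι → ℂ} (hM : BddMat M) :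
    ∃ T : H →L[ℂ] H, ∀ i j, ⟪b i, T (b j)⟫_ℂ = M i j := by
  obtain ⟨K, hK, h⟩ := hM.sum_norm_sq_le
  -- Testing on a single index shows that each column is square summable, hence the coordinates of a
  -- vector.
  have hcol : ∀ j, Summable fun i => ‖M i j‖ ^ 2 := by
    intro j
    refine summable_of_sum_le (c := K ^ 2) (fun _ => by positivity) fun s => ?_
    simpa using h s {j} fun _ => 1
  choose col hcol using fun j => basis_exists b (hcol j)
  -- The operator is defined on finite combinations of basis vectors, where the bound holds, and
  -- extended by density.
  let e : (ι →₀ ℂ) →ₗ[ℂ] H := Finsupp.linearCombination ℂ b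
  let f : (ι →₀ ℂ) →ₗ[ℂ] H := Finsupp.linearCombination ℂ col
  have hd : DenseRange e := by
    have : Set.range e = (Submodule.span ℂ (Set.range b) : Set H) := by
      rw [← Finsupp.range_linearCombination]; rfl
    rw [DenseRange, this]
    exact Submodule.dense_iff_topologicalClosure_eq_top.2 b.dense_span
  have hn : ∀ x, ‖f x‖ ≤ K * ‖e x‖ := by
    intro x
    have he : ‖e x‖ ^ 2 = ∑ j ∈ x.support, ‖x j‖ ^ 2 := by
      simp only [e, Finsupp.linearCombination_apply, Finsupp.sum]
      exact b.orthonormal.norm_sq_sum_smul _ _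
    have hf : ∀ i, ⟪b i, f x⟫_ℂ = ∑ j ∈ x.support, x j * M i j := by
      intro i
      simp only [f, Finsupp.linearCombination_apply, Finsupp.sum, inner_sum, inner_smul_right, hcol]
    have h2 : ‖f x‖ ^ 2 ≤ (K * ‖e x‖) ^ 2 := by
      rw [← (basis_hasSum_norm_sq b (f x)).tsum_eq, mul_pow, he]
      refine (basis_hasSum_norm_sq b (f x)).summable.tsum_le_of_sum_le fun s => ?_
      simp only [hf]
      exact h s x.support x
    exact (pow_le_pow_iff_left₀ (norm_nonneg _) (by positivity) two_ne_zero).1 h2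
  refine ⟨f.extendOfNorm e, fun i j => ?_⟩
  have := LinearMap.extendOfNorm_eq (f := f) hd ⟨K, hn⟩ (Finsupp.single j 1)
  simp only [e, f, Finsupp.linearCombination_single, one_smul] at this
  rw [this, hcol]

end BddMat

/-- Commuting with a diagonal operator multiplies the entry `(i, j)` by `p i - p j`. Boundedness of
all the powers is inherited by the commutator, which drives the induction. -/
theorem inDomDeltaPow_of_bddMat {ι H : Type*} [NormedAddCommGroup H] [InnerProductSpace ℂ H]
    [CompleteSpace H] (b : HilbertBasis ι ℂ H) (p : ι → ℝ) (n : ℕ) (T : H →L[ℂ] H)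
    (h : ∀ k : ℕ, BddMat fun i j => ((p i : ℂ) - p j) ^ k * ⟪b i, T (b j)⟫_ℂ) :
    InDomDeltaPow ((WPerm.diag p).op b) n T := by
  induction n generalizing T with
  | zero => trivial
  | succ n ih =>
    obtain ⟨C, hC⟩ := (h 1).exists_clm b
    refine ⟨C, WPerm.isCommutator_op _ b fun i j => ?_, ih C fun k => ?_⟩
    · rw [hC]; simp only [WPerm.diag, id]; ring
    · simp only [hC, ← mul_assoc, pow_one, ← pow_succ]; exact h (k + 1)

/-! ### Hermite functions -/

/-- This gives the Schwartz decay of the Gaussian, whose derivatives are Hermite polynomials times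
itself. For monomials, `|x|^n ≤ 1 + x^(2n)` and `x^(2n)` is dominated by one term of the series of
`exp (x²/2)`. -/
theorem exists_bound_eval_mul_exp (P : Polynomial ℝ) :
    ∃ C : ℝ, ∀ x : ℝ, |P.eval x| * Real.exp (-(x ^ 2 / 2)) ≤ C := by
  induction P using Polynomial.induction_on' with
  | add P Q hP hQ =>
    obtain ⟨C, hC⟩ := hP
    obtain ⟨C', hC'⟩ := hQ
    refine ⟨C + C', fun x => ?_⟩
    rw [Polynomial.eval_add]
    refine le_trans ?_ (add_le_add (hC x) (hC' x))
    rw [← add_mul]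
    gcongr
    exact abs_add_le _ _
  | monomial n a =>
    refine ⟨|a| * (1 + 2 ^ n * n.factorial), fun x => ?_⟩
    rw [Polynomial.eval_monomial, abs_mul, mul_assoc]
    gcongr
    have h1 : |x ^ n| ≤ 1 + (x ^ 2) ^ n := by
      rw [← pow_mul, mul_comm 2 n, pow_mul]
      nlinarith [sq_nonneg (|x ^ n| - 1), sq_abs (x ^ n), abs_nonneg (x ^ n)]
    have h2 := Real.pow_div_factorial_le_exp (x ^ 2 / 2) (by positivity) n
    have h3 : (x ^ 2) ^ n ≤ 2 ^ n * n.factorial * Real.exp (x ^ 2 / 2) := by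
      rw [div_pow, div_div, div_le_iff₀ (by positivity)] at h2
      linarith
    have h4 : Real.exp (x ^ 2 / 2) * Real.exp (-(x ^ 2 / 2)) = 1 := by
      rw [← Real.exp_add]; simp
    have h5 : Real.exp (-(x ^ 2 / 2)) ≤ 1 := Real.exp_le_one_iff.2 (by nlinarith [sq_nonneg x])
    have h6 := (Real.exp_pos (-(x ^ 2 / 2))).le
    calc _ ≤ (1 + 2 ^ n * n.factorial * Real.exp (x ^ 2 / 2)) * Real.exp (-(x ^ 2 / 2)) :=
          mul_le_mul_of_nonneg_right (by linarith) h6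
      _ = Real.exp (-(x ^ 2 / 2)) + 2 ^ n * n.factorial := by
          rw [add_mul, mul_assoc, h4]; ring
      _ ≤ _ := by linarith

/-- The Gaussian as a real Schwartz function. -/
def realGaussian : 𝓢(ℝ, ℝ) where
  toFun x := Real.exp (-(x ^ 2 / 2))
  smooth' := by fun_prop
  decay' k n := by
    obtain ⟨C, hC⟩ := exists_bound_eval_mul_exp
      (Polynomial.X ^ k * (Polynomial.hermite n).map (Int.castRingHom ℝ))
    refine ⟨C, fun x => ?_⟩
    rw [norm_iteratedFDeriv_eq_norm_iteratedDeriv, iteratedDeriv_eq_iterate,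
      Polynomial.deriv_gaussian_eq_hermite_mul_gaussian]
    refine le_trans (le_of_eq ?_) (hC x)
    rw [Polynomial.eval_mul, Polynomial.eval_pow, Polynomial.eval_X, Polynomial.eval_map,
      Polynomial.aeval_def]
    simp only [norm_mul, norm_pow, norm_neg, norm_one, one_pow, one_mul, Real.norm_eq_abs, abs_mul,
      abs_pow, Real.abs_exp]
    rw [mul_assoc]
    rfl

/-- The Gaussian `s ↦ exp (- s ^ 2 / 2)` as a Schwartz function. -/
def gaussian : 𝓢(ℝ, ℂ) := SchwartzMap.postcompCLM (𝕜 := ℝ) Complex.ofRealCLM realGaussian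

theorem gaussian_apply (x : ℝ) : gaussian x = (Real.exp (-(x ^ 2 / 2)) : ℂ) := rfl

/-- The inclusion of the Schwartz functions into `L²(ℝ)`. -/
def emb : 𝓢(ℝ, ℂ) →ₗ[ℂ] L2 := (SchwartzMap.toLpCLM ℂ ℂ 2 (volume : Measure ℝ)).toLinearMap

theorem emb_ae (φ : 𝓢(ℝ, ℂ)) : emb φ =ᵐ[volume] φ := φ.coeFn_toLp 2 volume

theorem inner_emb (φ ψ : 𝓢(ℝ, ℂ)) :
    ⟪emb φ, emb ψ⟫_ℂ = ∫ x, (starRingEnd ℂ) (φ x) * ψ x := by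
  have := SchwartzMap.inner_toL2_toL2_eq φ ψ volume
  simp only [RCLike.inner_apply, mul_comm] at this
  exact this

theorem pder_zero_apply (φ : 𝓢(ℝ, ℂ)) (x : ℝ) : pder 0 φ x = x * φ x := by
  change SchwartzMap.smulLeftCLM ℂ (fun s : ℝ => (s : ℂ)) φ x = _
  rw [SchwartzMap.smulLeftCLM_apply_apply (by fun_prop), smul_eq_mul]

theorem pder_one_apply (φ : 𝓢(ℝ, ℂ)) (x : ℝ) : pder 1 φ x = -Complex.I * deriv φ x := rfl

theorem inner_pder (k : Fin 2) (φ ψ : 𝓢(ℝ, ℂ)) :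
    ⟪emb (pder k φ), emb ψ⟫_ℂ = ⟪emb φ, emb (pder k ψ)⟫_ℂ := by
  rw [inner_emb, inner_emb]
  fin_cases k
  · congr 1; ext x
    simp only [Fin.zero_eta, pder_zero_apply, map_mul, Complex.conj_ofReal]
    ring
  · have h := SchwartzMap.integral_bilinear_deriv_right_eq_neg_left φ ψ
      ((ContinuousLinearMap.mul ℝ ℂ) ∘L Complex.conjCLE.toContinuousLinearMap)
    simp only [ContinuousLinearMap.comp_apply, ContinuousLinearMap.mul_apply',
      ContinuousLinearEquiv.coe_coe, Complex.conjCLE_apply] at h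
    simp only [Fin.mk_one, pder_one_apply, map_mul, map_neg, Complex.conj_I]
    have e1 : ∀ x, - -Complex.I * (starRingEnd ℂ) (deriv φ x) * ψ x =
      Complex.I * ((starRingEnd ℂ) (deriv φ x) * ψ x) := fun x => by ring
    have e2 : ∀ x, (starRingEnd ℂ) (φ x) * (-Complex.I * deriv ψ x) =
      -Complex.I * ((starRingEnd ℂ) (φ x) * deriv ψ x) := fun x => by ring
    simp only [e1, e2, integral_const_mul, h]
    ring

/-- The lowering operator `s + d/ds`. -/
def lower : 𝓢(ℝ, ℂ) →ₗ[ℂ] 𝓢(ℝ, ℂ) := pder 0 + Complex.I • pder 1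

/-- The raising operator `s - d/ds`. -/
def raise : 𝓢(ℝ, ℂ) →ₗ[ℂ] 𝓢(ℝ, ℂ) := pder 0 - Complex.I • pder 1

theorem lower_apply (φ : 𝓢(ℝ, ℂ)) (x : ℝ) : lower φ x = x * φ x + deriv φ x := by
  change pder 0 φ x + Complex.I * pder 1 φ x = _
  rw [pder_zero_apply, pder_one_apply, ← mul_assoc]
  simp

theorem raise_apply (φ : 𝓢(ℝ, ℂ)) (x : ℝ) : raise φ x = x * φ x - deriv φ x := by
  change pder 0 φ x - Complex.I * pder 1 φ x = _
  rw [pder_zero_apply, pder_one_apply, ← mul_assoc]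
  simp

theorem inner_raise (φ ψ : 𝓢(ℝ, ℂ)) : ⟪emb (raise φ), emb ψ⟫_ℂ = ⟪emb φ, emb (lower ψ)⟫_ℂ := by
  simp only [raise, lower, LinearMap.sub_apply, LinearMap.add_apply, LinearMap.smul_apply, map_sub,
    map_add, map_smul, inner_sub_left, inner_add_right, inner_smul_left, inner_smul_right,
    inner_pder, Complex.conj_I]
  ring

theorem inner_lower (φ ψ : 𝓢(ℝ, ℂ)) : ⟪emb (lower φ), emb ψ⟫_ℂ = ⟪emb φ, emb (raise ψ)⟫_ℂ := by
  rw [← inner_conj_symm, ← inner_raise, inner_conj_symm]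

theorem hasDerivAt_mul_schwartz (φ : 𝓢(ℝ, ℂ)) (x : ℝ) :
    HasDerivAt (fun x : ℝ => (x : ℂ) * φ x) (φ x + x * deriv φ x) x := by
  have := (HasDerivAt.ofReal_comp (hasDerivAt_id x)).mul (φ.differentiableAt (x := x)).hasDerivAt
  simp only [id, Complex.ofReal_one, one_mul] at this
  exact this

/-- The canonical commutation relation, which drives the whole ladder. -/
theorem lower_raise (φ : 𝓢(ℝ, ℂ)) : lower (raise φ) = raise (lower φ) + (2 : ℂ) • φ := by
  ext x
  have hd : HasDerivAt (deriv φ) (deriv (deriv φ) x) x :=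
    ((SchwartzMap.derivCLM ℂ ℂ φ).differentiableAt (x := x)).hasDerivAt
  have e1 : deriv (raise φ) x = φ x + x * deriv φ x - deriv (deriv φ) x := by
    have : (raise φ : ℝ → ℂ) = fun x : ℝ => (x : ℂ) * φ x - deriv φ x := funext fun x => raise_apply φ x
    rw [this]
    exact ((hasDerivAt_mul_schwartz φ x).sub hd).deriv
  have e2 : deriv (lower φ) x = φ x + x * deriv φ x + deriv (deriv φ) x := by
    have : (lower φ : ℝ → ℂ) = fun x : ℝ => (x : ℂ) * φ x + deriv φ x := funext (lower_apply φ)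
    rw [this]
    exact ((hasDerivAt_mul_schwartz φ x).add hd).deriv
  rw [lower_apply, e1, add_apply, smul_apply, raise_apply, raise_apply, e2,
    lower_apply, smul_eq_mul]
  ring

theorem lower_gaussian : lower gaussian = 0 := by
  ext x
  have h : HasDerivAt (gaussian : ℝ → ℂ) ((Real.exp (-(x ^ 2 / 2)) * -(x) : ℝ) : ℂ) x := by
    refine HasDerivAt.ofReal_comp (f := fun x => Real.exp (-(x ^ 2 / 2))) ?_
    have := (((hasDerivAt_pow 2 x).div_const 2).neg).exp
    simpa using this
  rw [lower_apply, h.deriv, gaussian_apply]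
  simp only [zero_apply]
  push_cast
  ring

theorem emb_gaussian_ne_zero : emb gaussian ≠ 0 := by
  intro h
  have h0 : gaussian = 0 := SchwartzMap.injective_toLp 2 volume (h.trans (map_zero emb).symm)
  have := congrArg (fun f : 𝓢(ℝ, ℂ) => f 0) h0
  simp [gaussian_apply] at this

/-- The normalised Hermite functions. -/
def herm : ℕ → 𝓢(ℝ, ℂ)
  | 0 => ((‖emb gaussian‖⁻¹ : ℝ) : ℂ) • gaussian
  | n + 1 => (((√(2 * (n + 1)))⁻¹ : ℝ) : ℂ) • raise (herm n)

theorem sqrt_two_mul_ne_zero (n : ℕ) : ((√(2 * (n + 1)) : ℝ) : ℂ) ≠ 0 := by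
  have : 0 < √(2 * ((n : ℝ) + 1)) := Real.sqrt_pos.2 (by positivity)
  exact_mod_cast this.ne'

theorem raise_herm (n : ℕ) : raise (herm n) = ((√(2 * (n + 1)) : ℝ) : ℂ) • herm (n + 1) := by
  rw [herm, smul_smul, Complex.ofReal_inv, mul_inv_cancel₀ (sqrt_two_mul_ne_zero n), one_smul]

theorem lower_herm_zero : lower (herm 0) = 0 := by
  rw [herm, map_smul, lower_gaussian, smul_zero]

theorem lower_herm_succ (n : ℕ) :
    lower (herm (n + 1)) = ((√(2 * (n + 1)) : ℝ) : ℂ) • herm n := by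
  have hs : ∀ n : ℕ, ((√(2 * (n + 1)) : ℝ) : ℂ) * ((√(2 * (n + 1)) : ℝ) : ℂ) = 2 * (n + 1) := by
    intro n
    rw [← Complex.ofReal_mul, Real.mul_self_sqrt (by positivity)]
    push_cast; ring
  -- The eigenvalue equation at level `n` comes from the theorem itself at level `n - 1`, so the
  -- recursion is structural.
  have key : raise (lower (herm n)) = (2 * n : ℂ) • herm n := by
    cases n with
    | zero => rw [lower_herm_zero]; simp
    | succ n =>
      rw [lower_herm_succ n, map_smul, raise_herm, smul_smul, hs]
      push_cast; rfl
  rw [herm, map_smul, lower_raise, key, ← add_smul, smul_smul]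
  congr 1
  have h := hs n
  have h0 := sqrt_two_mul_ne_zero n
  rw [Complex.ofReal_inv]
  field_simp
  linear_combination -h

/-- Raising on the left is lowering on the right, so the product at `(m + 1, n + 1)` reduces to that
at `(m, n)`. Products against index zero vanish because `herm 0` is annihilated by lowering. -/
theorem orthonormal_herm : Orthonormal ℂ fun n => emb (herm n) := by
  rw [orthonormal_iff_ite]
  intro m
  induction m with
  | zero =>
    intro n
    cases n with
    | zero =>
      have h0 : (‖emb gaussian‖ : ℂ) ≠ 0 := by
        exact_mod_cast norm_ne_zero_iff.2 emb_gaussian_ne_zero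
      rw [herm, map_smul, inner_smul_left, inner_smul_right, inner_self_eq_norm_sq_to_K]
      simp only [Complex.ofReal_inv, map_inv₀, Complex.conj_ofReal, if_true]
      change (‖emb gaussian‖ : ℂ)⁻¹ * ((‖emb gaussian‖ : ℂ)⁻¹ * (‖emb gaussian‖ : ℂ) ^ 2) = 1
      field_simp
    | succ n =>
      rw [show herm (n + 1) = (((√(2 * (n + 1)))⁻¹ : ℝ) : ℂ) • raise (herm n) from rfl, map_smul,
        inner_smul_right, ← inner_lower, lower_herm_zero]
      simp
  | succ m ih =>
    intro n
    rw [herm, map_smul, inner_smul_left, inner_raise]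
    cases n with
    | zero => rw [lower_herm_zero]; simp
    | succ n =>
      rw [lower_herm_succ, map_smul, inner_smul_right, ih n, Complex.conj_ofReal]
      by_cases h : m = n
      · subst h
        rw [if_pos rfl, if_pos rfl, mul_one, Complex.ofReal_inv,
          inv_mul_cancel₀ (sqrt_two_mul_ne_zero m)]
      · rw [if_neg h, if_neg (by omega)]; simp

/-! ### Completeness of the Hermite functions -/

open scoped FourierTransform in
/-- An integrable function with vanishing Fourier transform vanishes almost everywhere. -/
theorem ae_eq_zero_of_integral_exp {F : ℝ → ℂ} (hF : Integrable F)
    (h : ∀ t : ℝ, ∫ s, Complex.exp (Complex.I * ((t * s : ℝ) : ℂ)) * F s = 0) : F =ᵐ[volume] 0 := by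
  have hf : ∀ ξ, 𝓕 F ξ = 0 := by
    intro ξ
    rw [Real.fourier_real_eq_integral_exp_smul, ← h (-2 * Real.pi * ξ)]
    congr 1; ext s
    rw [smul_eq_mul]
    congr 2
    push_cast; ring
  refine ae_eq_zero_of_integral_contDiff_smul_eq_zero hF.locallyIntegrable fun g hg hg' => ?_
  -- A test function is the Fourier transform of its inverse transform; moving that transform onto
  -- `F` makes the pairing vanish.
  let ψ : 𝓢(ℝ, ℂ) := HasCompactSupport.toSchwartzMap (f := fun x => (g x : ℂ))
    (hg'.comp_left Complex.ofReal_zero) (Complex.ofRealCLM.contDiff.comp hg)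
  have hψ : 𝓕 (𝓕⁻ ψ) = ψ := FourierTransform.fourier_fourierInv_eq ψ
  have h1 := VectorFourier.integral_fourierIntegral_smul_eq_flip (L := innerₗ ℝ)
    (μ := volume) (ν := volume)
    Real.continuous_fourierChar continuous_inner hF (𝓕⁻ ψ : 𝓢(ℝ, ℂ)).integrable
  have h2 : ∀ x, VectorFourier.fourierIntegral Real.fourierChar volume (innerₗ ℝ).flip
      (𝓕⁻ ψ : 𝓢(ℝ, ℂ)) x
      = g x := by
    intro x
    rw [flip_innerₗ]
    exact (congrFun (SchwartzMap.fourier_coe (𝓕⁻ ψ : 𝓢(ℝ, ℂ))) x).symm.trans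
      (congrArg (fun f : 𝓢(ℝ, ℂ) => f x) hψ)
  have h3 : ∀ x, VectorFourier.fourierIntegral Real.fourierChar volume (innerₗ ℝ) F x = 0 := hf
  simp only [h2, h3, zero_smul, integral_zero] at h1
  rw [h1]
  congr 1; ext x
  simp [mul_comm]

/-- The majorant needed to expand `exp (i t s)` under the integral. It follows from `|t s| ≤ t² +
s²/4`, which leaves the Gaussian factor `exp (-s²/4)`. -/
theorem memLp_gaussian_exp (t : ℝ) :
    MemLp (fun s : ℝ => Real.exp |t * s| * Real.exp (-(s ^ 2 / 2))) 2 volume := by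
  have h1 : MemLp (fun s : ℝ => Real.exp (t ^ 2) * Real.exp (-(s ^ 2 / 4))) 2 volume := by
    refine MemLp.const_mul ?_ _
    rw [memLp_two_iff_integrable_sq (by fun_prop)]
    have := integrable_exp_neg_mul_sq (b := 1 / 2) (by norm_num)
    refine this.congr (Filter.Eventually.of_forall fun s => ?_)
    simp only [← Real.exp_nat_mul]
    congr 1; push_cast; ring
  refine h1.mono (by fun_prop) (Filter.Eventually.of_forall fun s => ?_)
  rw [Real.norm_of_nonneg (by positivity), Real.norm_of_nonneg (by positivity), ← Real.exp_add,
    ← Real.exp_add, Real.exp_le_exp]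
  have : |t * s| ≤ t ^ 2 + s ^ 2 / 4 := by
    rw [abs_le]; constructor <;> nlinarith [sq_nonneg (t - s / 2), sq_nonneg (t + s / 2)]
  linarith

/-- A square integrable function orthogonal to all `s ^ n exp (- s ^ 2 / 2)` vanishes. -/
theorem eq_zero_of_moments (x : L2)
    (h : ∀ n : ℕ, ∫ s : ℝ, (s : ℂ) ^ n * ((Real.exp (-(s ^ 2 / 2)) : ℂ) * x s) = 0) : x = 0 := by
  let F : ℝ → ℂ := fun s => (Real.exp (-(s ^ 2 / 2)) : ℂ) * x s
  have hmeas : AEStronglyMeasurable F volume :=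
    (by fun_prop : Continuous fun s : ℝ => (Real.exp (-(s ^ 2 / 2)) : ℂ)).aestronglyMeasurable.mul
      (Lp.aestronglyMeasurable x)
  have hint : ∀ t : ℝ, Integrable fun s : ℝ => Real.exp |t * s| * ‖F s‖ := by
    intro t
    have := (memLp_gaussian_exp t).integrable_mul (Lp.memLp x).norm
    refine this.congr (Filter.Eventually.of_forall fun s => ?_)
    simp only [F, Pi.mul_apply, norm_mul, Complex.norm_real, Real.norm_eq_abs, Real.abs_exp]
    ring
  have hF : Integrable F := by
    refine (integrable_norm_iff hmeas).1 ((hint 0).congr (Filter.Eventually.of_forall fun s => ?_))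
    simp
  have hz : F =ᵐ[volume] 0 := by
    refine ae_eq_zero_of_integral_exp hF fun t => ?_
    -- The Fourier transform of `F` is the sum of its moments, integrated term by term with the
    -- series of `exp |t s|` as majorant; all the moments vanish.
    have hs := hasSum_integral_of_dominated_convergence (μ := volume)
      (F := fun (n : ℕ) (s : ℝ) => (Complex.I * ((t * s : ℝ) : ℂ)) ^ n / n.factorial * F s)
      (f := fun s => Complex.exp (Complex.I * ((t * s : ℝ) : ℂ)) * F s)
      (fun n s => |t * s| ^ n / n.factorial * ‖F s‖) ?_ ?_ ?_ ?_ ?_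
    · refine hs.unique ?_
      convert! hasSum_zero with n
      have e : ∀ s : ℝ, (Complex.I * ((t * s : ℝ) : ℂ)) ^ n / n.factorial * F s =
          ((Complex.I * t) ^ n / n.factorial) * ((s : ℂ) ^ n * F s) := by
        intro s; push_cast; ring
      simp only [e, integral_const_mul]
      rw [h n, mul_zero]
    · exact fun n => (by fun_prop : Continuous fun s : ℝ =>
        (Complex.I * ((t * s : ℝ) : ℂ)) ^ n / n.factorial).aestronglyMeasurable.mul hmeas
    · refine fun n => Filter.Eventually.of_forall fun s => le_of_eq ?_
      simp only [norm_mul, norm_div, norm_pow, Complex.norm_I, one_mul, Complex.norm_real,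
        Real.norm_eq_abs, Complex.norm_natCast, abs_mul]
    · exact Filter.Eventually.of_forall fun s =>
        (Real.summable_pow_div_factorial _).mul_right _
    · refine (hint t).congr (Filter.Eventually.of_forall fun s => ?_)
      simp only [tsum_mul_right]
      rw [Real.exp_eq_exp_ℝ, NormedSpace.exp_eq_tsum_div]
    · refine Filter.Eventually.of_forall fun s => ?_
      have := NormedSpace.exp_series_hasSum_exp' (𝕂 := ℂ) (Complex.I * ((t * s : ℝ) : ℂ))
      rw [← Complex.exp_eq_exp_ℂ] at this
      simpa only [smul_eq_mul, div_eq_inv_mul] using this.mul_right (F s)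
  refine (Lp.eq_zero_iff_ae_eq_zero).2 ?_
  filter_upwards [hz] with s hs
  have : (Real.exp (-(s ^ 2 / 2)) : ℂ) ≠ 0 := by exact_mod_cast (Real.exp_pos _).ne'
  simpa [F] using hs

/-- The Hermite functions span an invariant subspace of multiplication by `s`. -/
theorem pow_mul_gaussian_mem (n : ℕ) :
    ((pder 0) ^ n) gaussian ∈ Submodule.span ℂ (Set.range herm) := by
  have h0 : ∀ φ ∈ Submodule.span ℂ (Set.range herm), pder 0 φ ∈ Submodule.span ℂ (Set.range herm) := by
    intro φ hφ
    have hm : ∀ n, herm n ∈ Submodule.span ℂ (Set.range herm) := fun n =>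
      Submodule.subset_span ⟨n, rfl⟩
    -- Multiplication by `s` is half the sum of the two ladder operators.
    have e : pder 0 = (1 / 2 : ℂ) • (raise + lower) := by
      rw [raise, lower, sub_add_add_cancel, ← two_smul ℂ, smul_smul]; norm_num
    induction hφ using Submodule.span_induction with
    | mem φ h =>
      obtain ⟨n, rfl⟩ := h
      rw [e, LinearMap.smul_apply, LinearMap.add_apply, raise_herm]
      refine Submodule.smul_mem _ _ (Submodule.add_mem _ (Submodule.smul_mem _ _ (hm _)) ?_)
      cases n with
      | zero => rw [lower_herm_zero]; exact Submodule.zero_mem _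
      | succ n => rw [lower_herm_succ]; exact Submodule.smul_mem _ _ (hm _)
    | zero => rw [map_zero]; exact Submodule.zero_mem _
    | add φ ψ _ _ h1 h2 => rw [map_add]; exact Submodule.add_mem _ h1 h2
    | smul c φ _ h1 => rw [map_smul]; exact Submodule.smul_mem _ _ h1
  induction n with
  | zero =>
    have h1 : herm 0 ∈ Submodule.span ℂ (Set.range herm) := Submodule.subset_span ⟨0, rfl⟩
    have h2 := Submodule.smul_mem _ ((‖emb gaussian‖ : ℝ) : ℂ) h1
    rwa [herm, smul_smul, ← Complex.ofReal_mul, mul_inv_cancel₀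
      (norm_ne_zero_iff.2 emb_gaussian_ne_zero), Complex.ofReal_one, one_smul] at h2
  | succ n ih =>
    rw [pow_succ', Module.End.mul_apply]
    exact h0 _ ih

theorem pow_pder_zero_apply (n : ℕ) (φ : 𝓢(ℝ, ℂ)) (s : ℝ) :
    ((pder 0) ^ n) φ s = (s : ℂ) ^ n * φ s := by
  induction n with
  | zero => simp
  | succ n ih =>
    rw [pow_succ', Module.End.mul_apply, pder_zero_apply, ih]
    ring

/-- The Hermite basis of `L²(ℝ)`. -/
def hermBasis : HilbertBasis ℕ ℂ L2 :=
  HilbertBasis.mkOfOrthogonalEqBot orthonormal_herm (by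
    rw [Submodule.eq_bot_iff]
    intro x hx
    rw [Submodule.mem_orthogonal] at hx
    refine eq_zero_of_moments x fun n => ?_
    have h1 : ∀ φ ∈ Submodule.span ℂ (Set.range herm), ⟪emb φ, x⟫_ℂ = 0 := by
      intro φ hφ
      refine hx _ ?_
      have := Submodule.mem_map_of_mem (f := emb) hφ
      rwa [Submodule.map_span, ← Set.range_comp] at this
    rw [← h1 _ (pow_mul_gaussian_mem n)]
    refine integral_congr_ae ?_
    filter_upwards [emb_ae (((pder 0) ^ n) gaussian)] with s hs
    rw [hs, pow_pder_zero_apply, gaussian_apply, RCLike.inner_apply, map_mul, map_pow,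
      Complex.conj_ofReal, Complex.conj_ofReal]
    ring)

theorem hermBasis_apply (n : ℕ) : hermBasis n = emb (herm n) := by
  rw [hermBasis, HilbertBasis.coe_mkOfOrthogonalEqBot]

/-! ### The Dirac operator in the Hermite basis -/

/-- The index set of the Hermite basis of the Hilbert space. -/
abbrev HIdx : Type := (SignType × Fin 2) × ℕ

/-- The Hermite function `herm n` in the component `(ν, j)`. -/
def coreVec (i : HIdx) : SCore := Pi.single i.1 (herm i.2)

theorem coreIncl_apply (φ : SCore) (x : SignType × Fin 2) : coreIncl φ x = emb (φ x) := rfl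

theorem inner_coreVec (i : HIdx) (y : HSpace) :
    ⟪coreIncl (coreVec i), y⟫_ℂ = ⟪hermBasis i.2, y i.1⟫_ℂ := by
  rw [PiLp.inner_apply, Finset.sum_eq_single i.1]
  · rw [coreIncl_apply, coreVec, Pi.single_eq_same, hermBasis_apply]
  · intro x _ hx
    rw [coreIncl_apply, coreVec, Pi.single_eq_of_ne hx, map_zero, inner_zero_left]
  · simp

theorem coreVec_apply (i : HIdx) (x : SignType × Fin 2) :
    coreIncl (coreVec i) x = if x = i.1 then hermBasis i.2 else 0 := by
  rw [coreIncl_apply, coreVec]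
  split_ifs with h
  · subst h; rw [Pi.single_eq_same, hermBasis_apply]
  · rw [Pi.single_eq_of_ne h, map_zero]

theorem orthonormal_coreVec : Orthonormal ℂ fun i => coreIncl (coreVec i) := by
  rw [orthonormal_iff_ite]
  rintro ⟨x, m⟩ ⟨y, n⟩
  rw [inner_coreVec, coreVec_apply]
  simp only [Prod.mk.injEq]
  by_cases h : x = y
  · subst h
    simp [orthonormal_iff_ite.1 hermBasis.orthonormal]
  · simp [h]

/-- The Hermite basis of the Hilbert space. -/
def hBasis : HilbertBasis HIdx ℂ HSpace :=
  HilbertBasis.mkOfOrthogonalEqBot orthonormal_coreVec (by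
    rw [Submodule.eq_bot_iff]
    intro y hy
    rw [Submodule.mem_orthogonal] at hy
    ext1 x
    refine basis_ext hermBasis fun n => ?_
    have := hy _ (Submodule.subset_span ⟨(x, n), rfl⟩)
    rw [inner_coreVec] at this
    simpa using this)

theorem hBasis_eq (i : HIdx) : hBasis i = coreIncl (coreVec i) := by
  rw [hBasis, HilbertBasis.coe_mkOfOrthogonalEqBot]

theorem inner_hBasis (i : HIdx) (y : HSpace) : ⟪hBasis i, y⟫_ℂ = ⟪hermBasis i.2, y i.1⟫_ℂ := by
  rw [hBasis_eq, inner_coreVec]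

theorem hBasis_apply (i : HIdx) (x : SignType × Fin 2) :
    hBasis i x = if x = i.1 then hermBasis i.2 else 0 := by
  rw [hBasis_eq, coreVec_apply]

/-- The involution of the Hermite basis underlying the Dirac operator. -/
def diracPerm : HIdx → HIdx
  | ((ν, 0), 0) => ((ν, 0), 0)
  | ((ν, 0), n + 1) => ((ν, 1), n)
  | ((ν, 1), n) => ((ν, 0), n + 1)

/-- The weights and the involution of the Hermite basis describing the Dirac operator. -/
def diracW : WPerm HIdx where
  -- On the spinor components `0` and `1` the square has eigenvalues `2 n` and `2 (n + 1)`. The only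
  -- fixed points of the involution are the vectors with `n = 0` in component `0`; they have weight
  -- zero and span the kernel.
  p i := √(2 * (i.2 + ((i.1.2 : ℕ) : ℝ)))
  σ := diracPerm
  σσ := by
    rintro ⟨⟨ν, j⟩, n⟩
    fin_cases j
    · cases n <;> rfl
    · rfl
  pσ := by
    rintro ⟨⟨ν, j⟩, n⟩
    fin_cases j
    · cases n
      · rfl
      · simp [diracPerm]
    · simp [diracPerm]

theorem diracCore_apply_zero (φ : SCore) (ν : SignType) :
    diracCore φ (ν, 0) = raise (φ (ν, 1)) := by
  simp [diracCore, gam, raise, sub_eq_add_neg]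

theorem diracCore_apply_one (φ : SCore) (ν : SignType) :
    diracCore φ (ν, 1) = lower (φ (ν, 0)) := by
  simp [diracCore, gam, lower]

theorem diracCore_coreVec (i : HIdx) :
    diracCore (coreVec i) = (diracW.p i : ℂ) • coreVec (diracW.σ i) := by
  obtain ⟨⟨ν, j⟩, n⟩ := i
  funext ⟨μ, k⟩
  fin_cases j <;> fin_cases k
  · change diracCore _ (μ, 0) = _
    rw [diracCore_apply_zero]
    cases n <;> simp [diracW, diracPerm, coreVec, Pi.single_apply]
  · change diracCore _ (μ, 1) = _
    rw [diracCore_apply_one]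
    cases n with
    | zero =>
      by_cases h : μ = ν
      · subst h; simp [diracW, diracPerm, coreVec, lower_herm_zero]
      · simp [diracW, diracPerm, coreVec, h]
    | succ n =>
      by_cases h : μ = ν
      · subst h; simp [diracW, diracPerm, coreVec, lower_herm_succ]
      · simp [diracW, diracPerm, coreVec, h]
  · change diracCore _ (μ, 0) = _
    rw [diracCore_apply_zero]
    by_cases h : μ = ν
    · subst h; simp [diracW, diracPerm, coreVec, raise_herm]
    · simp [diracW, diracPerm, coreVec, h]
  · change diracCore _ (μ, 1) = _
    rw [diracCore_apply_one]
    simp [diracW, diracPerm, coreVec]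

theorem inner_diracCore (φ ψ : SCore) :
    ⟪coreIncl (diracCore φ), coreIncl ψ⟫_ℂ = ⟪coreIncl φ, coreIncl (diracCore ψ)⟫_ℂ := by
  simp only [PiLp.inner_apply, coreIncl_apply, Fintype.sum_prod_type, Fin.sum_univ_two,
    diracCore_apply_zero, diracCore_apply_one, inner_raise, inner_lower]
  exact Finset.sum_congr rfl fun _ _ => add_comm _ _

/-- Symmetry on the Schwartz core, paired with Hermite vectors, places the graph of `γ^k ∂_k` inside
the coordinate graph. Since the core contains the basis, the closure is all of it. -/
theorem dirac_eq : dirac = diracW.op hBasis := by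
  refine diracW.closure_toLinearPMap hBasis ?_ fun i => ⟨coreVec i, ?_⟩
  · rintro _ ⟨φ, rfl⟩ i
    simp only [LinearMap.prod_apply, Function.prod, LinearMap.comp_apply]
    rw [hBasis_eq, ← inner_diracCore, diracCore_coreVec, map_smul, inner_smul_left,
      Complex.conj_ofReal, hBasis_eq]
  · simp only [LinearMap.prod_apply, Function.prod, LinearMap.comp_apply, diracCore_coreVec, hBasis_eq,
      map_smul]

theorem oscillator_apply (φ : 𝓢(ℝ, ℂ)) (s : ℝ) :
    oscillator φ s = (s : ℂ) ^ 2 * φ s - deriv (deriv φ) s := by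
  change SchwartzMap.smulLeftCLM ℂ (fun s : ℝ => (s : ℂ) ^ 2) φ s - deriv (deriv φ) s = _
  rw [SchwartzMap.smulLeftCLM_apply_apply (by fun_prop), smul_eq_mul]

theorem raise_lower (φ : 𝓢(ℝ, ℂ)) : raise (lower φ) = oscillator φ - φ := by
  ext s
  have hd : HasDerivAt (deriv φ) (deriv (deriv φ) s) s :=
    ((SchwartzMap.derivCLM ℂ ℂ φ).differentiableAt (x := s)).hasDerivAt
  have e2 : deriv (lower φ) s = φ s + s * deriv φ s + deriv (deriv φ) s := by
    have : (lower φ : ℝ → ℂ) = fun x : ℝ => (x : ℂ) * φ x + deriv φ x :=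
      funext fun x => lower_apply φ x
    rw [this]
    exact ((hasDerivAt_mul_schwartz φ s).add hd).deriv
  rw [sub_apply, raise_apply, e2, lower_apply, oscillator_apply]
  ring

/-- The square is raising after lowering in component `0` and lowering after raising in component
`1`, that is `H - 1` and `H + 1`. -/
theorem oscillatorCore_apply (φ : SCore) : oscillatorCore φ = diracCore (diracCore φ) := by
  funext ⟨ν, j⟩
  fin_cases j
  · change oscillatorCore φ (ν, 0) = diracCore (diracCore φ) (ν, 0)
    rw [diracCore_apply_zero, diracCore_apply_one, raise_lower]
    simp [oscillatorCore, sub_eq_add_neg]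
  · change oscillatorCore φ (ν, 1) = diracCore (diracCore φ) (ν, 1)
    rw [diracCore_apply_one, diracCore_apply_zero, lower_raise, raise_lower, two_smul]
    simp [oscillatorCore]

theorem oscillatorOp_eq :
    oscillatorOp = (WPerm.diag fun i => diracW.p i ^ 2).op hBasis := by
  have hv : ∀ i, oscillatorCore (coreVec i) = ((diracW.p i ^ 2 : ℝ) : ℂ) • coreVec i := by
    intro i
    rw [oscillatorCore_apply, diracCore_coreVec, map_smul, diracCore_coreVec, diracW.σσ, diracW.pσ,
      smul_smul, ← Complex.ofReal_mul, sq]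
  refine WPerm.closure_toLinearPMap _ hBasis ?_ fun i => ⟨coreVec i, ?_⟩
  · rintro _ ⟨φ, rfl⟩ i
    simp only [LinearMap.prod_apply, Function.prod, LinearMap.comp_apply, WPerm.diag, id]
    rw [hBasis_eq, oscillatorCore_apply, ← inner_diracCore, ← inner_diracCore,
      ← oscillatorCore_apply, hv, map_smul, inner_smul_left, Complex.conj_ofReal]
  · simp only [LinearMap.prod_apply, Function.prod, LinearMap.comp_apply, hv, hBasis_eq, map_smul,
      WPerm.diag, id]

theorem graphMul_dirac : graphMul dirac dirac = (oscillatorOp.graph : Set (HSpace × HSpace)) := by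
  rw [dirac_eq, oscillatorOp_eq, WPerm.graphMul_op]

theorem isSelfAdjoint_dirac : IsSelfAdjoint dirac := by
  rw [dirac_eq]; exact diracW.isSelfAdjoint_op hBasis

/-- A bound on the weight bounds `n`, and only finitely many summands and spinor components occur.
-/
theorem hasCompactResolvent_dirac : HasCompactResolvent dirac := by
  rw [dirac_eq]
  refine diracW.hasCompactResolvent_op hBasis (Filter.tendsto_atTop.2 fun c => ?_)
  rw [Filter.eventually_cofinite]
  obtain ⟨N, hN⟩ := exists_nat_gt (c ^ 2)
  refine ((Set.finite_univ (α := SignType × Fin 2)).prod (Set.finite_Iio N)).subset ?_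
  rintro ⟨x, n⟩ h
  refine ⟨Set.mem_univ _, ?_⟩
  by_contra hn
  apply h
  have hn' : (N : ℝ) ≤ n := by exact_mod_cast not_lt.1 hn
  refine Real.le_sqrt_of_sq_le ?_
  have : (0 : ℝ) ≤ ((x.2 : ℕ) : ℝ) := by positivity
  have : (0 : ℝ) ≤ n := by positivity
  simp only
  linarith

/-! ### Matrix operators on the spinor components -/

theorem spinMat_apply (M : Matrix (Fin 2) (Fin 2) ℂ) (x : HSpace) (i : SignType × Fin 2) :
    spinMat M x i = ∑ j, M i.2 j • x (i.1, j) := by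
  change (∑ j, M i.2 j • PiLp.proj 2 (fun _ : SignType × Fin 2 => L2) (i.1, j) :
    HSpace →L[ℂ] L2) x = _
  simp [Fin.sum_univ_two]

theorem rep_apply (f : TestAlg) (x : HSpace) (i : SignType × Fin 2) :
    rep f x i = repOn i.1 f (x i) := rfl

theorem grading_apply (x : HSpace) (i : SignType × Fin 2) :
    grading x i = (![1, -1] i.2 : ℂ) • x i := by
  obtain ⟨ν, j⟩ := i
  have : (-Complex.I) • (gam 0 * gam 1) = !![1, 0; 0, -1] := by
    ext a b
    fin_cases a <;> fin_cases b <;> simp [gam]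
  rw [grading, this, spinMat_apply]
  fin_cases j <;> simp [Fin.sum_univ_two]

theorem grading_grading : grading * grading = 1 := by
  refine ContinuousLinearMap.ext fun x => ?_
  ext1 ⟨ν, j⟩
  rw [mul_apply_eq_comp, grading_apply, grading_apply, smul_smul]
  fin_cases j <;> simp

theorem isSelfAdjoint_grading : IsSelfAdjoint grading := by
  rw [ContinuousLinearMap.isSelfAdjoint_iff_isSymmetric]
  intro x y
  change ⟪grading x, y⟫_ℂ = ⟪x, grading y⟫_ℂ
  simp only [PiLp.inner_apply, grading_apply, Fintype.sum_prod_type, Fin.sum_univ_two]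
  simp [inner_neg_left, inner_neg_right]

theorem grading_rep (f : TestAlg) : grading * rep f = rep f * grading := by
  refine ContinuousLinearMap.ext fun x => ?_
  ext1 i
  rw [mul_apply_eq_comp, mul_apply_eq_comp, grading_apply, rep_apply,
    rep_apply, grading_apply, map_smul]

/-- The involution exchanges the eigenspaces of the grading, except at its fixed points, where the
weight is zero. -/
theorem grading_anticomm (x : dirac.domain) :
    ∃ h : grading x ∈ dirac.domain, dirac ⟨grading x, h⟩ = -grading (dirac x) := by
  -- The operator is a variable so that `dirac_eq` can be substituted into types that depend on its
  -- domain.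
  have key : ∀ D, D = diracW.op hBasis → ∀ x : D.domain,
      ∃ h : grading x ∈ D.domain, D ⟨grading x, h⟩ = -grading (D x) := by
    rintro _ rfl x
    refine diracW.exists_domain hBasis fun i => ?_
    have hx := diracW.inner_op hBasis x i
    rw [inner_neg_right, inner_hBasis, inner_hBasis, grading_apply, grading_apply, inner_smul_right,
      inner_smul_right, ← inner_hBasis, ← inner_hBasis, hx]
    obtain ⟨⟨ν, j⟩, n⟩ := i
    fin_cases j
    · cases n <;> simp [diracW, diracPerm]
    · simp [diracW, diracPerm]
  exact key dirac dirac_eq x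

/-! ### The integrated representation on Schwartz functions -/

theorem hasDerivAt_integral_of_compact {F F' : ℝ → ℝ × ℝ → ℂ} {k : Set (ℝ × ℝ)} (hk : IsCompact k)
    (hF : Continuous (Function.uncurry F)) (hF' : Continuous (Function.uncurry F'))
    (h0 : ∀ s p, p ∉ k → F s p = 0) (h0' : ∀ s p, p ∉ k → F' s p = 0)
    (hd : ∀ s p, HasDerivAt (fun s => F s p) (F' s p) s) (s : ℝ) :
    HasDerivAt (fun s => ∫ p, F s p) (∫ p, F' s p) s := by
  obtain ⟨C, hC⟩ := ((isCompact_closedBall s 1).prod hk).exists_bound_of_continuousOn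
    hF'.continuousOn
  have hint : Integrable (k.indicator fun _ => C) (volume : Measure (ℝ × ℝ)) :=
    (integrable_indicator_iff hk.measurableSet).2 (integrableOn_const hk.measure_lt_top.ne)
  have hc : ∀ {G : ℝ → ℝ × ℝ → ℂ}, Continuous (Function.uncurry G) → ∀ s, Continuous (G s) :=
    fun hG s => hG.comp (by fun_prop : Continuous fun p : ℝ × ℝ => (s, p))
  refine (hasDerivAt_integral_of_dominated_loc_of_deriv_le (bound := k.indicator fun _ => C)
    (Metric.ball_mem_nhds s one_pos) (Filter.Eventually.of_forall fun x =>
      (hc hF x).aestronglyMeasurable) ?_ (hc hF' s).aestronglyMeasurable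
    (Filter.Eventually.of_forall fun p x hx => ?_) hint
    (Filter.Eventually.of_forall fun p x _ => hd x p)).2
  · exact (hc hF s).integrable_of_hasCompactSupport (HasCompactSupport.intro hk fun p => h0 s p)
  · by_cases hp : p ∈ k
    · rw [Set.indicator_of_mem hp]
      exact hC (x, p) ⟨Metric.ball_subset_closedBall hx, hp⟩
    · rw [Set.indicator_of_notMem hp, h0' x p hp, norm_zero]

theorem hasDerivAt_phase_right (ν : SignType) (b s : ℝ) :
    HasDerivAt (fun s => phase ν b s)
      (-(Complex.I * ((ν : ℝ) * b * Real.exp (-s) : ℝ) * phase ν b s)) s := by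
  have h1 : HasDerivAt (fun s : ℝ => (ν : ℝ) * b * Real.exp (-s))
      ((ν : ℝ) * b * (Real.exp (-s) * -1)) s := ((hasDerivAt_neg s).exp).const_mul _
  have h2 := ((h1.ofReal_comp).const_mul Complex.I).cexp
  convert! h2 using 1
  simp only [phase]
  push_cast
  ring

theorem hasDerivAt_phase_left (ν : SignType) (b s : ℝ) :
    HasDerivAt (fun b => phase ν b s) (Complex.I * ((ν : ℝ) * Real.exp (-s) : ℝ) * phase ν b s) b := by
  have h1 : HasDerivAt (fun b : ℝ => (ν : ℝ) * b * Real.exp (-s))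
      ((ν : ℝ) * 1 * Real.exp (-s)) b := ((hasDerivAt_id b).const_mul _).mul_const _
  have h2 := ((h1.ofReal_comp).const_mul Complex.I).cexp
  convert! h2 using 1
  simp only [phase]
  push_cast
  ring

/-- The pointwise formula for `π_ν(f) φ`. -/
def repFun (ν : SignType) (f : TestAlg) (φ : ℝ → ℂ) (s : ℝ) : ℂ :=
  ∫ p : ℝ × ℝ, ((Real.exp p.1 : ℂ) * f p) * (phase ν p.2 s * φ (s + p.1))

section repFun

variable (ν : SignType) (f : TestAlg) {φ : ℝ → ℂ}

theorem continuous_repFun_integrand (hφ : Continuous φ) : Continuous (Function.uncurry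
    fun (s : ℝ) (p : ℝ × ℝ) => ((Real.exp p.1 : ℂ) * f p) * (phase ν p.2 s * φ (s + p.1))) := by
  have h1 : Continuous fun x : ℝ × ℝ × ℝ => phase ν x.2.2 x.1 :=
    (continuous_phase ν).comp (by fun_prop : Continuous fun x : ℝ × ℝ × ℝ => (x.2.2, x.1))
  have h2 := f.continuous
  simp only [Function.uncurry_def]
  fun_prop

theorem integrable_repFun (hφ : Continuous φ) (s : ℝ) : Integrable
    fun p : ℝ × ℝ => ((Real.exp p.1 : ℂ) * f p) * (phase ν p.2 s * φ (s + p.1)) :=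
  ((continuous_repFun_integrand ν f hφ).comp
    (by fun_prop : Continuous fun p : ℝ × ℝ => (s, p))).integrable_of_hasCompactSupport
    (HasCompactSupport.intro f.hasCompactSupport.isCompact fun p hp => by
      simp [image_eq_zero_of_notMem_tsupport hp])

theorem continuous_repFun (hφ : Continuous φ) : Continuous (repFun ν f φ) := by
  rw [← continuousOn_univ]
  exact continuousOn_integral_of_compact_support f.hasCompactSupport.isCompact
    (continuous_repFun_integrand ν f hφ).continuousOn fun s p _ hp => by
      simp [image_eq_zero_of_notMem_tsupport hp]

theorem norm_repFun_le {C : ℝ} (hC : ∀ s, ‖φ s‖ ≤ C) (s : ℝ) :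
    ‖repFun ν f φ s‖ ≤ (∫ p : ℝ × ℝ, ‖(Real.exp p.1 : ℂ) * f p‖) * C := by
  rw [← integral_mul_const]
  have hi : Integrable fun p : ℝ × ℝ => (Real.exp p.1 : ℂ) * f p :=
    ((by fun_prop : Continuous fun p : ℝ × ℝ => (Real.exp p.1 : ℂ)).mul
      f.continuous).integrable_of_hasCompactSupport f.hasCompactSupport.mul_left
  refine norm_integral_le_of_norm_le (hi.norm.mul_const C) (Filter.Eventually.of_forall fun p => ?_)
  rw [norm_mul _ (phase ν p.2 s * _), norm_mul (phase ν p.2 s), norm_phase, one_mul]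
  exact mul_le_mul_of_nonneg_left (hC _) (norm_nonneg _)

/-- For fixed `a`, the second factor is the `b`-derivative of the compactly supported function `b
f(a, b) phase(b, s)`, while the first factor does not involve `b`. -/
theorem integral_repFun_by_parts (hφ : Continuous φ) (s : ℝ) :
    ∫ p : ℝ × ℝ, ((Real.exp p.1 : ℂ) * φ (s + p.1)) * (((f p + p.2 * f.dirDeriv p) * phase ν p.2 s) +
      p.2 * f p * (Complex.I * ((ν : ℝ) * Real.exp (-s) : ℝ) * phase ν p.2 s)) = 0 := by
  have hf := f.continuous
  have hf' := f.contDiff_dirDeriv.continuous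
  have hph : Continuous fun x : ℝ × ℝ => phase ν x.2 s :=
    (continuous_phase ν).comp (by fun_prop : Continuous fun x : ℝ × ℝ => (x.2, s))
  have hk := f.hasCompactSupport.isCompact
  have hz : ∀ p, p ∉ tsupport f → f.dirDeriv p = 0 := fun p hp =>
    image_eq_zero_of_notMem_tsupport fun h => hp (tsupport_fderiv_apply_subset ℝ (0, 1) h)
  have hcont : Continuous fun p : ℝ × ℝ => ((f p + p.2 * f.dirDeriv p) * phase ν p.2 s) +
      p.2 * f p * (Complex.I * ((ν : ℝ) * Real.exp (-s) : ℝ) * phase ν p.2 s) := by fun_prop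
  have hcs : HasCompactSupport fun p : ℝ × ℝ => ((f p + p.2 * f.dirDeriv p) * phase ν p.2 s) +
      p.2 * f p * (Complex.I * ((ν : ℝ) * Real.exp (-s) : ℝ) * phase ν p.2 s) :=
    HasCompactSupport.intro hk fun p hp => by
      simp [image_eq_zero_of_notMem_tsupport hp, hz p hp]
  have hi : Integrable (fun p : ℝ × ℝ => ((Real.exp p.1 : ℂ) * φ (s + p.1)) *
      (((f p + p.2 * f.dirDeriv p) * phase ν p.2 s) +
      p.2 * f p * (Complex.I * ((ν : ℝ) * Real.exp (-s) : ℝ) * phase ν p.2 s)))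
      (volume.prod volume) :=
    ((by fun_prop : Continuous fun p : ℝ × ℝ => (Real.exp p.1 : ℂ) * φ (s + p.1)).mul
      hcont).integrable_of_hasCompactSupport hcs.mul_left
  rw [Measure.volume_eq_prod, integral_prod _ hi]
  simp only [integral_const_mul]
  have hsec : ∀ {G : ℝ × ℝ → ℂ} (a : ℝ), Continuous G → HasCompactSupport G →
      Integrable fun b => G (a, b) := fun {G} a hG hG' =>
    (hG.comp (by fun_prop : Continuous fun b : ℝ => (a, b))).integrable_of_hasCompactSupport
      (HasCompactSupport.intro (hG'.isCompact.image continuous_snd) fun b hb =>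
        image_eq_zero_of_notMem_tsupport (f := G) fun h => hb ⟨(a, b), h, rfl⟩)
  have hzero : ∀ a : ℝ, ∫ b : ℝ, (((f (a, b) + b * f.dirDeriv (a, b)) * phase ν b s) +
      b * f (a, b) * (Complex.I * ((ν : ℝ) * Real.exp (-s) : ℝ) * phase ν b s)) = 0 := by
    intro a
    refine integral_eq_zero_of_hasDerivAt_of_integrable
      (f := fun b : ℝ => (b : ℂ) * f (a, b) * phase ν b s) (fun b => ?_) (hsec a hcont hcs)
      (hsec (G := fun p : ℝ × ℝ => (p.2 : ℂ) * f p * phase ν p.2 s) a (by fun_prop)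
        (HasCompactSupport.intro hk fun p hp => by simp [image_eq_zero_of_notMem_tsupport hp]))
    have h1 : HasDerivAt (fun b : ℝ => f (a, b)) (f.dirDeriv (a, b)) b := by
      have h2 : HasDerivAt (fun b : ℝ => (a, b)) ((0 : ℝ), (1 : ℝ)) b :=
        (hasDerivAt_const b a).prodMk (hasDerivAt_id b)
      exact ((f.contDiff.differentiable (by simp)) (a, b)).hasFDerivAt.comp_hasDerivAt b h2
    have h3 : HasDerivAt (fun b : ℝ => (b : ℂ)) 1 b := by
      simpa using (hasDerivAt_id b).ofReal_comp
    convert! (h3.mul h1).mul (hasDerivAt_phase_left ν b s) using 1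
    simp only [Pi.mul_apply]
    ring
  simp only [hzero, mul_zero, integral_zero]

/-- The `s`-derivative of the phase equals `-b ∂_b` of it; integrating by parts in `b` replaces `f`
by `f + b ∂_b f`, which is `-δ₂ f`. -/
theorem hasDerivAt_repFun {φ' : ℝ → ℂ} (hφ' : Continuous φ') (hd : ∀ s, HasDerivAt φ (φ' s) s)
    (s : ℝ) :
    HasDerivAt (repFun ν f φ) (repFun ν f φ' s - repFun ν (TestAlg.del₂ f) φ s) s := by
  have hφ : Continuous φ := continuous_iff_continuousAt.2 fun s => (hd s).continuousAt
  have hph : Continuous fun x : ℝ × ℝ × ℝ => phase ν x.2.2 x.1 :=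
    (continuous_phase ν).comp (by fun_prop : Continuous fun x : ℝ × ℝ × ℝ => (x.2.2, x.1))
  have hf := f.continuous
  have hk := f.hasCompactSupport.isCompact
  have h := hasDerivAt_integral_of_compact hk (continuous_repFun_integrand ν f hφ)
    (F' := fun s p => ((Real.exp p.1 : ℂ) * f p) *
      (-(Complex.I * ((ν : ℝ) * p.2 * Real.exp (-s) : ℝ) * phase ν p.2 s) * φ (s + p.1) +
        phase ν p.2 s * φ' (s + p.1)))
    (by simp only [Function.uncurry_def]; fun_prop)
    (fun s p hp => by simp [image_eq_zero_of_notMem_tsupport hp])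
    (fun s p hp => by simp [image_eq_zero_of_notMem_tsupport hp])
    (fun s p => by
      have h1 : HasDerivAt (fun s => φ (s + p.1)) (φ' (s + p.1)) s := (hd _).comp_add_const s p.1
      exact ((hasDerivAt_phase_right ν p.2 s).mul h1).const_mul _) s
  convert! h using 1
  have h0 := integral_repFun_by_parts ν f hφ s
  have i1 := integrable_repFun ν f hφ' s
  have i2 := integrable_repFun ν (TestAlg.del₂ f) hφ s
  have i3 : Integrable fun p : ℝ × ℝ => ((Real.exp p.1 : ℂ) * f p) *
      (-(Complex.I * ((ν : ℝ) * p.2 * Real.exp (-s) : ℝ) * phase ν p.2 s) * φ (s + p.1) +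
        phase ν p.2 s * φ' (s + p.1)) := by
    have hph' : Continuous fun x : ℝ × ℝ => phase ν x.2 s :=
      (continuous_phase ν).comp (by fun_prop : Continuous fun x : ℝ × ℝ => (x.2, s))
    refine Continuous.integrable_of_hasCompactSupport (by fun_prop) (HasCompactSupport.intro hk ?_)
    intro p hp
    simp [image_eq_zero_of_notMem_tsupport hp]
  rw [← sub_eq_zero, ← h0, repFun, repFun, ← integral_sub i1 i2]
  refine (integral_sub (i1.sub i2) i3).symm.trans ?_
  congr 1
  ext p
  have e : TestAlg.del₂ f p = -f p - p.2 * f.dirDeriv p := rfl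
  simp only [Pi.sub_apply, e]
  push_cast
  ring

/-- Write `a = (s + a) - s` in the integrand. -/
theorem repFun_del₁ (φ : ℝ → ℂ) (hφ : Continuous φ) (s : ℝ) :
    repFun ν (TestAlg.del₁ f) φ s =
      -Complex.I * (s * repFun ν f φ s - repFun ν f (fun s : ℝ => (s : ℂ) * φ s) s) := by
  have i1 := (integrable_repFun ν f hφ s).const_mul (s : ℂ)
  have i2 := integrable_repFun ν f (φ := fun s : ℝ => (s : ℂ) * φ s) (by fun_prop) s
  rw [repFun, repFun, repFun, ← integral_const_mul, ← integral_sub i1 i2, ← integral_const_mul]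
  congr 1
  ext p
  have e : TestAlg.del₁ f p = Complex.I * p.1 * f p := rfl
  rw [e]
  push_cast
  ring

theorem repFun_smul (c : ℂ) (φ : ℝ → ℂ) (s : ℝ) :
    repFun ν (c • f) φ s = c * repFun ν f φ s := by
  rw [repFun, repFun, ← integral_const_mul]
  congr 1
  ext p
  rw [TestAlg.smul_apply]
  ring

end repFun

theorem repOn_apply (ν : SignType) (f : TestAlg) (φ : L2) :
    repOn ν f φ = ∫ p : ℝ × ℝ, ((Real.exp p.1 : ℂ) * f p) • unitaryRep ν p φ := rfl

theorem inner_repOn (ν : SignType) (f : TestAlg) (φ ψ : L2) :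
    ⟪ψ, repOn ν f φ⟫_ℂ = ∫ p : ℝ × ℝ, ((Real.exp p.1 : ℂ) * f p) * ⟪ψ, unitaryRep ν p φ⟫_ℂ := by
  rw [repOn_apply, ← innerSL_apply_apply ℂ,
    ← (innerSL ℂ ψ).integral_comp_comm (integrable_rep ν f φ)]
  simp only [innerSL_apply_apply, inner_smul_right]

/-- Fubini identifies the `L²`-valued integral with the pointwise formula in weak form, which is all
that the matrix elements require. -/
theorem inner_repOn_emb (ν : SignType) (f : TestAlg) (φ ψ : 𝓢(ℝ, ℂ)) :
    ⟪emb ψ, repOn ν f (emb φ)⟫_ℂ = ∫ s, (starRingEnd ℂ) (ψ s) * repFun ν f φ s := by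
  have h1 : ∀ p : ℝ × ℝ, ⟪emb ψ, unitaryRep ν p (emb φ)⟫_ℂ =
      ∫ s, (starRingEnd ℂ) (ψ s) * (phase ν p.2 s * φ (s + p.1)) := by
    intro p
    refine integral_congr_ae ?_
    filter_upwards [emb_ae ψ, unitaryRep_ae ν p (emb φ), quasi_shift p.1 (emb_ae φ)]
      with s e1 e2 e3
    rw [e1, e2, e3, RCLike.inner_apply, mul_comm]
  rw [inner_repOn]
  simp only [h1, repFun, ← integral_const_mul]
  obtain ⟨C, hC⟩ : ∃ C, ∀ s, ‖φ s‖ ≤ C := ⟨_, fun s => SchwartzMap.norm_le_seminorm ℂ φ s⟩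
  rw [integral_integral_swap]
  · congr 1; ext s; congr 1; ext p; ring
  have i1 : Integrable (fun p : ℝ × ℝ => (Real.exp p.1 : ℂ) * f p) :=
    ((by fun_prop : Continuous fun p : ℝ × ℝ => (Real.exp p.1 : ℂ)).mul
      f.continuous).integrable_of_hasCompactSupport f.hasCompactSupport.mul_left
  have i2 := (i1.mul_prod (ψ.integrable (μ := volume))).norm.mul_const C
  refine i2.mono' ?_ (Filter.Eventually.of_forall fun x => ?_)
  · have hf := f.continuous
    have hψ := ψ.continuous
    have hφ := φ.continuous
    have hph : Continuous fun x : (ℝ × ℝ) × ℝ => phase ν x.1.2 x.2 :=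
      (continuous_phase ν).comp (by fun_prop : Continuous fun x : (ℝ × ℝ) × ℝ => (x.1.2, x.2))
    refine Continuous.aestronglyMeasurable ?_
    simp only [Function.uncurry_def]
    fun_prop
  · simp only [Function.uncurry_def, norm_mul, norm_phase, RCLike.norm_conj, one_mul]
    have := hC (x.2 + x.1.1)
    rw [← mul_assoc]
    gcongr

/-- The commutators of the integrated representation with `∂₁` and `∂₂`, on Schwartz functions. -/
theorem inner_pder_repOn (ν : SignType) (f : TestAlg) (k : Fin 2) (φ ψ : 𝓢(ℝ, ℂ)) :
    ⟪emb (pder k ψ), repOn ν f (emb φ)⟫_ℂ - ⟪emb ψ, repOn ν f (emb (pder k φ))⟫_ℂ =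
      ⟪emb ψ, repOn ν (Complex.I • TestAlg.del k f) (emb φ)⟫_ℂ := by
  have hint : ∀ (χ η : 𝓢(ℝ, ℂ)) (f : TestAlg),
      Integrable fun s => (starRingEnd ℂ) (χ s) * repFun ν f η s := by
    intro χ η f
    obtain ⟨C, hC⟩ : ∃ C, ∀ s, ‖η s‖ ≤ C := ⟨_, fun s => SchwartzMap.norm_le_seminorm ℂ η s⟩
    have h1 : Integrable fun s => (starRingEnd ℂ) (χ s) :=
      Complex.conjCLE.toContinuousLinearMap.integrable_comp χ.integrable
    exact h1.mul_bdd (continuous_repFun ν f η.continuous).aestronglyMeasurable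
      (Filter.Eventually.of_forall (norm_repFun_le ν f hC))
  simp only [inner_repOn_emb, repFun_smul]
  fin_cases k
  · have e : TestAlg.del 0 f = TestAlg.del₁ f := rfl
    have e2 : (pder 0 φ : ℝ → ℂ) = fun s : ℝ => (s : ℂ) * φ s := funext (pder_zero_apply φ)
    simp only [Fin.zero_eta, e]
    rw [← integral_sub (hint _ _ _) (hint _ _ _)]
    congr 1; ext s
    rw [repFun_del₁ ν f φ φ.continuous, e2, pder_zero_apply, map_mul, Complex.conj_ofReal]
    linear_combination ((starRingEnd ℂ) (ψ s) * (s * repFun ν f φ s -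
      repFun ν f (fun s : ℝ => (s : ℂ) * φ s) s)) * Complex.I_mul_I
  · have e : TestAlg.del 1 f = TestAlg.del₂ f := rfl
    have e2 : ∀ s, repFun ν f (pder 1 φ) s = -Complex.I * repFun ν f (deriv φ) s := by
      intro s
      rw [repFun, repFun, ← integral_const_mul]
      congr 1; ext p
      rw [pder_one_apply]; ring
    have hd : ∀ s, HasDerivAt φ (deriv φ s) s := fun s => φ.differentiableAt.hasDerivAt
    have hd' : ∀ s, HasDerivAt ψ (deriv ψ s) s := fun s => ψ.differentiableAt.hasDerivAt
    have i1 := hint (SchwartzMap.derivCLM ℂ ℂ ψ) φ f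
    have i2 := hint ψ (SchwartzMap.derivCLM ℂ ℂ φ) f
    have i3 := hint ψ φ (TestAlg.del₂ f)
    -- Integration by parts in `s`: `repFun` need only be bounded and differentiable, since the
    -- Schwartz function on the left supplies the decay.
    have ibp := integral_bilinear_hasDerivAt_right_eq_neg_left_of_integrable
      (L := ContinuousLinearMap.mul ℝ ℂ) (u := fun s => (starRingEnd ℂ) (ψ s))
      (u' := fun s => (starRingEnd ℂ) (deriv ψ s)) (v := repFun ν f φ)
      (v' := fun s => repFun ν f (deriv φ) s - repFun ν (TestAlg.del₂ f) φ s)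
      (fun s _ => (hd' s).star) (fun s _ => hasDerivAt_repFun ν f
        (SchwartzMap.derivCLM ℂ ℂ φ).continuous hd s)
      (by
        simp only [ContinuousLinearMap.mul_apply', mul_sub]
        exact i2.sub i3)
      (by simp only [ContinuousLinearMap.mul_apply']; exact i1)
      (by simpa only [ContinuousLinearMap.mul_apply'] using hint ψ φ f)
    simp only [ContinuousLinearMap.mul_apply', mul_sub] at ibp
    have ibp' := (integral_sub i2 i3).symm.trans ibp
    simp only [Fin.mk_one, e, e2]
    have e3 : ∀ s, (starRingEnd ℂ) (pder 1 ψ s) * repFun ν f φ s =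
        Complex.I * ((starRingEnd ℂ) (deriv ψ s) * repFun ν f φ s) := by
      intro s
      rw [pder_one_apply]; simp; ring
    have e4 : ∀ s, (starRingEnd ℂ) (ψ s) * (-Complex.I * repFun ν f (deriv φ) s) =
        -Complex.I * ((starRingEnd ℂ) (ψ s) * repFun ν f (deriv φ) s) := fun s => by ring
    have e5 : ∀ s, (starRingEnd ℂ) (ψ s) * (Complex.I * repFun ν (TestAlg.del₂ f) φ s) =
        Complex.I * ((starRingEnd ℂ) (ψ s) * repFun ν (TestAlg.del₂ f) φ s) := fun s => by ring
    simp only [e3, e4, e5, integral_const_mul]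
    have i2' : ∫ s, (starRingEnd ℂ) (ψ s) * repFun ν f (SchwartzMap.derivCLM ℂ ℂ φ) s =
      ∫ s, (starRingEnd ℂ) (ψ s) * repFun ν f (deriv φ) s := rfl
    rw [i2'] at ibp'
    linear_combination Complex.I * ibp'

/-! ### The integrated representation is a faithful `*`-representation -/

theorem phase_add (ν : SignType) (b b' s : ℝ) : phase ν (b + b') s = phase ν b s * phase ν b' s := by
  rw [phase, phase, phase, ← Complex.exp_add]
  congr 1; push_cast; ring

theorem unitaryRep_mul (ν : SignType) (p q : ℝ × ℝ) (φ : L2) :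
    unitaryRep ν (grpMul p q) φ = unitaryRep ν p (unitaryRep ν q φ) := by
  apply Lp.ext
  filter_upwards [unitaryRep_ae ν (grpMul p q) φ, unitaryRep_ae ν p (unitaryRep ν q φ),
    quasi_shift p.1 (unitaryRep_ae ν q φ)] with s h1 h2 h3
  rw [h1, h2, h3]
  -- Translation by `a` rescales `exp (-s)` by `exp (-a)`, which is the twist of the group law.
  have e : phase ν (Real.exp (-p.1) * q.2) s = phase ν q.2 (s + p.1) := by
    rw [phase, phase, neg_add, Real.exp_add]
    congr 3; ring
  simp only [grpMul]
  rw [phase_add, e, mul_assoc, add_assoc]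

theorem unitaryRep_zero (ν : SignType) (φ : L2) : unitaryRep ν (0, 0) φ = φ := by
  apply Lp.ext
  filter_upwards [unitaryRep_ae ν (0, 0) φ] with s h1
  rw [h1]
  simp [phase]

theorem grpMul_grpInv (p : ℝ × ℝ) : grpMul p (grpInv p) = (0, 0) := by
  ext
  · simp [grpMul, grpInv]
  · simp [grpMul, grpInv, ← mul_assoc, ← Real.exp_add]

/-- The unitary representation as isometries. -/
def unitaryIso (ν : SignType) (p : ℝ × ℝ) : L2 →ₗᵢ[ℂ] L2 where
  toFun := unitaryRep ν p
  map_add' := unitaryRep_add ν p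
  map_smul' := unitaryRep_smul ν p
  norm_map' := norm_unitaryRep ν p

theorem inner_unitaryRep (ν : SignType) (p : ℝ × ℝ) (φ ψ : L2) :
    ⟪unitaryRep ν p φ, ψ⟫_ℂ = ⟪φ, unitaryRep ν (grpInv p) ψ⟫_ℂ := by
  rw [← (unitaryIso ν p).inner_map_map φ]
  change _ = ⟪unitaryRep ν p φ, unitaryRep ν p _⟫_ℂ
  rw [← unitaryRep_mul, grpMul_grpInv, unitaryRep_zero]

theorem inner_unitaryRep' (ν : SignType) (p : ℝ × ℝ) (φ ψ : L2) :
    ⟪ψ, unitaryRep ν p φ⟫_ℂ = ⟪unitaryRep ν (grpInv p) ψ, φ⟫_ℂ := by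
  rw [inner_unitaryRep, grpInv_grpInv]

theorem ext_inner_L2 {φ ψ : L2} (h : ∀ χ : L2, ⟪χ, φ⟫_ℂ = ⟪χ, ψ⟫_ℂ) : φ = ψ :=
  ext_inner_left ℂ h

theorem continuous_inner_unitaryRep (ν : SignType) (φ ψ : L2) :
    Continuous fun p : ℝ × ℝ => ⟪ψ, unitaryRep ν p φ⟫_ℂ := 
  continuous_const.inner (continuous_unitaryRep ν φ)

theorem integrable_inner_rep (ν : SignType) (f : TestAlg) (φ ψ : L2) :
    Integrable fun p : ℝ × ℝ => ((Real.exp p.1 : ℂ) * f p) * ⟪ψ, unitaryRep ν p φ⟫_ℂ := by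
  have h := (innerSL ℂ ψ).integrable_comp (integrable_rep ν f φ)
  simpa only [innerSL_apply_apply, inner_smul_right] using h

theorem repOn_add (ν : SignType) (f g : TestAlg) : repOn ν (f + g) = repOn ν f + repOn ν g := by
  refine ContinuousLinearMap.ext fun φ => ext_inner_L2 fun ψ => ?_
  rw [add_apply, inner_add_right, inner_repOn, inner_repOn, inner_repOn,
    ← integral_add (integrable_inner_rep ν f φ ψ) (integrable_inner_rep ν g φ ψ)]
  congr 1; ext p
  rw [TestAlg.add_apply]; ring

theorem repOn_smul (ν : SignType) (c : ℂ) (f : TestAlg) : repOn ν (c • f) = c • repOn ν f := by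
  refine ContinuousLinearMap.ext fun φ => ext_inner_L2 fun ψ => ?_
  rw [smul_apply, inner_smul_right, inner_repOn, inner_repOn, ← integral_const_mul]
  congr 1; ext p
  rw [TestAlg.smul_apply]; ring

theorem repOn_zero (ν : SignType) : repOn ν 0 = 0 := by
  have := repOn_smul ν 0 0
  simpa using this

theorem repOn_mul (ν : SignType) (f g : TestAlg) : repOn ν (f * g) = repOn ν f * repOn ν g := by
  refine ContinuousLinearMap.ext fun φ => ext_inner_L2 fun ψ => ?_
  rw [mul_apply_eq_comp, inner_repOn, inner_repOn]
  -- The left translation `p ↦ q p` absorbs the unitary of `q` into the integral defining the second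
  -- operator.
  have key : ∀ q : ℝ × ℝ, ⟪ψ, unitaryRep ν q (repOn ν g φ)⟫_ℂ =
      ∫ p : ℝ × ℝ, (Real.exp p.1 : ℂ) * (g (grpMul (grpInv q) p) * ⟪ψ, unitaryRep ν p φ⟫_ℂ) := by
    intro q
    have hm : ∀ r, Continuous fun p => grpMul r p := fun r =>
      continuous_grpMul.comp (by fun_prop : Continuous fun p : ℝ × ℝ => (r, p))
    have hc : Continuous fun p => g (grpMul (grpInv q) p) * ⟪ψ, unitaryRep ν p φ⟫_ℂ :=
      (g.continuous.comp (hm _)).mul (continuous_inner_unitaryRep ν φ ψ)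
    have hs : HasCompactSupport
        fun p => g (grpMul (grpInv q) p) * ⟪ψ, unitaryRep ν p φ⟫_ℂ := by
      refine HasCompactSupport.intro (g.hasCompactSupport.isCompact.image (hm q)) fun p hp => ?_
      by_cases h : grpMul (grpInv q) p ∈ tsupport g
      · exact absurd ⟨_, h, grpMul_inv_cancel_left _ _⟩ hp
      · simp [image_eq_zero_of_notMem_tsupport h]
    rw [inner_unitaryRep', inner_repOn, ← integral_grpMul q hc hs]
    congr 1; ext p
    rw [grpInv_mul_cancel_left, inner_unitaryRep, grpInv_grpInv, ← unitaryRep_mul]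
    ring
  simp only [key, TestAlg.mul_apply, ← integral_const_mul, ← integral_mul_const]
  rw [integral_integral_swap]
  · congr 1; ext q; congr 1; ext p; ring
  have hf := f.continuous
  have hg : Continuous fun x : (ℝ × ℝ) × (ℝ × ℝ) => g (grpMul (grpInv x.2) x.1) :=
    g.continuous.comp (continuous_grpMul.comp
      ((continuous_grpInv.comp continuous_snd).prodMk continuous_fst))
  have hu : Continuous fun x : (ℝ × ℝ) × (ℝ × ℝ) => ⟪ψ, unitaryRep ν x.1 φ⟫_ℂ :=
    (continuous_inner_unitaryRep ν φ ψ).comp continuous_fst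
  refine Continuous.integrable_of_hasCompactSupport ?_ (HasCompactSupport.intro
    (((f.hasCompactSupport.isCompact.prod g.hasCompactSupport.isCompact).image
      continuous_grpMul).prod f.hasCompactSupport.isCompact) ?_)
  · have h1 : Continuous fun x : (ℝ × ℝ) × (ℝ × ℝ) => (Real.exp x.1.1 : ℂ) := by fun_prop
    have h2 : Continuous fun x : (ℝ × ℝ) × (ℝ × ℝ) => (Real.exp x.2.1 : ℂ) := by fun_prop
    exact (h1.mul (h2.mul ((hf.comp continuous_snd).mul hg))).mul hu
  · rintro ⟨p, q⟩ hx
    by_cases hq : q ∈ tsupport f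
    · by_cases h' : grpMul (grpInv q) p ∈ tsupport g
      · exact absurd ⟨⟨(q, grpMul (grpInv q) p), ⟨hq, h'⟩, grpMul_inv_cancel_left _ _⟩, hq⟩ hx
      · simp [image_eq_zero_of_notMem_tsupport h']
    · simp [image_eq_zero_of_notMem_tsupport hq]

/-- Inversion transforms the left Haar measure into the right Haar measure. -/
theorem integral_grpInv {F : ℝ × ℝ → ℂ} (hF : Continuous F) (hF' : HasCompactSupport F) :
    ∫ p : ℝ × ℝ, (Real.exp p.1 : ℂ) * F (grpInv p) = ∫ p : ℝ × ℝ, F p := by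
  have i1 : Integrable (fun p : ℝ × ℝ => F p) (volume.prod volume) :=
    hF.integrable_of_hasCompactSupport hF'
  have hs : HasCompactSupport fun p => F (grpInv p) := by
    refine HasCompactSupport.intro (hF'.isCompact.image continuous_grpInv) fun p hp => ?_
    by_contra h
    exact hp ⟨grpInv p, subset_tsupport _ h, grpInv_grpInv p⟩
  have i2 : Integrable (fun p : ℝ × ℝ => (Real.exp p.1 : ℂ) * F (grpInv p))
      (volume.prod volume) :=
    ((by fun_prop : Continuous fun p : ℝ × ℝ => (Real.exp p.1 : ℂ)).mul
      (hF.comp continuous_grpInv)).integrable_of_hasCompactSupport hs.mul_left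
  rw [Measure.volume_eq_prod, integral_prod _ i1, integral_prod _ i2,
    ← integral_neg_eq_self (fun x : ℝ => ∫ y : ℝ, F (x, y))]
  congr 1; ext x
  simp only [integral_const_mul, grpInv]
  have h1 := Measure.integral_comp_mul_left (fun y => F (-x, y)) (-Real.exp x)
  simp only [neg_mul] at h1
  rw [h1, abs_inv, abs_neg, abs_of_pos (Real.exp_pos _), Complex.real_smul, ← mul_assoc,
    Complex.ofReal_inv, mul_inv_cancel₀ (by exact_mod_cast (Real.exp_pos x).ne'), one_mul]

theorem inner_repOn_star (ν : SignType) (f : TestAlg) (φ ψ : L2) :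
    ⟪ψ, repOn ν (star f) φ⟫_ℂ = ⟪repOn ν f ψ, φ⟫_ℂ := by
  have hc : Continuous fun p => (starRingEnd ℂ) (f (grpInv p)) * ⟪ψ, unitaryRep ν p φ⟫_ℂ :=
    (Complex.continuous_conj.comp (f.continuous.comp continuous_grpInv)).mul
      (continuous_inner_unitaryRep ν φ ψ)
  have hs : HasCompactSupport
      fun p => (starRingEnd ℂ) (f (grpInv p)) * ⟪ψ, unitaryRep ν p φ⟫_ℂ := by
    refine HasCompactSupport.intro (f.hasCompactSupport.isCompact.image continuous_grpInv)
      fun p hp => ?_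
    by_cases h : grpInv p ∈ tsupport f
    · exact absurd ⟨grpInv p, h, grpInv_grpInv p⟩ hp
    · simp [image_eq_zero_of_notMem_tsupport h]
  -- The factor `exp (-a)` of the involution cancels the Haar density, and inversion restores it.
  have h := integral_grpInv hc hs
  rw [← inner_conj_symm (repOn ν f ψ) φ, inner_repOn, inner_repOn, ← integral_conj]
  refine Eq.trans ?_ (h.symm.trans ?_)
  · congr 1; ext p
    rw [TestAlg.star_apply, ← mul_assoc, ← Complex.ofReal_mul, ← Real.exp_add]
    simp
  · congr 1; ext p
    rw [grpInv_grpInv, map_mul, map_mul, Complex.conj_ofReal, inner_conj_symm, inner_unitaryRep]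
    ring

/-- By continuity the integrals `repFun` vanish everywhere. Varying the Schwartz function isolates
each `a`, which leaves the Fourier transform of `b ↦ f (a, b)` at the frequencies `ν exp (-s)`. -/
theorem repOn_eq_zero (f : TestAlg) (h : ∀ ν, repOn ν f = 0) : f = 0 := by
  have hf := f.continuous
  have h1 : ∀ ν (φ : 𝓢(ℝ, ℂ)) s, repFun ν f φ s = 0 := by
    intro ν φ s
    have hc := continuous_repFun ν f φ.continuous
    have h0 : ∀ᵐ s, repFun ν f φ s = 0 := by
      refine ae_eq_zero_of_integral_contDiff_smul_eq_zero hc.locallyIntegrable fun g hg hg' => ?_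
      let ψ : 𝓢(ℝ, ℂ) := HasCompactSupport.toSchwartzMap (f := fun x => (g x : ℂ))
        (hg'.comp_left Complex.ofReal_zero) (Complex.ofRealCLM.contDiff.comp hg)
      have h2 := inner_repOn_emb ν f φ ψ
      rw [h ν, zero_apply, inner_zero_right] at h2
      rw [h2]
      congr 1; ext x
      have e : ψ x = (g x : ℂ) := rfl
      rw [e, Complex.conj_ofReal, Complex.real_smul]
    exact congrFun (hc.ae_eq_iff_eq volume continuous_const |>.1 h0) s
  have hsec : ∀ a, Continuous fun b => f (a, b) := fun a => by fun_prop
  have hint : ∀ a, Integrable fun b => f (a, b) := fun a =>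
    (hsec a).integrable_of_hasCompactSupport (HasCompactSupport.intro
      (f.hasCompactSupport.isCompact.image continuous_snd) fun b hb =>
        image_eq_zero_of_notMem_tsupport (f := f) fun h => hb ⟨(a, b), h, rfl⟩)
  have h2 : ∀ ν s a, ∫ b, f (a, b) * phase ν b s = 0 := by
    intro ν s a
    have hph : Continuous fun x : ℝ => phase ν x s :=
      (continuous_phase ν).comp (by fun_prop : Continuous fun x : ℝ => (x, s))
    let F : ℝ → ℂ := fun a => (Real.exp a : ℂ) * ∫ b, f (a, b) * phase ν b s
    have hF : Continuous F := by
      refine (by fun_prop : Continuous fun a : ℝ => (Real.exp a : ℂ)).mul ?_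
      rw [← continuousOn_univ]
      refine continuousOn_integral_of_compact_support
        (f.hasCompactSupport.isCompact.image continuous_snd) (Continuous.continuousOn ?_) ?_
      · simp only [Function.uncurry_def]
        fun_prop
      · intro a b _ hb
        rw [image_eq_zero_of_notMem_tsupport (f := f) fun h => hb ⟨(a, b), h, rfl⟩, zero_mul]
    have h0 : ∀ᵐ a, F a = 0 := by
      refine ae_eq_zero_of_integral_contDiff_smul_eq_zero hF.locallyIntegrable fun g hg hg' => ?_
      let ψ : 𝓢(ℝ, ℂ) := HasCompactSupport.toSchwartzMap (f := fun x => (g x : ℂ))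
        (hg'.comp_left Complex.ofReal_zero) (Complex.ofRealCLM.contDiff.comp hg)
      -- The test function is recentred at `s`, so that its value at `s + a` is `g a`.
      let η : 𝓢(ℝ, ℂ) := SchwartzMap.compSubConstCLM ℂ s ψ
      have h3 := h1 ν η s
      have i1 := integrable_repFun ν f η.continuous s
      rw [repFun, Measure.volume_eq_prod, integral_prod _ i1] at h3
      rw [← h3]
      congr 1; ext a
      have e : η (s + a) = (g a : ℂ) := by
        change ψ (s + a - s) = _
        rw [add_sub_cancel_left]; rfl
      simp only [F, e]
      rw [Complex.real_smul, ← integral_const_mul, ← integral_const_mul]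
      congr 1; ext b
      ring
    have h4 : F a = 0 := congrFun (hF.ae_eq_iff_eq volume continuous_const |>.1 h0) a
    exact (mul_eq_zero.1 h4).resolve_left (by exact_mod_cast (Real.exp_pos a).ne')
  ext ⟨a, b⟩
  have h5 : (fun b => f (a, b)) =ᵐ[volume] 0 := by
    refine ae_eq_zero_of_integral_exp (hint a) ?_
    -- The two signs of `ν` reach all non-zero frequencies; frequency zero follows by continuity.
    have hne : ∀ t : ℝ, t ≠ 0 → ∫ s, Complex.exp (Complex.I * ((t * s : ℝ) : ℂ)) * f (a, s) = 0 := by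
      intro t ht
      rcases lt_or_gt_of_ne ht with ht | ht
      · rw [← h2 (-1) (-Real.log (-t)) a]
        congr 1; ext b
        rw [mul_comm, phase, neg_neg, Real.exp_log (by linarith)]
        congr 4
        simp; ring
      · rw [← h2 1 (-Real.log t) a]
        congr 1; ext b
        rw [mul_comm, phase, neg_neg, Real.exp_log ht]
        congr 4
        simp; ring
    have hcont : Continuous fun t : ℝ =>
        ∫ s, Complex.exp (Complex.I * ((t * s : ℝ) : ℂ)) * f (a, s) := by
      rw [← continuousOn_univ]
      refine continuousOn_integral_of_compact_support
        (f.hasCompactSupport.isCompact.image continuous_snd) (Continuous.continuousOn ?_) ?_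
      · simp only [Function.uncurry_def]
        fun_prop
      · intro t b _ hb
        rw [image_eq_zero_of_notMem_tsupport (f := f) fun h => hb ⟨(a, b), h, rfl⟩, mul_zero]
    have hd : Dense {t : ℝ | t ≠ 0} := dense_compl_singleton 0
    exact congrFun (hcont.ext_on hd continuous_const hne)
  exact congrFun ((hsec a).ae_eq_iff_eq volume continuous_const |>.1 h5) b

/-- The representation as a `*`-homomorphism. -/
def repHom : TestAlg →⋆ₙₐ[ℂ] (HSpace →L[ℂ] HSpace) where
  toFun := rep
  map_smul' c f := ContinuousLinearMap.ext fun x => by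
    ext1 i
    change repOn i.1 (c • f) (x i) = c • repOn i.1 f (x i)
    rw [repOn_smul]; rfl
  map_zero' := ContinuousLinearMap.ext fun x => by
    ext1 i
    change repOn i.1 0 (x i) = 0
    rw [repOn_zero]; rfl
  map_add' f g := ContinuousLinearMap.ext fun x => by
    ext1 i
    change repOn i.1 (f + g) (x i) = repOn i.1 f (x i) + repOn i.1 g (x i)
    rw [repOn_add]; rfl
  map_mul' f g := ContinuousLinearMap.ext fun x => by
    ext1 i
    change repOn i.1 (f * g) (x i) = repOn i.1 f (repOn i.1 g (x i))
    rw [repOn_mul]; rfl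
  map_star' f := by
    rw [ContinuousLinearMap.star_eq_adjoint, ContinuousLinearMap.eq_adjoint_iff]
    intro x y
    simp only [PiLp.inner_apply, rep_apply]
    refine Finset.sum_congr rfl fun i _ => ?_
    rw [← inner_conj_symm, inner_repOn_star, inner_conj_symm]

theorem rep_injective : Function.Injective rep := by
  intro f g h
  rw [← sub_eq_zero]
  refine repOn_eq_zero _ fun ν => ContinuousLinearMap.ext fun φ => ?_
  have h1 : rep (f - g) = 0 := by
    change repHom (f - g) = 0
    rw [map_sub, sub_eq_zero]; exact h
  have h2 := congrArg (fun T : HSpace →L[ℂ] HSpace => T (WithLp.toLp 2 fun _ => φ) (ν, 0)) h1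
  exact h2

/-! ### Regularity -/

/-- The matrix of `π_ν(f)` in the Hermite basis. -/
def repMat (ν : SignType) (f : TestAlg) (m n : ℕ) : ℂ := ⟪emb (herm m), repOn ν f (emb (herm n))⟫_ℂ

theorem inner_raise_repOn (ν : SignType) (f : TestAlg) (φ ψ : 𝓢(ℝ, ℂ)) :
    ⟪emb (raise ψ), repOn ν f (emb φ)⟫_ℂ = ⟪emb ψ, repOn ν f (emb (lower φ))⟫_ℂ +
      ⟪emb ψ, repOn ν (Complex.I • TestAlg.del 0 f + Complex.I • (Complex.I • TestAlg.del 1 f))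
        (emb φ)⟫_ℂ := by
  have h0 := inner_pder_repOn ν f 0 φ ψ
  have h1 := inner_pder_repOn ν f 1 φ ψ
  rw [repOn_add, repOn_smul ν Complex.I (Complex.I • _)]
  simp only [raise, lower, LinearMap.sub_apply, LinearMap.add_apply, LinearMap.smul_apply, map_sub,
    map_add, map_smul, add_apply, smul_apply, inner_sub_left, inner_add_right, inner_smul_left,
    inner_smul_right, Complex.conj_I]
  linear_combination h0 + Complex.I * h1

theorem inner_lower_repOn (ν : SignType) (f : TestAlg) (φ ψ : 𝓢(ℝ, ℂ)) :
    ⟪emb (lower ψ), repOn ν f (emb φ)⟫_ℂ = ⟪emb ψ, repOn ν f (emb (raise φ))⟫_ℂ +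
      ⟪emb ψ, repOn ν (Complex.I • TestAlg.del 0 f +
        (-Complex.I) • (Complex.I • TestAlg.del 1 f)) (emb φ)⟫_ℂ := by
  have h0 := inner_pder_repOn ν f 0 φ ψ
  have h1 := inner_pder_repOn ν f 1 φ ψ
  rw [repOn_add, repOn_smul ν (-Complex.I) (Complex.I • _)]
  simp only [raise, lower, LinearMap.sub_apply, LinearMap.add_apply, LinearMap.smul_apply, map_sub,
    map_add, map_smul, add_apply, smul_apply, inner_sub_right, inner_add_left, inner_add_right,
    inner_smul_left, inner_smul_right, Complex.conj_I]
  linear_combination h0 - Complex.I * h1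

/-- The matrix coefficient `√(2 m)` of the ladder operators. -/
def lad (m : ℕ) : ℝ := √(2 * m)

theorem lad_zero : lad 0 = 0 := by simp [lad]

theorem lad_sq (m : ℕ) : (lad m : ℂ) * lad m = 2 * m := by
  rw [← Complex.ofReal_mul, lad, Real.mul_self_sqrt (by positivity)]
  push_cast; rfl

theorem emb_raise_herm (m : ℕ) : emb (raise (herm m)) = (lad (m + 1) : ℂ) • emb (herm (m + 1)) := by
  rw [raise_herm, map_smul, lad]; push_cast; rfl

theorem emb_lower_herm (m : ℕ) : emb (lower (herm m)) = (lad m : ℂ) • emb (herm (m - 1)) := by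
  cases m with
  | zero => rw [lower_herm_zero, lad_zero]; simp
  | succ m => rw [lower_herm_succ, map_smul, lad]; push_cast; rfl

/-- The error term is again a matrix of the representation, and later estimates are uniform in the
algebra element, so its existence is enough. The truncated `n - 1` at `n = 0` is harmless because
`lad 0 = 0`. -/
theorem exists_repMat_raise (ν : SignType) (f : TestAlg) : ∃ g : TestAlg, ∀ m n : ℕ,
    (lad (m + 1) : ℂ) * repMat ν f (m + 1) n =
      lad n * repMat ν f m (n - 1) + repMat ν g m n := by
  refine ⟨Complex.I • TestAlg.del 0 f + Complex.I • (Complex.I • TestAlg.del 1 f), fun m n => ?_⟩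
  have := inner_raise_repOn ν f (herm n) (herm m)
  rw [emb_raise_herm, emb_lower_herm, inner_smul_left, Complex.conj_ofReal, map_smul,
    inner_smul_right] at this
  exact this

theorem exists_repMat_lower (ν : SignType) (f : TestAlg) : ∃ g : TestAlg, ∀ m n : ℕ,
    (lad m : ℂ) * repMat ν f (m - 1) n =
      lad (n + 1) * repMat ν f m (n + 1) + repMat ν g m n := by
  refine ⟨Complex.I • TestAlg.del 0 f + (-Complex.I) • (Complex.I • TestAlg.del 1 f),
    fun m n => ?_⟩
  have := inner_lower_repOn ν f (herm n) (herm m)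
  rw [emb_raise_herm, emb_lower_herm, inner_smul_left, Complex.conj_ofReal, map_smul,
    inner_smul_right] at this
  exact this

/-- The commutator with the number operator. -/
theorem exists_sub_mul_repMat (ν : SignType) (f : TestAlg) : ∃ g h : TestAlg, ∀ m n : ℕ,
    2 * ((m : ℂ) - n) * repMat ν f m n =
      lad m * repMat ν g (m - 1) n + lad n * repMat ν h m (n - 1) := by
  obtain ⟨g, hg⟩ := exists_repMat_raise ν f
  obtain ⟨h, hh⟩ := exists_repMat_lower ν f
  refine ⟨g, h, fun m n => ?_⟩
  -- Both `2 m` and `2 n` times the entry are compared with the same entry at `(m - 1, n - 1)`; that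
  -- entry cancels in the difference.
  have e1 : (lad m : ℂ) * lad m * repMat ν f m n =
      lad m * lad n * repMat ν f (m - 1) (n - 1) + lad m * repMat ν g (m - 1) n := by
    cases m with
    | zero => simp [lad_zero]
    | succ m =>
      have := hg m n
      rw [Nat.add_sub_cancel]
      linear_combination (lad (m + 1) : ℂ) * this
  have e2 : (lad m : ℂ) * lad n * repMat ν f (m - 1) (n - 1) =
      lad n * lad n * repMat ν f m n + lad n * repMat ν h m (n - 1) := by
    cases n with
    | zero => simp [lad_zero]
    | succ n =>
      have := hh m n
      rw [Nat.add_sub_cancel]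
      linear_combination (lad (n + 1) : ℂ) * this
  rw [lad_sq] at e1
  rw [lad_sq] at e2
  linear_combination e1 + e2

/-- One more ladder relation moves the unbounded coefficient from the column to the row, so that the
whole loss can be charged to the row index. -/
theorem exists_sub_mul_repMat_left (ν : SignType) (f : TestAlg) : ∃ g h k : TestAlg, ∀ m n : ℕ,
    2 * ((m : ℂ) - n) * repMat ν f m n = lad m * repMat ν g (m - 1) n +
      lad (m + 1) * repMat ν h (m + 1) n - repMat ν k m n := by
  obtain ⟨g, h, hgh⟩ := exists_sub_mul_repMat ν f
  obtain ⟨k, hk⟩ := exists_repMat_raise ν h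
  exact ⟨g, h, k, fun m n => by linear_combination hgh m n - hk m n⟩

theorem exists_sub_mul_repMat_right (ν : SignType) (f : TestAlg) : ∃ g h k : TestAlg, ∀ m n : ℕ,
    2 * ((m : ℂ) - n) * repMat ν f m n = lad n * repMat ν h m (n - 1) +
      lad (n + 1) * repMat ν g m (n + 1) + repMat ν k m n := by
  obtain ⟨g, h, hgh⟩ := exists_sub_mul_repMat ν f
  obtain ⟨k, hk⟩ := exists_repMat_lower ν g
  exact ⟨g, h, k, fun m n => by linear_combination hgh m n + hk m n⟩

/-- The weight `√(m + 1)`. -/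
def wt (m : ℕ) : ℝ := √(m + 1)

theorem wt_pos (m : ℕ) : 0 < wt m := Real.sqrt_pos.2 (by positivity)

theorem one_le_wt (m : ℕ) : 1 ≤ wt m := Real.one_le_sqrt.2 (by simp)

theorem wt_ne_zero (m : ℕ) : (wt m : ℂ) ≠ 0 := by exact_mod_cast (wt_pos m).ne'

/-- The matrix `(m - n) ^ l / (wt m ^ i wt n ^ j) M m n` is bounded. -/
def BddOrder (i j l : ℕ) (M : ℕ → ℕ → ℂ) : Prop :=
  BddMat fun (m n : ℕ) => ((m : ℂ) - n) ^ l / (wt m ^ i * wt n ^ j) * M m n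

/-! ### Weighted bounds for powers of `m - n` times the representation matrix. -/

namespace BddOrder

variable {i j l : ℕ} {M N : ℕ → ℕ → ℂ}

theorem add (hM : BddOrder i j l M) (hN : BddOrder i j l N) :
    BddOrder i j l fun m n => M m n + N m n := by
  exact (congrArg BddMat (by funext m n; ring)).mp (BddMat.add hM hN)

theorem smul (a : ℂ) (hM : BddOrder i j l M) : BddOrder i j l fun m n => a * M m n := by
  exact (congrArg BddMat (by funext m n; ring)).mp (BddMat.smul a hM)

theorem transpose (hM : BddOrder i j l M) : BddOrder j i l fun m n => M n m := by
  have h := BddMat.smul ((-1) ^ l) (BddMat.transpose hM)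
  refine (congrArg BddMat ?_).mp h
  funext m n
  have e : (m : ℂ) - n = -1 * (n - m) := by ring
  rw [e, mul_pow]
  ring

theorem succ_left (hM : BddOrder i j l M) : BddOrder (i + 1) j l M := by
  have h := BddMat.mul_left hM (c := fun m : ℕ => (wt m : ℂ)⁻¹) (K := 1) fun m => by
    rw [norm_inv, Complex.norm_real, Real.norm_of_nonneg (wt_pos m).le]
    exact inv_le_one_of_one_le₀ (one_le_wt m)
  refine (congrArg BddMat ?_).mp h
  funext m n
  have := wt_ne_zero m
  have := wt_ne_zero n
  field_simp
  ring

/-- Expand `(m - n)^l` binomially around `τ m - n`, hence the need for all lower powers. The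
coefficient `d` costs one weight, and `wt (τ m) ≤ 2 wt m` makes the change of weights cost at most
`2 ^ i`. -/
theorem shift_left (hM : ∀ k ≤ l, BddOrder i j k M) {τ : ℕ → ℕ} {d : ℕ → ℝ} {ε : ℂ} {K : ℝ}
    (hτ : Set.InjOn τ {m | d m ≠ 0}) (hε : ∀ m, d m ≠ 0 → (m : ℂ) = τ m + ε)
    (hd : ∀ m, |d m| ≤ K * wt m) (hw : ∀ m, wt (τ m) ≤ 2 * wt m) :
    BddOrder (i + 1) j l fun m n => d m * M (τ m) n := by
  have h := BddMat.sum (Finset.range (l + 1)) (M := fun (k m n : ℕ) => ε ^ (l - k) * (l.choose k) *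
    (((d m * wt (τ m) ^ i / wt m ^ (i + 1) : ℝ) : ℂ) *
      (((τ m : ℂ) - n) ^ k / (wt (τ m) ^ i * wt n ^ j) * M (τ m) n))) fun k hk => by
    have hM' : BddMat fun (m n : ℕ) => ((m : ℂ) - n) ^ k / (wt m ^ i * wt n ^ j) * M m n :=
      hM k (by have := Finset.mem_range.1 hk; omega)
    refine BddMat.smul _ (BddMat.comp_left hM'
      (c := fun m => ((d m * wt (τ m) ^ i / wt m ^ (i + 1) : ℝ) : ℂ)) (K := K * 2 ^ i)
      (fun m => ?_) (hτ.mono fun m hm => ?_))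
    swap
    · intro (h0 : d m = 0)
      exact hm (by simp [h0])
    have h1 := wt_pos m
    rw [Complex.norm_real, Real.norm_eq_abs, abs_div, abs_mul,
      abs_of_nonneg (pow_nonneg (wt_pos (τ m)).le i), abs_of_nonneg (pow_nonneg h1.le (i + 1)),
      div_le_iff₀ (by positivity)]
    calc |d m| * wt (τ m) ^ i ≤ (K * wt m) * (2 * wt m) ^ i :=
          mul_le_mul (hd m) (pow_le_pow_left₀ (wt_pos _).le (hw m) i)
            (pow_nonneg (wt_pos _).le i) ((abs_nonneg _).trans (hd m))
      _ = _ := by ring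
  refine (congrArg BddMat ?_).mp h
  funext m n
  by_cases h0 : d m = 0
  · simp [h0]
  · have e : (m : ℂ) - n = (τ m - n) + ε := by rw [hε m h0]; ring
    rw [e, add_pow, Finset.sum_div, Finset.sum_mul]
    refine Finset.sum_congr rfl fun k _ => ?_
    have := wt_ne_zero m
    have := wt_ne_zero n
    have := wt_ne_zero (τ m)
    push_cast
    field_simp

theorem lad_le (m : ℕ) : |lad m| ≤ 2 * wt m := by
  rw [lad, abs_of_nonneg (Real.sqrt_nonneg _), wt]
  refine Real.sqrt_le_iff.2 ⟨by positivity, ?_⟩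
  rw [mul_pow, Real.sq_sqrt (by positivity)]
  have : (0 : ℝ) ≤ m := by positivity
  linarith

theorem lad_pred (hM : ∀ k ≤ l, BddOrder i j k M) :
    BddOrder (i + 1) j l fun m n => lad m * M (m - 1) n := by
  have h0 : ∀ m, lad m ≠ 0 → 1 ≤ m := fun m hm => by
    by_contra h
    have : m = 0 := by omega
    subst this
    exact hm lad_zero
  refine shift_left hM (ε := 1) (K := 2) (fun a ha b hb hab => ?_) (fun m hm => ?_) lad_le
    fun m => ?_
  · have := h0 a ha; have := h0 b hb; have : a - 1 = b - 1 := hab; omega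
  · have h1 := h0 m hm
    push_cast [h1]; ring
  · have h1 : wt (m - 1) ≤ wt m := by
      refine Real.sqrt_le_sqrt ?_
      have : ((m - 1 : ℕ) : ℝ) ≤ m := by exact_mod_cast Nat.sub_le m 1
      linarith
    linarith [wt_pos m]

theorem lad_succ (hM : ∀ k ≤ l, BddOrder i j k M) :
    BddOrder (i + 1) j l fun m n => lad (m + 1) * M (m + 1) n := by
  have hw : ∀ m, wt (m + 1) ≤ 2 * wt m := by
    intro m
    refine Real.sqrt_le_iff.2 ⟨by have := wt_pos m; positivity, ?_⟩
    rw [mul_pow, wt, Real.sq_sqrt (by positivity)]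
    push_cast
    have : (0 : ℝ) ≤ m := by positivity
    linarith
  refine shift_left hM (τ := fun m => m + 1) (d := fun m => lad (m + 1)) (ε := -1) (K := 4)
    (fun a _ b _ hab => by simp only at hab; omega) (fun m _ => by push_cast; ring) (fun m => ?_) hw
  have := lad_le (m + 1)
  linarith [hw m]

end BddOrder

/-- Each factor `m - n` is traded for one weight: the left form of the commutator is used when a row
weight is available, the right form otherwise. The column statements are transposes of the row ones.
-/
theorem bddOrder_repMat (ν : SignType) (l : ℕ) : ∀ (i j : ℕ), l ≤ i + j → ∀ f : TestAlg,
    BddOrder i j l (repMat ν f) := by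
  induction l using Nat.strong_induction_on with
  | _ l ih =>
  have hleft : ∀ i j, l ≤ i + j → ∀ f, BddOrder i j l (repMat ν f) := by
    intro i j hij f
    cases l with
    | zero =>
      have h := BddMat.of_clm orthonormal_herm orthonormal_herm (repOn ν f)
      have hK : ∀ i m, ‖((wt m : ℂ) ^ i)⁻¹‖ ≤ 1 := fun i m => by
        rw [norm_inv, norm_pow, Complex.norm_real, Real.norm_of_nonneg (wt_pos m).le]
        exact inv_le_one_of_one_le₀ (one_le_pow₀ (one_le_wt m))
      refine (congrArg BddMat ?_).mp ((h.mul_left (hK i)).mul_right (hK j))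
      funext m n
      rw [pow_zero, one_div, mul_inv, repMat]
      ring
    | succ l =>
      have hle : ∀ i j, l ≤ i + j → ∀ k ≤ l, ∀ f, BddOrder i j k (repMat ν f) :=
        fun i j h k hk f => ih k (by omega) i j (by omega) f
      have hconv : ∀ {N : ℕ → ℕ → ℂ}, (∀ m n : ℕ, 2 * ((m : ℂ) - n) * repMat ν f m n = N m n) →
          BddOrder i j l N → BddOrder i j (l + 1) (repMat ν f) := by
        intro N hN h
        refine (congrArg BddMat ?_).mp (h.smul (1 / 2))
        funext m n
        beta_reduce
        rw [← hN]; ring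
      cases i with
      | succ i =>
        obtain ⟨g, h, k, hghk⟩ := exists_sub_mul_repMat_left ν f
        refine hconv hghk ?_
        have hl : l ≤ i + j := by omega
        have h1 := BddOrder.lad_pred fun k hk => hle i j hl k hk g
        have h2 := BddOrder.lad_succ fun k hk => hle i j hl k hk h
        have h3 := ((hle i j hl l le_rfl k).succ_left).smul (-1)
        refine (congrArg (BddOrder (i + 1) j l) ?_).mp ((h1.add h2).add h3)
        funext m n; ring
      | zero =>
        obtain ⟨j, rfl⟩ : ∃ j', j = j' + 1 := ⟨j - 1, by omega⟩
        obtain ⟨g, h, k, hghk⟩ := exists_sub_mul_repMat_right ν f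
        refine hconv hghk ?_
        have hl : l ≤ 0 + j := by omega
        have h1 := (BddOrder.lad_pred fun k hk => (hle 0 j hl k hk h).transpose).transpose
        have h2 := (BddOrder.lad_succ fun k hk => (hle 0 j hl k hk g).transpose).transpose
        have h3 := ((hle 0 j hl l le_rfl k).transpose.succ_left).transpose
        exact (h1.add h2).add h3
  exact hleft

/-- The weight `√(2 (m + j))`. -/
def wtP (j m : ℕ) : ℝ := √(2 * (m + (j : ℝ)))

/-- The weight `√(2 (m + j) + 1)`. -/
def wtL (j m : ℕ) : ℝ := √(2 * (m + (j : ℝ)) + 1)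

theorem wtL_pos (j m : ℕ) : 0 < wtL j m := Real.sqrt_pos.2 (by positivity)

theorem wtL_sq (j m : ℕ) : wtL j m ^ 2 = 2 * (m + (j : ℝ)) + 1 := Real.sq_sqrt (by positivity)

theorem wt_le_wtL (j m : ℕ) : wt m ≤ wtL j m := by
  refine Real.sqrt_le_sqrt ?_
  have : (0 : ℝ) ≤ m := by positivity
  have : (0 : ℝ) ≤ j := by positivity
  linarith

/-- The Schur multiplier needs positive weights, whereas `wtP 0 0 = 0`; the shift by one under the
root moves every weight by at most one. -/
theorem abs_wtL_sub_wtP_le (j m : ℕ) : |wtL j m - wtP j m| ≤ 1 := by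
  have h1 := wtL_sq j m
  have h2 : wtP j m ^ 2 = 2 * (m + (j : ℝ)) := Real.sq_sqrt (by positivity)
  have h3 := wtL_pos j m
  have h4 : 0 ≤ wtP j m := Real.sqrt_nonneg _
  rw [abs_le]
  constructor <;> nlinarith

theorem BddMat.schur_pow {ι κ : Type*} {M : ι → κ → ℂ} (hM : BddMat M) {q : ι → ℝ} {r : κ → ℝ}
    (hq : ∀ i, 0 < q i) (hr : ∀ j, 0 < r j) (a : ℕ) :
    BddMat fun i j => ((q i * r j / (q i + r j) ^ 2 : ℝ) : ℂ) ^ a * M i j := by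
  induction a with
  | zero => simpa using hM
  | succ a ih => simpa only [pow_succ', mul_assoc] using ih.schur hq hr

/-- Raise `x - y = (xy/(x+y)²) (1/x + 1/y) (x² - y²)` to the power `a`, where `x² - y² = 2(m-n) +
2(j-j')`. Both remaining binomials are expanded: the term with indices `i, l` has order `(i, a - i,
l)` with `l ≤ a`, and the first factor is the Schur multiplier. -/
theorem bddMat_wtL_pow (ν : SignType) (f : TestAlg) (j j' a : ℕ) :
    BddMat fun (m n : ℕ) => ((wtL j m : ℂ) - wtL j' n) ^ a * repMat ν f m n := by
  have h1 : BddMat fun (m n : ℕ) => ∑ i ∈ Finset.range (a + 1), ∑ l ∈ Finset.range (a + 1),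
      ((a.choose i) * (a.choose l) * 2 ^ l * (2 * ((j : ℂ) - j')) ^ (a - l)) *
        (((wt n / wtL j' n : ℝ) : ℂ) ^ (a - i) * (((wt m / wtL j m : ℝ) : ℂ) ^ i *
          (((m : ℂ) - n) ^ l / (wt m ^ i * wt n ^ (a - i)) * repMat ν f m n))) := by
    refine BddMat.sum _ fun i hi => BddMat.sum _ fun l hl => BddMat.smul _ ?_
    have hi' := Finset.mem_range.1 hi
    have hl' := Finset.mem_range.1 hl
    have hK : ∀ j k m, ‖((wt m / wtL j m : ℝ) : ℂ) ^ k‖ ≤ 1 := fun j k m => by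
      have h1 := wt_pos m
      have h2 := wtL_pos j m
      rw [norm_pow, Complex.norm_real, Real.norm_of_nonneg (by positivity)]
      exact pow_le_one₀ (by positivity) ((div_le_one h2).2 (wt_le_wtL j m))
    exact ((bddOrder_repMat ν l i (a - i) (by omega) f).mul_left (hK j i)).mul_right
      (hK j' (a - i))
  refine (congrArg BddMat ?_).mp (h1.schur_pow (wtL_pos j) (wtL_pos j') a)
  funext m n
  have w1 := wt_ne_zero m
  have w2 := wt_ne_zero n
  have p1 := wtL_pos j m
  have p2 := wtL_pos j' n
  have l1 : (wtL j m : ℂ) ≠ 0 := by exact_mod_cast p1.ne'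
  have l2 : (wtL j' n : ℂ) ≠ 0 := by exact_mod_cast p2.ne'
  have l3 : (wtL j m : ℂ) + wtL j' n ≠ 0 := by exact_mod_cast (add_pos p1 p2).ne'
  have s1 : (wtL j m : ℂ) ^ 2 = 2 * (m + j) + 1 := by exact_mod_cast wtL_sq j m
  have s2 : (wtL j' n : ℂ) ^ 2 = 2 * (n + j') + 1 := by exact_mod_cast wtL_sq j' n
  have e1 : ∑ i ∈ Finset.range (a + 1), ∑ l ∈ Finset.range (a + 1),
      ((a.choose i) * (a.choose l) * 2 ^ l * (2 * ((j : ℂ) - j')) ^ (a - l)) *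
        (((wt n / wtL j' n : ℝ) : ℂ) ^ (a - i) * (((wt m / wtL j m : ℝ) : ℂ) ^ i *
          (((m : ℂ) - n) ^ l / (wt m ^ i * wt n ^ (a - i)) * repMat ν f m n))) =
      (((wtL j m : ℂ)⁻¹ + (wtL j' n : ℂ)⁻¹) ^ a * (2 * ((m : ℂ) - n) + 2 * ((j : ℂ) - j')) ^ a) *
        repMat ν f m n := by
    rw [add_pow, add_pow, Finset.sum_mul_sum, Finset.sum_mul]
    refine Finset.sum_congr rfl fun i _ => ?_
    rw [Finset.sum_mul]
    refine Finset.sum_congr rfl fun l _ => ?_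
    push_cast
    rw [div_pow, div_pow, inv_pow, inv_pow, mul_pow 2 ((m : ℂ) - n)]
    field_simp
  rw [e1, ← mul_assoc, ← mul_pow, ← mul_pow]
  congr 2
  have e2 : 2 * ((m : ℂ) - n) + 2 * ((j : ℂ) - j') = (wtL j m : ℂ) ^ 2 - wtL j' n ^ 2 := by
    rw [s1, s2]; ring
  rw [e2]
  push_cast
  field_simp
  ring

theorem bddMat_wtP_pow (ν : SignType) (f : TestAlg) (j j' k : ℕ) :
    BddMat fun (m n : ℕ) => ((wtP j m : ℂ) - wtP j' n) ^ k * repMat ν f m n := by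
  -- Mixed powers make the induction close: a factor in `wtP` is one in `wtL` plus bounded functions
  -- of `m` and of `n` separately.
  have h : ∀ k a : ℕ, BddMat fun (m n : ℕ) => ((wtP j m : ℂ) - wtP j' n) ^ k *
      (((wtL j m : ℂ) - wtL j' n) ^ a * repMat ν f m n) := by
    intro k
    induction k with
    | zero => intro a; simpa using bddMat_wtL_pow ν f j j' a
    | succ k ih =>
      intro a
      have hK : ∀ j m, ‖((wtL j m - wtP j m : ℝ) : ℂ)‖ ≤ 1 := fun j m => by
        rw [Complex.norm_real]; exact abs_wtL_sub_wtP_le j m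
      refine (congrArg BddMat ?_).mp (((ih (a + 1)).sub ((ih a).mul_left (hK j))).add
        ((ih a).mul_right (hK j')))
      funext m n
      push_cast
      ring
  simpa using h k 0

/-! ### Matrix elements on the full Hilbert space, the commutator and regularity. -/

theorem hBasis_repOn (ν : SignType) (f : TestAlg) (m n : ℕ) :
    ⟪hermBasis m, repOn ν f (hermBasis n)⟫_ℂ = repMat ν f m n := by
  rw [hermBasis_apply, hermBasis_apply, repMat]

theorem inner_rep (f : TestAlg) (x y : SignType × Fin 2) (m n : ℕ) :
    ⟪hBasis (x, m), rep f (hBasis (y, n))⟫_ℂ = if x = y then repMat x.1 f m n else 0 := by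
  rw [inner_hBasis, rep_apply, hBasis_apply]
  split_ifs with h
  · exact hBasis_repOn _ _ _ _
  · rw [map_zero, inner_zero_right]

theorem inner_spinMat_rep (M : Matrix (Fin 2) (Fin 2) ℂ) (f : TestAlg) (x y : SignType × Fin 2)
    (m n : ℕ) : ⟪hBasis (x, m), (spinMat M ∘L rep f) (hBasis (y, n))⟫_ℂ =
      (if x.1 = y.1 then M x.2 y.2 else 0) * repMat x.1 f m n := by
  obtain ⟨μ, i⟩ := x
  obtain ⟨ν, j⟩ := y
  rw [inner_hBasis, ContinuousLinearMap.comp_apply, spinMat_apply, inner_sum]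
  simp only [inner_smul_right, rep_apply, hBasis_apply, Prod.mk.injEq]
  by_cases h : μ = ν
  · subst h
    simp only [true_and, if_true]
    rw [Finset.sum_eq_single j]
    · rw [if_pos rfl, hBasis_repOn]
    · intro k _ hk
      rw [if_neg hk, map_zero, inner_zero_right, mul_zero]
    · simp
  · simp [h]

theorem inner_diracCore_rep (f : TestAlg) (φ ψ : SCore) :
    ⟪coreIncl (diracCore ψ), rep f (coreIncl φ)⟫_ℂ -
        ⟪coreIncl ψ, rep f (coreIncl (diracCore φ))⟫_ℂ =
      ⟪coreIncl ψ, (∑ k, spinMat (gam k) ∘L rep (Complex.I • TestAlg.del k f)) (coreIncl φ)⟫_ℂ := by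
  rw [Fin.sum_univ_two, add_apply, ContinuousLinearMap.comp_apply, ContinuousLinearMap.comp_apply]
  simp only [PiLp.inner_apply, PiLp.add_apply, spinMat_apply, rep_apply, coreIncl_apply,
    Fintype.sum_prod_type, Fin.sum_univ_two, diracCore_apply_zero, diracCore_apply_one,
    inner_raise_repOn, inner_lower_repOn]
  rw [← Finset.sum_sub_distrib]
  refine Finset.sum_congr rfl fun ν _ => ?_
  rw [repOn_add, repOn_add, repOn_smul ν Complex.I (Complex.I • _),
    repOn_smul ν (-Complex.I) (Complex.I • _)]
  simp only [gam, Matrix.of_apply, Matrix.cons_val', Matrix.cons_val_zero, Matrix.cons_val_one,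
    Matrix.cons_val_fin_one, add_apply, smul_apply, inner_add_right, inner_smul_right]
  ring

/-- The commutator `[𝒟, π(f)]`. -/
theorem isCommutator_dirac (f : TestAlg) : IsCommutator dirac (rep f)
    (∑ k, spinMat (gam k) ∘L rep (Complex.I • TestAlg.del k f)) := by
  rw [dirac_eq]
  refine WPerm.isCommutator_op _ _ fun i j => ?_
  rw [hBasis_eq j, hBasis_eq i, ← inner_diracCore_rep, diracCore_coreVec, diracCore_coreVec, map_smul,
    map_smul, map_smul, inner_smul_left, inner_smul_right, Complex.conj_ofReal, hBasis_eq, hBasis_eq]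

/-- Both `π(f)` and its commutator with the Dirac operator have blocks of this form, so one
criterion covers the two halves of regularity. -/
theorem inDomDeltaPow_of_repMat (n : ℕ) (T : HSpace →L[ℂ] HSpace)
    (h : ∀ x y, ∃ (s : Finset ℕ) (c : ℕ → ℂ) (g : ℕ → TestAlg), ∀ m n,
      ⟪hBasis (x, m), T (hBasis (y, n))⟫_ℂ = ∑ a ∈ s, c a * repMat x.1 (g a) m n) :
    InDomDeltaPow ((WPerm.diag diracW.p).op hBasis) n T := by
  refine inDomDeltaPow_of_bddMat hBasis _ n T fun k => BddMat.of_blocks fun x y => ?_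
  obtain ⟨s, c, g, hT⟩ := h x y
  have h1 := BddMat.sum s (M := fun (a m n : ℕ) => c a * (((wtP x.2 m : ℂ) - wtP y.2 n) ^ k *
    repMat x.1 (g a) m n)) fun a _ => (bddMat_wtP_pow x.1 (g a) x.2 y.2 k).smul (c a)
  refine (congrArg BddMat ?_).mp h1
  funext m n
  rw [hT, Finset.mul_sum]
  exact Finset.sum_congr rfl fun a _ => by
    change _ = ((wtP x.2 m : ℂ) - wtP y.2 n) ^ k * _
    ring

theorem isRegularTriple : IsRegularTriple rep dirac := by
  have hp : ∀ i, 0 ≤ diracW.p i := fun i => Real.sqrt_nonneg _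
  refine ⟨(WPerm.diag diracW.p).op hBasis, by rw [dirac_eq]; exact diracW.isAbs_op hBasis hp,
    fun f n => ⟨?_, fun C hC => ?_⟩⟩
  · refine inDomDeltaPow_of_repMat n _ fun x y => ⟨{0}, fun _ => if x = y then 1 else 0,
      fun _ => f, fun m n => ?_⟩
    rw [inner_rep, Finset.sum_singleton]
    split_ifs <;> simp
  · rw [isCommutator_unique isSelfAdjoint_dirac.dense_domain hC (isCommutator_dirac f)]
    refine inDomDeltaPow_of_repMat n _ fun x y => ⟨Finset.range 2,
      fun k => if h : k < 2 then (if x.1 = y.1 then gam ⟨k, h⟩ x.2 y.2 else 0) else 0,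
      fun k => if h : k < 2 then Complex.I • TestAlg.del ⟨k, h⟩ f else 0, fun m n => ?_⟩
    rw [Fin.sum_univ_two, add_apply, inner_add_right, inner_spinMat_rep, inner_spinMat_rep,
      Finset.sum_range_succ, Finset.sum_range_one]
    rfl

end AffineTriple

end

theorem mainTheorem3 :
    IsEvenSpectralTriple rep dirac grading ∧
    IsRegularTriple rep dirac ∧
    HasCompactResolvent dirac ∧
    graphMul dirac dirac = (oscillatorOp.graph : Set (HSpace × HSpace)) ∧
    ∀ f : TestAlg, IsCommutator dirac (rep f)
      (∑ k, spinMat (gam k) ∘L rep (Complex.I • TestAlg.del k f)) := by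
  refine ⟨{
    starHom := ⟨repHom, fun _ => rfl⟩
    faithful := rep_injective
    selfAdjoint := isSelfAdjoint_dirac
    boundedCommutator := fun f => ⟨_, isCommutator_dirac f⟩
    locallyCompact := fun f z hz => by
      obtain ⟨R, hR, hR'⟩ := hasCompactResolvent_dirac z hz
      exact ⟨R, hR, hR'.clm_comp (rep f)⟩
    grading_selfAdjoint := isSelfAdjoint_grading
    grading_sq := grading_grading
    grading_comm := grading_rep
    grading_anticomm := grading_anticomm },
    isRegularTriple, hasCompactResolvent_dirac, graphMul_dirac, isCommutator_dirac⟩
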